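/- Let $H\in(0,1)$, $\theta>0$, $\mu\in\mathbb R$, $\alpha=\mu\theta$. Let $S^H=\{S^H_t,\,t\ge 0\}$ be a subfractional Brownian motion, i.e. a centered Gaussian process with (almost surely) continuous paths and covariance $$E(S^H_tS^H_s)=t^{2H}+s^{2H}-\tfrac12\big((t+s)^{2H}+|t-s|^{2H}\big),\qquad s,t\ge 0,$$ and let $X$ be the (pathwise, continuous) solution of $X_0=0$, $dX_t=\theta(\mu+X_t)\,dt+dS^H_t$, $t\ge0$, that is, $X_t=\theta\int_0^t(\mu+X_s)\,ds+S^H_t$. Consider the estimators $$\widetilde\theta_T=\frac{\frac12TX_T^2-X_T\int_0^TX_s\,ds}{T\int_0^TX_s^2\,ds-\big(\int_0^TX_s\,ds\big)^2},\qquad \widetilde\alpha_T=\frac{X_T\int_0^TX_s^2\,ds-\frac12X_T^2\int_0^TX_s\,ds}{T\int_0^TX_s^2\,ds-\big(\int_0^TX_s\,ds\big)^2},\qquad \widetilde\mu_T=\frac{\int_0^TX_s^2\,ds-\frac12X_T\int_0^TX_s\,ds}{\frac12TX_T-\int_0^TX_s\,ds}.$$ Then, almost surely, as $T\to\infty$,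 $$(\widetilde\theta_T,\widetilde\mu_T)\to(\theta,\mu),\qquad(\widetilde\theta_T,\widetilde\alpha_T)\to(\theta,\alpha).$$ Moreover, the integral $\int_0^\infty e^{-\theta s}S^H_s\,ds$ converges absolutely almost surely, and $$\zeta_\infty:=\theta\int_0^\infty e^{-\theta s}S^H_s\,ds\sim\mathcal N\Big(0,\frac{(1-H)\Gamma(2H+1)}{\theta^{2H}}\Big).$$ Finally, let $\sigma,\lambda>0$ be given by $\sigma^2=H\Gamma(2H)/\theta^{2H}$ and $\lambda^2=2-2^{2H-1}$. If $N_1\sim\mathcal N(0,1)$, $N_2\sim\mathcal N(0,1)$ and $S^H$ are independent (the variables $N_1,N_2$ being defined on the underlying probability space or on an extension of it), then $\zeta_\infty$ is independent of $(N_1,N_2)$ and, as $T\to\infty$, $$\Big(e^{\theta T}(\widetilde\theta_T-\theta),\,T^{1-H}(\widetilde\mu_T-\mu)\Big)\overset{\text{Law}}{\longrightarrow}\Big(\frac{2\theta\sigma N_2}{\mu+\zeta_\infty},\,\frac{\lambda}{\theta}N_1\Big),$$ $$\Big(e^{\theta T}(\widetilde\theta_T-\theta),\,T^{1-H}(\widetilde\alpha_T-\alpha)\Big)\overset{\text{Law}}{\longrightarrow}\Big(\frac{2\theta\sigma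 N_2}{\mu+\zeta_\infty},\,\lambda N_1\Big).$$ -/

import Mathlib

open MeasureTheory ProbabilityTheory Filter Topology
open scoped NNReal

noncomputable section

/-- `S` is a subfractional Brownian motion with parameter `H` under `P`: a centered Gaussian process
with covariance `t^{2H} + s^{2H} - ((t+s)^{2H} + |t-s|^{2H})/2` and almost surely continuous
paths. -/
structure IsSubfractionalBM {Ω : Type*} [MeasurableSpace Ω] (H : ℝ) (S : ℝ≥0 → Ω → ℝ)
    (P : Measure Ω) : Prop where
  measurable : ∀ t, Measurable (S t)
  gaussian : IsGaussianProcess S P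
  centered : ∀ t, ∫ ω, S t ω ∂P = 0
  covariance : ∀ s t, ∫ ω, S t ω * S s ω ∂P =
    (t : ℝ) ^ (2 * H) + (s : ℝ) ^ (2 * H)
      - (1 / 2) * (((t : ℝ) + s) ^ (2 * H) + |(t : ℝ) - s| ^ (2 * H))
  continuous_paths : ∀ᵐ ω ∂P, Continuous fun t => S t ω

/-- `X` solves, path by path, `X_0 = 0`, `dX_t = θ (μ + X_t) dt + dG_t`, where `G_0 = 0`: almost
surely, `X` has continuous paths, starts at zero and satisfies
`X_t = ∫_0^t θ (μ + X_s) ds + G_t` for all `t ≥ 0`. -/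
structure IsVasicekProcess {Ω : Type*} [MeasurableSpace Ω] (θ μ : ℝ) (G X : ℝ≥0 → Ω → ℝ)
    (P : Measure Ω) : Prop where
  initial : ∀ᵐ ω ∂P, X 0 ω = 0
  continuous_paths : ∀ᵐ ω ∂P, Continuous fun t => X t ω
  equation : ∀ᵐ ω ∂P, ∀ t : ℝ≥0,
    X t ω = (∫ s in (0 : ℝ)..t, θ * (μ + X s.toNNReal ω)) + G t ω

/-- `∫_0^T x_s ds` for a path `x` on `[0, ∞)`. -/
def pathInt (x : ℝ≥0 → ℝ) (T : ℝ≥0) : ℝ := ∫ s in (0 : ℝ)..T, x s.toNNReal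

/-- `∫_0^T x_s² ds` for a path `x` on `[0, ∞)`. -/
def pathSqInt (x : ℝ≥0 → ℝ) (T : ℝ≥0) : ℝ := ∫ s in (0 : ℝ)..T, x s.toNNReal ^ 2

/-- The least squares-type estimator of `θ`, as a functional of the observed path. -/
def thetaTilde (x : ℝ≥0 → ℝ) (T : ℝ≥0) : ℝ :=
  ((1 / 2) * T * x T ^ 2 - x T * pathInt x T) / (T * pathSqInt x T - pathInt x T ^ 2)

/-- The least squares-type estimator of `α = μ θ`, as a functional of the observed path. -/
def alphaTilde (x : ℝ≥0 → ℝ) (T : ℝ≥0) : ℝ :=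
  (x T * pathSqInt x T - (1 / 2) * x T ^ 2 * pathInt x T) /
    (T * pathSqInt x T - pathInt x T ^ 2)

/-- The least squares-type estimator of `μ`, as a functional of the observed path. -/
def muTilde (x : ℝ≥0 → ℝ) (T : ℝ≥0) : ℝ :=
  (pathSqInt x T - (1 / 2) * x T * pathInt x T) / ((1 / 2) * T * x T - pathInt x T)

/-- The estimator of `μ` is the quotient of the estimators of `α` and `θ`. -/
theorem muTilde_eq_div (x : ℝ≥0 → ℝ) (T : ℝ≥0) (hx : x T ≠ 0)
    (hD : (T : ℝ) * pathSqInt x T - pathInt x T ^ 2 ≠ 0) :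
    muTilde x T = alphaTilde x T / thetaTilde x T := by
  rw [muTilde, alphaTilde, thetaTilde, div_div_div_cancel_right₀ hD,
    ← mul_div_mul_left _ _ hx]
  congr 1 <;> ring

/-- `ζ_∞ = θ ∫_0^∞ e^{-θ s} G_s ds`, as a functional of the path of `G`. -/
def zetaInf (θ : ℝ) (g : ℝ≥0 → ℝ) : ℝ :=
  θ * ∫ s in Set.Ioi (0 : ℝ), Real.exp (-θ * s) * g s.toNNReal

/-- `σ > 0` with `σ² = H Γ(2H) / θ^{2H}`. -/
def subfSigma (θ H : ℝ) : ℝ := √(H * Real.Gamma (2 * H) / θ ^ (2 * H))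

/-- `λ > 0` with `λ² = 2 - 2^{2H-1}`. -/
def subfLambda (H : ℝ) : ℝ := √(2 - (2 : ℝ) ^ (2 * H - 1))

/-- The variance `(1-H) Γ(2H+1) / θ^{2H}` of `ζ_∞`. -/
def subfZetaVar (θ H : ℝ) : ℝ := (1 - H) * Real.Gamma (2 * H + 1) / θ ^ (2 * H)

end

/-! The argument separates a deterministic expansion along each path from one Gaussian limit
theorem. Write ξ = μ + ζ_∞ and let η_T = e^{-θT} ∫_0^T e^{θs} dS_s be the lagged mean. A moment
bound and chaining show that S grows sublinearly, so the explicit solution of the linear equation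
gives X_T = ξ e^{θT} + O(1 + T) (`IsVasicekPath.abs_sub_exp_le`). The equation itself yields ∫X. The
chain rule for (X - S)², where X - S is continuously differentiable, yields ∫X² up to an integral of
S against μ + X, and there the leading part of X produces η_T. After normalisation the remainder is
a power of T times e^{-θT} (`exists_abs_sqInt_remainder_le`). Since ξ ≠ 0 almost surely, exact
algebraic identities for the estimators then give, almost surely, e^{θT}(θ̃_T - θ) = 2θ η_T/ξ +
o(1), T(α̃_T - α) = S_T - 2η_T + o(1), T(μ̃_T - μ) = (S_T - 2η_T)/θ + o(1). Consistency follows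
because S_T and η_T are o(T).

For the limit in law, S_T, η_T and ζ_∞ are all means of increments of S for the same exponential
probability weight. Hence every linear combination of them is a centered Gaussian
(`exists_hasLaw_comb`), and its variance is a double integral of covariances of increments. These
covariances converge pointwise and are dominated through Cauchy-Schwarz. The variances of T^{-H}S_T,
η_T and ζ_∞ tend to λ², σ² and (1-H)Γ(2H+1)/θ^{2H}, and the cross terms tend to zero
(`tendsto_integral_comb_sq`). Convergence of characteristic functions gives the joint limit of the
triple, in which T^{-H}η_T disappears. The continuous mapping theorem on {μ + z ≠ 0} and Slutsky's
lemma transfer it to the estimators. -/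

/-! ### Sublinear growth of paths from moment bounds on increments. -/

/-- A countable family of nonnegative random variables with summable expectations is almost surely
bounded. -/
theorem ae_exists_forall_le_of_summable {Ω ι : Type*} [MeasurableSpace Ω] [Countable ι]
    {P : Measure Ω} (f : ι → Ω → ℝ) (hf : ∀ i, Measurable (f i)) (b : ι → ℝ)
    (hb0 : ∀ i, 0 ≤ b i) (hb : Summable b)
    (h : ∀ i, ∫⁻ ω, ENNReal.ofReal (f i ω) ∂P ≤ ENNReal.ofReal (b i)) :
    ∀ᵐ ω ∂P, ∃ C : ℝ, 0 ≤ C ∧ ∀ i, f i ω ≤ C := by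
  have hm : ∀ i, Measurable fun ω => ENNReal.ofReal (f i ω) := fun i => (hf i).ennreal_ofReal
  have hlt : ∫⁻ ω, ∑' i, ENNReal.ofReal (f i ω) ∂P ≠ ⊤ := by
    rw [lintegral_tsum fun i => (hm i).aemeasurable]
    refine ne_top_of_le_ne_top ?_ (ENNReal.tsum_le_tsum h)
    rw [← ENNReal.ofReal_tsum_of_nonneg hb0 hb]
    exact ENNReal.ofReal_ne_top
  filter_upwards [ae_lt_top (Measurable.tsum hm) hlt] with ω hω
  refine ⟨(∑' i, ENNReal.ofReal (f i ω)).toReal, ENNReal.toReal_nonneg, fun i => ?_⟩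
  rw [← ENNReal.ofReal_le_iff_le_toReal hω.ne]
  exact ENNReal.le_tsum i

/-- The dyadic approximation from below of `t` with mesh `2⁻ᵏ`. -/
noncomputable def dyadicFloor (k : ℕ) (t : ℝ≥0) : ℝ≥0 := (⌊2 ^ k * t⌋₊ : ℝ≥0) / 2 ^ k

theorem dyadicFloor_le (k : ℕ) (t : ℝ≥0) : dyadicFloor k t ≤ t := by
  rw [dyadicFloor, div_le_iff₀ (by positivity), mul_comm t]
  exact Nat.floor_le (by positivity)

theorem tendsto_dyadicFloor (t : ℝ≥0) : Tendsto (fun k => dyadicFloor k t) atTop (𝓝 t) := by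
  rw [← NNReal.tendsto_coe]
  have h1 : Tendsto (fun k : ℕ => (t : ℝ) - (1 / 2) ^ k) atTop (𝓝 ((t : ℝ) - 0)) :=
    tendsto_const_nhds.sub (tendsto_pow_atTop_nhds_zero_of_lt_one (by norm_num) (by norm_num))
  rw [sub_zero] at h1
  refine tendsto_of_tendsto_of_tendsto_of_le_of_le h1 tendsto_const_nhds (fun k => ?_)
    fun k => NNReal.coe_le_coe.2 (dyadicFloor_le k t)
  have h2 : (2 : ℝ) ^ k * t < ⌊(2 : ℝ≥0) ^ k * t⌋₊ + 1 := by
    exact_mod_cast Nat.lt_floor_add_one ((2 : ℝ≥0) ^ k * t)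
  simp only [dyadicFloor, NNReal.coe_div, NNReal.coe_natCast, NNReal.coe_pow, NNReal.coe_ofNat]
  rw [one_div, inv_pow, le_div_iff₀ (by positivity), sub_mul, inv_mul_cancel₀ (by positivity)]
  linarith

/-- Doubling 2^k t sends its integer part m to 2m or 2m + 1. Hence a refinement uses at most one
increment over a cell of the finer grid, and these are the only increments that the chaining has to
control. -/
theorem dyadicFloor_succ (k : ℕ) (t : ℝ≥0) :
    dyadicFloor (k + 1) t = dyadicFloor k t ∨ ∃ m : ℕ, (m : ℝ≥0) / 2 ^ (k + 1) ≤ t ∧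
      dyadicFloor k t = (m : ℝ≥0) / 2 ^ (k + 1) ∧
      dyadicFloor (k + 1) t = ((m + 1 : ℕ) : ℝ≥0) / 2 ^ (k + 1) := by
  set m := ⌊(2 : ℝ≥0) ^ k * t⌋₊ with hm
  have h1 : (m : ℝ≥0) ≤ 2 ^ k * t := Nat.floor_le (by positivity)
  have h2 : (2 : ℝ≥0) ^ k * t < m + 1 := Nat.lt_floor_add_one _
  have h3 : 2 * m ≤ ⌊(2 : ℝ≥0) ^ (k + 1) * t⌋₊ := by
    refine Nat.le_floor ?_
    push_cast
    calc (2 : ℝ≥0) * m ≤ 2 * (2 ^ k * t) := by gcongr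
      _ = _ := by ring
  have h4 : ⌊(2 : ℝ≥0) ^ (k + 1) * t⌋₊ < 2 * m + 2 := by
    rw [Nat.floor_lt (by positivity)]
    push_cast
    calc (2 : ℝ≥0) ^ (k + 1) * t = 2 * (2 ^ k * t) := by ring
      _ < 2 * (m + 1) := by gcongr
      _ = _ := by ring
  have h5 : dyadicFloor k t = ((2 * m : ℕ) : ℝ≥0) / 2 ^ (k + 1) := by
    rw [dyadicFloor, ← hm, pow_succ']
    push_cast
    rw [mul_div_mul_left _ _ two_ne_zero]
  have h6 : ⌊(2 : ℝ≥0) ^ (k + 1) * t⌋₊ = 2 * m ∨ ⌊(2 : ℝ≥0) ^ (k + 1) * t⌋₊ = 2 * m + 1 := by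
    omega
  rcases h6 with h | h
  · left
    rw [h5, dyadicFloor, h]
  · right
    refine ⟨2 * m, h5 ▸ dyadicFloor_le k t, h5, ?_⟩
    rw [dyadicFloor, h]

/-- Chaining: a continuous path whose dyadic increments of rank `k` before time `t` are bounded by
`(C 2⁻ᵏ (1 + t)²)^{1/p}` is close to its values at the integers. -/
theorem abs_sub_floor_le_of_dyadic {g : ℝ≥0 → ℝ} (hg : Continuous g) {C p : ℝ} (hC : 0 ≤ C)
    (hp : 0 < p)
    (h : ∀ k m : ℕ, |g (((m + 1 : ℕ) : ℝ≥0) / 2 ^ k) - g ((m : ℝ≥0) / 2 ^ k)| ^ p * 2 ^ k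
      * 4 ^ k / (1 + m : ℝ) ^ 2 ≤ C) (t : ℝ≥0) :
    |g (⌊t⌋₊ : ℝ≥0) - g t| ≤
      (C * (1 + t) ^ (2 : ℕ)) ^ (1 / p) / (1 - (1 / 2 : ℝ) ^ (1 / p)) := by
  have hr : (1 / 2 : ℝ) ^ (1 / p) < 1 :=
    Real.rpow_lt_one (by norm_num) (by norm_num) (by positivity)
  have key : ∀ k, dist (g (dyadicFloor k t)) (g (dyadicFloor (k + 1) t)) ≤
      (C * (1 + t) ^ (2 : ℕ)) ^ (1 / p) * ((1 / 2 : ℝ) ^ (1 / p)) ^ k := by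
    intro k
    rcases dyadicFloor_succ k t with h1 | ⟨m, hmt, h1, h2⟩
    · rw [h1, dist_self]; positivity
    · rw [h1, h2, dist_comm, Real.dist_eq]
      set D := |g (((m + 1 : ℕ) : ℝ≥0) / 2 ^ (k + 1)) - g ((m : ℝ≥0) / 2 ^ (k + 1))| with hD
      have h3 := h (k + 1) m
      rw [← hD, div_le_iff₀ (by positivity)] at h3
      have h4 : (m : ℝ) ≤ t * 2 ^ (k + 1) := by
        rw [div_le_iff₀ (by positivity)] at hmt
        exact_mod_cast hmt
      have h5 : (1 + m : ℝ) ≤ (1 + t) * 2 ^ (k + 1) := by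
        have : (1 : ℝ) ≤ 2 ^ (k + 1) := one_le_pow₀ (by norm_num)
        linarith
      -- The factor 4^(k+1) of the hypothesis pays for (1+m)² ≤ (1+t)² 4^(k+1); the factor 2^(k+1)
      -- that is left gives the geometric decay.
      have h6 : D ^ p * 2 ^ (k + 1) ≤ C * (1 + t) ^ 2 := by
        have h7 : (1 + m : ℝ) ^ 2 ≤ (1 + t : ℝ) ^ 2 * 4 ^ (k + 1) := by
          calc (1 + m : ℝ) ^ 2 ≤ ((1 + t : ℝ) * 2 ^ (k + 1)) ^ 2 := by gcongr
            _ = (1 + t : ℝ) ^ 2 * (2 ^ 2) ^ (k + 1) := by rw [mul_pow, ← pow_mul, ← pow_mul, mul_comm (k + 1)]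
            _ = _ := by norm_num
        have h8 : D ^ p * 2 ^ (k + 1) * 4 ^ (k + 1) ≤ C * (1 + t) ^ 2 * 4 ^ (k + 1) := by
          calc _ ≤ C * (1 + m : ℝ) ^ 2 := h3
            _ ≤ C * ((1 + t) ^ 2 * 4 ^ (k + 1)) := by gcongr
            _ = _ := by ring
        exact le_of_mul_le_mul_right h8 (by positivity)
      have h9 : D ^ p ≤ C * (1 + t) ^ 2 * (1 / 2) ^ k := by
        have hDp : 0 ≤ D ^ p := by positivity
        rw [one_div, inv_pow, ← div_eq_mul_inv, le_div_iff₀ (by positivity)]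
        refine le_trans ?_ h6
        gcongr <;> norm_num
      calc D = (D ^ p) ^ (1 / p) := by
            rw [← Real.rpow_mul (abs_nonneg _), mul_one_div_cancel hp.ne', Real.rpow_one]
        _ ≤ (C * (1 + t) ^ 2 * (1 / 2) ^ k) ^ (1 / p) := by gcongr
        _ = _ := by
          rw [Real.mul_rpow (by positivity) (by positivity), ← Real.rpow_natCast (1 / 2 : ℝ) k,
            ← Real.rpow_natCast _ k, ← Real.rpow_mul (by norm_num), ← Real.rpow_mul (by norm_num),
            mul_comm (k : ℝ)]
  -- The chain starts at rank zero, that is, at the integer part of t.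
  have h0 : dyadicFloor 0 t = (⌊t⌋₊ : ℝ≥0) := by simp [dyadicFloor]
  have := dist_le_of_le_geometric_of_tendsto₀ _ _ hr key
    ((hg.tendsto t).comp (tendsto_dyadicFloor t))
  simpa [h0, Real.dist_eq] using this

theorem tendsto_one_add_rpow_div_atTop {γ : ℝ} (hγ : γ < 1) :
    Tendsto (fun t : ℝ≥0 => (1 + t : ℝ) ^ γ / t) atTop (𝓝 0) := by
  have h1 : Tendsto (fun x : ℝ => x ^ (γ - 1)) atTop (𝓝 0) := by
    have := tendsto_rpow_neg_atTop (y := 1 - γ) (by linarith)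
    simpa using this
  have hcoe : Tendsto (fun t : ℝ≥0 => (t : ℝ)) atTop atTop := NNReal.tendsto_coe_atTop.2 tendsto_id
  have h2 : Tendsto (fun t : ℝ≥0 => (1 + t : ℝ) ^ (γ - 1) * (1 + 1 / t)) atTop
      (𝓝 (0 * (1 + 0))) := by
    refine (h1.comp (tendsto_atTop_add_const_left _ 1 hcoe)).mul (tendsto_const_nhds.add ?_)
    simpa only [one_div, Function.comp_def] using tendsto_inv_atTop_zero.comp hcoe
  rw [zero_mul] at h2
  refine h2.congr' ?_
  filter_upwards [eventually_gt_atTop 0] with t ht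
  have ht' : (0 : ℝ) < t := ht
  rw [Real.rpow_sub_one (by positivity)]
  field_simp
  ring

/-- This is where q > 3 comes from: the weight 2^k 4^k against increments of length 2^{-k} leaves
2^{(3-q)k}, geometric in k, while (1+m)^{-2} is summable in m. -/
theorem dyadic_moment_weight (q M : ℝ) (k m : ℕ) :
    M * ((((m + 1 : ℕ) : ℝ≥0) / 2 ^ k : ℝ≥0) - ((m : ℝ≥0) / 2 ^ k : ℝ≥0) : ℝ) ^ q *
        (2 ^ k * 4 ^ k / (1 + m : ℝ) ^ 2) =
      (M * ((2 : ℝ) ^ (3 - q)) ^ k) * ((1 + m : ℝ) ^ 2)⁻¹ := by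
  have h2 : ((((m + 1 : ℕ) : ℝ≥0) / 2 ^ k : ℝ≥0) - ((m : ℝ≥0) / 2 ^ k : ℝ≥0) : ℝ)
      = ((2 : ℝ) ^ k)⁻¹ := by
    push_cast
    field_simp
    ring
  have h3 : (4 : ℝ) ^ k = 2 ^ (2 * (k : ℝ)) := by
    rw [Real.rpow_mul (by norm_num), Real.rpow_natCast]
    norm_num
  have h4 : (((2 : ℝ) ^ k)⁻¹) ^ q * (2 ^ k * 4 ^ k) = ((2 : ℝ) ^ (3 - q)) ^ k := by
    rw [h3, ← Real.rpow_natCast 2 k, ← Real.rpow_neg (by norm_num), ← Real.rpow_mul (by norm_num),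
      ← Real.rpow_natCast _ k, ← Real.rpow_mul (by norm_num), ← Real.rpow_add (by norm_num),
      ← Real.rpow_add (by norm_num)]
    ring_nf
  rw [h2, ← h4]
  ring

/-- A process with almost surely continuous paths, starting at zero, with
`E |S_t - S_s|^p ≤ M |t - s|^q`, where `3 < q < p - 1`, has almost surely sublinear growth. -/
theorem ae_tendsto_div_atTop_of_moment {Ω : Type*} [MeasurableSpace Ω] {P : Measure Ω}
    {S : ℝ≥0 → Ω → ℝ} (hm : ∀ t, Measurable (S t))
    (hc : ∀ᵐ ω ∂P, Continuous fun t => S t ω) (h0 : ∀ᵐ ω ∂P, S 0 ω = 0)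
    {p q M : ℝ} (hq : 3 < q) (hp : q + 1 < p) (hM : 0 ≤ M)
    (h : ∀ s t : ℝ≥0, s ≤ t → ∫⁻ ω, ENNReal.ofReal (|S t ω - S s ω| ^ p) ∂P ≤
      ENNReal.ofReal (M * ((t : ℝ) - s) ^ q)) :
    ∀ᵐ ω ∂P, Tendsto (fun t : ℝ≥0 => S t ω / t) atTop (𝓝 0) := by
  have hp0 : 0 < p := by linarith
  -- Any a strictly between q + 1 and p would do: a > q + 1 makes the sum of n^{q-a} finite, and a <
  -- p makes n^{a/p} sublinear.
  set a := (q + 1 + p) / 2 with ha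
  have scale : ∀ (s t : ℝ≥0) (c : ℝ), 0 ≤ c → s ≤ t →
      ∫⁻ ω, ENNReal.ofReal (|S t ω - S s ω| ^ p * c) ∂P ≤
        ENNReal.ofReal (M * ((t : ℝ) - s) ^ q * c) := by
    intro s t c hc0 hst
    have h1 : ∀ ω, ENNReal.ofReal (|S t ω - S s ω| ^ p * c) =
        ENNReal.ofReal (|S t ω - S s ω| ^ p) * ENNReal.ofReal c :=
      fun ω => ENNReal.ofReal_mul (by positivity)
    have hst' : (0 : ℝ) ≤ t - s := sub_nonneg.2 hst
    rw [lintegral_congr h1, lintegral_mul_const' _ _ ENNReal.ofReal_ne_top,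
      ENNReal.ofReal_mul (by positivity)]
    gcongr
    exact h s t hst
  have hmeas : ∀ (s t : ℝ≥0) (c : ℝ), Measurable fun ω => |S t ω - S s ω| ^ p * c :=
    fun s t c => (((hm t).sub (hm s)).abs.pow_const p).mul_const c
  have hB : ∀ᵐ ω ∂P, ∃ C : ℝ, 0 ≤ C ∧ ∀ i : ℕ × ℕ,
      |S (((i.2 + 1 : ℕ) : ℝ≥0) / 2 ^ i.1) ω - S ((i.2 : ℝ≥0) / 2 ^ i.1) ω| ^ p *
        (2 ^ i.1 * 4 ^ i.1 / (1 + i.2 : ℝ) ^ 2) ≤ C := by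
    refine ae_exists_forall_le_of_summable
      (fun (i : ℕ × ℕ) ω =>
        |S (((i.2 + 1 : ℕ) : ℝ≥0) / 2 ^ i.1) ω - S ((i.2 : ℝ≥0) / 2 ^ i.1) ω| ^ p *
          (2 ^ i.1 * 4 ^ i.1 / (1 + i.2 : ℝ) ^ 2)) (fun i => hmeas _ _ _)
      (fun i => (M * ((2 : ℝ) ^ (3 - q)) ^ i.1) * ((1 + i.2 : ℝ) ^ 2)⁻¹) (fun i => by positivity)
      ?_ fun i => (scale ((i.2 : ℝ≥0) / 2 ^ i.1) (((i.2 + 1 : ℕ) : ℝ≥0) / 2 ^ i.1)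
        (2 ^ i.1 * 4 ^ i.1 / (1 + i.2 : ℝ) ^ 2) (by positivity) ?_).trans (le_of_eq ?_)
    · refine Summable.mul_of_nonneg (f := fun k : ℕ => M * ((2 : ℝ) ^ (3 - q)) ^ k)
        (g := fun m : ℕ => ((1 + m : ℝ) ^ 2)⁻¹) ?_ ?_ (fun k => ?_) fun k => ?_
      · exact (summable_geometric_of_lt_one (by positivity)
          (Real.rpow_lt_one_of_one_lt_of_neg (by norm_num) (by linarith))).mul_left M
      · have := (summable_nat_add_iff 1).2 (Real.summable_nat_pow_inv.2 (one_lt_two))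
        refine this.congr fun k => ?_
        push_cast
        rw [add_comm]
      · exact mul_nonneg hM (by positivity)
      · simp only [Pi.zero_apply]; positivity
    · exact div_le_div_of_nonneg_right (by exact_mod_cast i.2.le_succ) zero_le
    · rw [dyadic_moment_weight]
  -- Integer times need no chaining: the p-th moment at n is at most M n^q, and the weight
  -- (1+n)^{-a} makes it summable.
  have hN : ∀ᵐ ω ∂P, ∃ C : ℝ, 0 ≤ C ∧ ∀ n : ℕ,
      |S (n : ℝ≥0) ω - S 0 ω| ^ p * ((1 + n : ℝ) ^ a)⁻¹ ≤ C := by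
    refine ae_exists_forall_le_of_summable _ (fun i => hmeas _ _ _)
      (fun n => M * ((n + 1 : ℕ) : ℝ) ^ (q - a)) (fun i => by positivity)
      ?_ fun n => (scale _ _ _ (by positivity) zero_le).trans ?_
    · refine Summable.mul_left M ?_
      exact (summable_nat_add_iff 1).2 (Real.summable_nat_rpow.2 (by linarith))
    · refine ENNReal.ofReal_le_ofReal ?_
      rw [Real.rpow_sub (by positivity), mul_assoc, div_eq_mul_inv]
      push_cast
      rw [sub_zero, add_comm (n : ℝ) 1]
      gcongr
      linarith
  filter_upwards [hB, hN, hc, h0] with ω ⟨C, hC, hBω⟩ ⟨C', hC', hNω⟩ hcω h0ω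
  have h1 := abs_sub_floor_le_of_dyadic hcω hC hp0 (fun k m => by
    have := hBω (k, m)
    simp only at this
    rwa [mul_div_assoc, mul_assoc, ← mul_div_assoc])
  have h2 : ∀ n : ℕ, |S (n : ℝ≥0) ω| ≤ C' ^ (1 / p) * (1 + n : ℝ) ^ (a / p) := by
    intro n
    have := hNω n
    rw [h0ω, sub_zero, ← div_eq_mul_inv, div_le_iff₀ (by positivity)] at this
    calc |S (n : ℝ≥0) ω| = (|S (n : ℝ≥0) ω| ^ p) ^ (1 / p) := by
          rw [← Real.rpow_mul (abs_nonneg _), mul_one_div_cancel hp0.ne', Real.rpow_one]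
      _ ≤ (C' * (1 + n : ℝ) ^ a) ^ (1 / p) := by gcongr
      _ = _ := by
        rw [Real.mul_rpow hC' (by positivity), ← Real.rpow_mul (by positivity), mul_one_div]
  have h3 : ∀ t : ℝ≥0, ‖S t ω / t‖ ≤ C' ^ (1 / p) * ((1 + t : ℝ) ^ (a / p) / t) +
      C ^ (1 / p) / (1 - (1 / 2 : ℝ) ^ (1 / p)) * ((1 + t : ℝ) ^ (2 / p) / t) := by
    intro t
    have h4 := h1 t
    have h5 := h2 ⌊t⌋₊
    have h6 : (1 + (⌊t⌋₊ : ℝ)) ^ (a / p) ≤ (1 + t : ℝ) ^ (a / p) := by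
      have : ((⌊t⌋₊ : ℝ≥0) : ℝ) ≤ t := NNReal.coe_le_coe.2 (Nat.floor_le zero_le)
      have ha0 : 0 ≤ a / p := by positivity
      gcongr
      simpa using this
    have h7 : |S t ω| ≤ C' ^ (1 / p) * (1 + t : ℝ) ^ (a / p) +
        C ^ (1 / p) / (1 - (1 / 2 : ℝ) ^ (1 / p)) * (1 + t : ℝ) ^ (2 / p) := by
      have h8 : (C * (1 + t : ℝ) ^ (2 : ℕ)) ^ (1 / p) = C ^ (1 / p) * (1 + t : ℝ) ^ (2 / p) := by
        rw [Real.mul_rpow hC (by positivity), ← Real.rpow_natCast, ← Real.rpow_mul (by positivity)]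
        congr 2
        push_cast
        ring
      rw [h8] at h4
      have h9 : |S t ω| ≤ |S (⌊t⌋₊ : ℝ≥0) ω| + |S (⌊t⌋₊ : ℝ≥0) ω - S t ω| := by
        have := abs_sub_abs_le_abs_sub (S t ω) (S (⌊t⌋₊ : ℝ≥0) ω)
        rw [abs_sub_comm] at this
        linarith
      refine h9.trans (add_le_add (h5.trans ?_) (h4.trans (le_of_eq ?_)))
      · gcongr
      · ring
    rw [norm_div, Real.norm_eq_abs, Real.norm_eq_abs, abs_of_nonneg t.coe_nonneg]
    calc _ ≤ (C' ^ (1 / p) * (1 + t : ℝ) ^ (a / p) +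
        C ^ (1 / p) / (1 - (1 / 2 : ℝ) ^ (1 / p)) * (1 + t : ℝ) ^ (2 / p)) / t := by gcongr
      _ = _ := by ring
  refine squeeze_zero_norm h3 ?_
  have ha1 : a / p < 1 := by rw [div_lt_one hp0]; linarith
  have hp1 : 2 / p < 1 := by rw [div_lt_one hp0]; linarith
  simpa using ((tendsto_one_add_rpow_div_atTop ha1).const_mul (C' ^ (1 / p))).add
    ((tendsto_one_add_rpow_div_atTop hp1).const_mul
      (C ^ (1 / p) / (1 - (1 / 2 : ℝ) ^ (1 / p))))

/-! ### Subfractional Brownian motion: increments, growth and a regular version. -/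

/-- The covariance function of subfractional Brownian motion. -/
noncomputable def subfCov (H s t : ℝ) : ℝ :=
  t ^ (2 * H) + s ^ (2 * H) - (1 / 2) * ((t + s) ^ (2 * H) + |t - s| ^ (2 * H))

theorem subfCov_comm (H s t : ℝ) : subfCov H s t = subfCov H t s := by
  rw [subfCov, subfCov, add_comm t s, abs_sub_comm t s]
  ring

theorem subfCov_self {H : ℝ} (hH : 0 < H) {t : ℝ} (ht : 0 ≤ t) :
    subfCov H t t = (2 - (2 : ℝ) ^ (2 * H - 1)) * t ^ (2 * H) := by
  rw [subfCov, sub_self, abs_zero, Real.zero_rpow (by positivity), ← two_mul t,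
    Real.mul_rpow (by norm_num) ht, Real.rpow_sub_one (by norm_num)]
  ring

/-- For 2H ≥ 1, convexity gives (t+s)^{2H} ≤ 2^{2H-1}(t^{2H} + s^{2H}), and even the constant 1
suffices. For 2H ≤ 1, subadditivity applied to t + s = 2s + (t - s) costs one more (t-s)^{2H}. -/
theorem subfCov_increment_le {H : ℝ} (hH0 : 0 < H) {s t : ℝ} (hs : 0 ≤ s) (hst : s ≤ t) :
    subfCov H t t + subfCov H s s - 2 * subfCov H s t ≤ 2 * (t - s) ^ (2 * H) := by
  have ht : 0 ≤ t := hs.trans hst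
  have hd : 0 ≤ (t - s) ^ (2 * H) := Real.rpow_nonneg (by linarith) _
  rw [subfCov_self hH0 ht, subfCov_self hH0 hs, subfCov, abs_of_nonneg (sub_nonneg.2 hst),
    Real.rpow_sub_one (by norm_num)]
  rcases le_total 1 (2 * H) with h | h
  · have h1 : (t + s) ^ (2 * H) ≤ 2 ^ (2 * H - 1) * (t ^ (2 * H) + s ^ (2 * H)) := by
      lift t to ℝ≥0 using ht
      lift s to ℝ≥0 using hs
      exact_mod_cast NNReal.rpow_add_le_mul_rpow_add_rpow t s h
    rw [Real.rpow_sub_one (by norm_num)] at h1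
    nlinarith
  · have h1 : (t + s) ^ (2 * H) ≤ (2 * s) ^ (2 * H) + (t - s) ^ (2 * H) := by
      have := Real.rpow_add_le_add_rpow (mul_nonneg zero_le_two hs) (sub_nonneg.2 hst)
        (by positivity) h
      rwa [show 2 * s + (t - s) = t + s by ring] at this
    rw [Real.mul_rpow (by norm_num) hs] at h1
    have h2 : s ^ (2 * H) ≤ t ^ (2 * H) := by gcongr
    have h3 : 0 ≤ (2 : ℝ) ^ (2 * H) := by positivity
    nlinarith

section SubfractionalBM

variable {Ω : Type*} [MeasurableSpace Ω] {P : Measure Ω} {H : ℝ}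
  {S : ℝ≥0 → Ω → ℝ}

theorem ProbabilityTheory.HasGaussianLaw.hasLaw_of_centered {X : Ω → ℝ}
    (hX : HasGaussianLaw X P) (h0 : ∫ ω, X ω ∂P = 0) :
    HasLaw X (gaussianReal 0 (∫ ω, X ω ^ 2 ∂P).toNNReal) P where
  aemeasurable := hX.aemeasurable
  map_eq := by
    rw [hX.map_eq_gaussianReal, h0, variance_of_integral_eq_zero hX.aemeasurable h0]

namespace IsSubfractionalBM

theorem memLp_two (hS : IsSubfractionalBM H S P) (t : ℝ≥0) : MemLp (S t) 2 P :=
  (hS.gaussian.hasGaussianLaw_eval t).memLp_two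

theorem integrable_mul (hS : IsSubfractionalBM H S P) (s t : ℝ≥0) :
    Integrable (fun ω => S s ω * S t ω) P :=
  (hS.memLp_two s).integrable_mul (hS.memLp_two t)

theorem integral_mul (hS : IsSubfractionalBM H S P) (s t : ℝ≥0) :
    ∫ ω, S s ω * S t ω ∂P = subfCov H s t := by
  rw [subfCov_comm]
  exact hS.covariance t s

theorem integral_sub_mul_sub (hS : IsSubfractionalBM H S P) (a b c d : ℝ≥0) :
    ∫ ω, (S a ω - S b ω) * (S c ω - S d ω) ∂P =
      subfCov H a c - subfCov H a d - subfCov H b c + subfCov H b d := by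
  have h : ∀ ω, (S a ω - S b ω) * (S c ω - S d ω) =
      S a ω * S c ω - S a ω * S d ω - S b ω * S c ω + S b ω * S d ω := fun ω => by ring
  simp_rw [h]
  rw [integral_add, integral_sub, integral_sub]
  · simp only [hS.integral_mul]
  all_goals first
    | exact hS.integrable_mul _ _
    | exact (hS.integrable_mul _ _).sub (hS.integrable_mul _ _)
    | exact ((hS.integrable_mul _ _).sub (hS.integrable_mul _ _)).sub (hS.integrable_mul _ _)

theorem integral_sub_sq_le (hS : IsSubfractionalBM H S P) (hH : 0 < H) {s t : ℝ≥0} (hst : s ≤ t) :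
    ∫ ω, (S t ω - S s ω) ^ 2 ∂P ≤ 2 * ((t : ℝ) - s) ^ (2 * H) := by
  simp_rw [sq]
  rw [hS.integral_sub_mul_sub]
  have := subfCov_increment_le hH s.coe_nonneg (NNReal.coe_le_coe.2 hst)
  have h2 := subfCov_comm H s t
  linarith

theorem integral_sub_eq_zero (hS : IsSubfractionalBM H S P) (s t : ℝ≥0) :
    ∫ ω, (S t ω - S s ω) ∂P = 0 := by
  rw [integral_sub (hS.gaussian.hasGaussianLaw_eval t).integrable
    (hS.gaussian.hasGaussianLaw_eval s).integrable, hS.centered, hS.centered, sub_zero]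

theorem ae_zero (hS : IsSubfractionalBM H S P) (hH : 0 < H) : ∀ᵐ ω ∂P, S 0 ω = 0 := by
  have h : ∫ ω, S 0 ω * S 0 ω ∂P = 0 := by
    rw [hS.integral_mul, NNReal.coe_zero, subfCov_self hH le_rfl,
      Real.zero_rpow (by positivity), mul_zero]
  rw [integral_eq_zero_iff_of_nonneg (fun ω => mul_self_nonneg _) (hS.integrable_mul 0 0)] at h
  filter_upwards [h] with ω hω
  simpa using hω

/-- Scaling: √v times a standard normal variable has variance v, including v = 0. -/
theorem lintegral_abs_rpow_gaussianReal_le {p : ℝ} (hp : 0 ≤ p) (v : ℝ≥0) :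
    ∫⁻ x, ENNReal.ofReal (|x| ^ p) ∂gaussianReal 0 v =
      ENNReal.ofReal ((v : ℝ) ^ (p / 2) * ∫ x, |x| ^ p ∂gaussianReal 0 1) := by
  have hi : Integrable (fun x => |x| ^ p) (gaussianReal 0 1) := by
    rcases hp.eq_or_lt with rfl | hp0
    · simp
    · have := (memLp_id_gaussianReal (μ := 0) (v := 1) p.toNNReal).integrable_norm_rpow
        (by simpa using hp0) (by simp)
      simpa [Real.coe_toNNReal p hp] using this
  have h := gaussianReal_map_const_mul (μ := 0) (v := 1) (√(v : ℝ))
  have hv : NNReal.mk (√(v : ℝ) ^ 2) (sq_nonneg _) * 1 = v := by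
    ext
    simp [Real.sq_sqrt]
  rw [mul_zero, hv] at h
  rw [← h, lintegral_map (by fun_prop) (by fun_prop)]
  have h2 : ∀ x : ℝ, ENNReal.ofReal (|√(v : ℝ) * x| ^ p) =
      ENNReal.ofReal ((v : ℝ) ^ (p / 2)) * ENNReal.ofReal (|x| ^ p) := fun x => by
    rw [← ENNReal.ofReal_mul (by positivity), abs_mul, Real.mul_rpow (abs_nonneg _) (abs_nonneg _),
      abs_of_nonneg (Real.sqrt_nonneg _), Real.sqrt_eq_rpow, ← Real.rpow_mul (by positivity)]
    ring_nf
  simp_rw [h2]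
  rw [lintegral_const_mul _ (by fun_prop), ENNReal.ofReal_mul (by positivity),
    ofReal_integral_eq_lintegral_ofReal hi (ae_of_all _ fun x => by positivity)]

/-- For Gaussian increments the second moment controls every moment, so p may be taken as large as
the growth criterion requires. -/
theorem lintegral_sub_rpow_le (hS : IsSubfractionalBM H S P) (hH : 0 < H) {p : ℝ} (hp : 0 ≤ p)
    {s t : ℝ≥0} (hst : s ≤ t) :
    ∫⁻ ω, ENNReal.ofReal (|S t ω - S s ω| ^ p) ∂P ≤
      ENNReal.ofReal ((2 ^ (p / 2) * ∫ x, |x| ^ p ∂gaussianReal 0 1) * ((t : ℝ) - s) ^ (p * H)) := by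
  have hL := (hS.gaussian.hasGaussianLaw_fun_sub (s := t) (t := s)).hasLaw_of_centered
    (hS.integral_sub_eq_zero s t)
  have h1 : ∫⁻ ω, ENNReal.ofReal (|S t ω - S s ω| ^ p) ∂P =
      ∫⁻ x, ENNReal.ofReal (|x| ^ p) ∂(P.map fun ω => S t ω - S s ω) := by
    rw [lintegral_map' (by fun_prop) hL.aemeasurable]
  rw [h1, hL.map_eq, lintegral_abs_rpow_gaussianReal_le hp]
  refine ENNReal.ofReal_le_ofReal ?_
  have hd : (0 : ℝ) ≤ t - s := sub_nonneg.2 (NNReal.coe_le_coe.2 hst)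
  have h0 : 0 ≤ ∫ ω, (S t ω - S s ω) ^ 2 ∂P := integral_nonneg fun ω => sq_nonneg _
  have h2 := hS.integral_sub_sq_le hH hst
  have hg : 0 ≤ ∫ x, |x| ^ p ∂gaussianReal 0 1 := integral_nonneg fun x => by positivity
  rw [Real.coe_toNNReal _ h0]
  calc _ ≤ (2 * ((t : ℝ) - s) ^ (2 * H)) ^ (p / 2) * ∫ x, |x| ^ p ∂gaussianReal 0 1 := by gcongr
    _ = _ := by
      rw [Real.mul_rpow (by norm_num) (by positivity), ← Real.rpow_mul hd,
        show 2 * H * (p / 2) = p * H by ring]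
      ring

/-- Subfractional Brownian motion has almost surely sublinear growth. -/
theorem ae_tendsto_div (hS : IsSubfractionalBM H S P) (hH0 : 0 < H) (hH1 : H < 1) :
    ∀ᵐ ω ∂P, Tendsto (fun t : ℝ≥0 => S t ω / t) atTop (𝓝 0) := by
  -- The two summands serve the two conditions on q = pH: the first gives pH > 4, the second gives p
  -- - pH > 2.
  set p := 4 / H + 2 / (1 - H) with hp
  have h1H : 0 < 1 - H := by linarith
  have hp0 : 0 < p := by positivity
  have h1 : 3 < p * H := by
    have : p * H = 4 + 2 / (1 - H) * H := by rw [hp]; field_simp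
    have h2 : 0 < 2 / (1 - H) * H := by positivity
    linarith
  have h2 : p * H + 1 < p := by
    have : p * (1 - H) = 4 / H * (1 - H) + 2 := by rw [hp]; field_simp
    have h2 : 0 < 4 / H * (1 - H) := by positivity
    nlinarith
  exact ae_tendsto_div_atTop_of_moment hS.measurable hS.continuous_paths (hS.ae_zero hH0) h1 h2
    (M := 2 ^ (p / 2) * ∫ x, |x| ^ p ∂gaussianReal 0 1)
    (mul_nonneg (by positivity) (integral_nonneg fun x => by positivity))
    fun s t hst => hS.lintegral_sub_rpow_le hH0 hp0.le hst

end IsSubfractionalBM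

/-- A subfractional Brownian motion all of whose paths are continuous, start at zero and grow
sublinearly. -/
structure IsRegularSubfractionalBM (H : ℝ) (S : ℝ≥0 → Ω → ℝ) (P : Measure Ω) : Prop
    extends IsSubfractionalBM H S P where
  continuous : ∀ ω, Continuous fun t => S t ω
  zero : ∀ ω, S 0 ω = 0
  tendsto_div : ∀ ω, Tendsto (fun t : ℝ≥0 => S t ω / t) atTop (𝓝 0)

/-- The process is set to zero on a measurable null set that contains all bad paths. The new process
stays measurable at each time, and path arguments then apply to every ω. -/
theorem IsSubfractionalBM.exists_regular (hS : IsSubfractionalBM H S P) (hH0 : 0 < H)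
    (hH1 : H < 1) :
    ∃ S' : ℝ≥0 → Ω → ℝ, IsRegularSubfractionalBM H S' P ∧ ∀ᵐ ω ∂P, ∀ t, S t ω = S' t ω := by
  classical
  have hall := hS.continuous_paths.and ((hS.ae_zero hH0).and (hS.ae_tendsto_div hH0 hH1))
  obtain ⟨A, hA, hAm, hAP⟩ := exists_measurable_superset_of_null (ae_iff.1 hall)
  have hmem : ∀ ω, ω ∉ A → (Continuous fun t => S t ω) ∧ S 0 ω = 0 ∧
      Tendsto (fun t : ℝ≥0 => S t ω / t) atTop (𝓝 0) := by
    intro ω hω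
    by_contra h
    exact hω (hA h)
  set S' : ℝ≥0 → Ω → ℝ := fun t => Aᶜ.indicator (S t) with hS'
  have hin : ∀ ω, ω ∉ A → ∀ t, S' t ω = S t ω := fun ω hω t => by simp [hS', hω]
  have hout : ∀ ω, ω ∈ A → ∀ t, S' t ω = 0 := fun ω hω t => by simp [hS', hω]
  have hae : ∀ᵐ ω ∂P, ∀ t, S t ω = S' t ω := by
    have : ∀ᵐ ω ∂P, ω ∉ A := measure_eq_zero_iff_ae_notMem.1 hAP
    filter_upwards [this] with ω hω t using (hin ω hω t).symm
  refine ⟨S', ⟨⟨fun t => (hS.measurable t).indicator hAm.compl,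
    hS.gaussian.congr fun t => ?_, fun t => ?_, fun s t => ?_, ?_⟩, ?_, ?_, ?_⟩, hae⟩
  · filter_upwards [hae] with ω hω using hω t
  · rw [← hS.centered t]
    exact integral_congr_ae (by filter_upwards [hae] with ω hω using (hω t).symm)
  · rw [← hS.covariance s t]
    exact integral_congr_ae (by filter_upwards [hae] with ω hω; rw [hω t, hω s])
  · filter_upwards [hae, hS.continuous_paths] with ω hω hc
    simpa only [hω] using hc
  · intro ω
    by_cases h : ω ∈ A
    · simp only [hout ω h]; exact continuous_const
    · simp only [hin ω h]; exact (hmem ω h).1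
  · intro ω
    by_cases h : ω ∈ A
    · exact hout ω h 0
    · rw [hin ω h]; exact (hmem ω h).2.1
  · intro ω
    by_cases h : ω ∈ A
    · simp [hout ω h]
    · simp only [hin ω h]; exact (hmem ω h).2.2

end SubfractionalBM

/-! ### The exponential distribution as a weight for lags. -/

section ExpWeight

/-- The exponential distribution with rate `θ`, as a weight on `(0, ∞)`. -/
noncomputable def expWeight (θ : ℝ) : Measure ℝ :=
  (volume.restrict (Set.Ioi 0)).withDensity fun s => ENNReal.ofReal (θ * Real.exp (-θ * s))

variable {θ : ℝ}

theorem integral_expWeight (hθ : 0 < θ) (f : ℝ → ℝ) :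
    ∫ s, f s ∂expWeight θ = θ * ∫ s in Set.Ioi (0 : ℝ), Real.exp (-θ * s) * f s := by
  rw [expWeight, integral_withDensity_eq_integral_toReal_smul (by fun_prop)
    (ae_of_all _ fun s => ENNReal.ofReal_lt_top), ← integral_const_mul]
  refine integral_congr_ae (ae_of_all _ fun s => ?_)
  simp only [smul_eq_mul]
  rw [ENNReal.toReal_ofReal (by positivity), mul_assoc]

theorem integrable_expWeight_iff (hθ : 0 < θ) (f : ℝ → ℝ) :
    Integrable f (expWeight θ) ↔
      IntegrableOn (fun s => Real.exp (-θ * s) * f s) (Set.Ioi 0) := by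
  rw [expWeight, integrable_withDensity_iff_integrable_smul' (by fun_prop)
    (ae_of_all _ fun s => ENNReal.ofReal_lt_top), IntegrableOn]
  refine Iff.trans (integrable_congr (ae_of_all _ fun s => ?_))
    (integrable_const_mul_iff (IsUnit.mk0 θ hθ.ne') _)
  simp only [smul_eq_mul]
  rw [ENNReal.toReal_ofReal (by positivity), mul_assoc]

theorem ae_expWeight_pos (θ : ℝ) : ∀ᵐ s ∂expWeight θ, 0 < s :=
  (withDensity_absolutelyContinuous _ _).ae_le (ae_restrict_mem measurableSet_Ioi)

theorem integrable_rpow_expWeight (hθ : 0 < θ) {a : ℝ} (ha : -1 < a) :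
    Integrable (fun s : ℝ => s ^ a) (expWeight θ) := by
  rw [integrable_expWeight_iff hθ]
  have := integrableOn_rpow_mul_exp_neg_mul_rpow ha one_pos hθ
  simp only [Real.rpow_one] at this
  exact this.congr_fun (fun s _ => mul_comm _ _) measurableSet_Ioi

theorem integral_rpow_expWeight (hθ : 0 < θ) {a : ℝ} (ha : -1 < a) :
    ∫ s, s ^ a ∂expWeight θ = Real.Gamma (a + 1) / θ ^ a := by
  have h := Real.integral_rpow_mul_exp_neg_mul_Ioi (a := a + 1) (r := θ) (by linarith) hθ
  rw [integral_expWeight hθ]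
  have h2 : ∫ s in Set.Ioi (0 : ℝ), Real.exp (-θ * s) * s ^ a =
      ∫ s in Set.Ioi (0 : ℝ), s ^ (a + 1 - 1) * Real.exp (-(θ * s)) := by
    refine setIntegral_congr_fun measurableSet_Ioi fun s _ => ?_
    simp only [add_sub_cancel_right, neg_mul]
    ring
  rw [h2, h, one_div, Real.inv_rpow hθ.le, Real.rpow_add_one hθ.ne']
  field_simp

theorem isProbabilityMeasure_expWeight (hθ : 0 < θ) : IsProbabilityMeasure (expWeight θ) := by
  have h1 : ∫ s, (1 : ℝ) ∂expWeight θ = 1 := by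
    have := integral_rpow_expWeight hθ (a := 0) (by norm_num)
    simpa using this
  refine ⟨?_⟩
  rw [integral_const, smul_eq_mul, mul_one, Measure.real] at h1
  rwa [ENNReal.toReal_eq_one_iff] at h1

theorem integrable_one_add_abs_expWeight (hθ : 0 < θ) :
    Integrable (fun s : ℝ => 1 + |s|) (expWeight θ) := by
  have := isProbabilityMeasure_expWeight hθ
  refine (integrable_const 1).add ?_
  have := (integrable_rpow_expWeight hθ (a := 1) (by norm_num)).abs
  simpa using this

end ExpWeight

/-! ### Integrals of Gaussian processes: their laws and their second moments. -/

section GaussianLimit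

variable {Ω : Type*} [MeasurableSpace Ω] {P : Measure Ω} [IsProbabilityMeasure P]

/-- If `exp (-v_n t² / 2)` converges for every `t` to a function that is continuous at zero, then
the limit is of the same form. -/
theorem exists_eq_exp_of_tendsto {v : ℕ → ℝ≥0} {φ : ℝ → ℝ} (hφ : ContinuousAt φ 0) (h0 : φ 0 = 1)
    (h : ∀ t, Tendsto (fun n => Real.exp (-(v n * t ^ 2 / 2))) atTop (𝓝 (φ t))) :
    ∃ w : ℝ≥0, ∀ t, φ t = Real.exp (-(w * t ^ 2 / 2)) := by
  by_cases h1 : φ 1 = 0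
  -- A zero limit at t = 1 means that the variances tend to infinity; then φ vanishes off the
  -- origin, against continuity and φ 0 = 1.
  · exfalso
    have hv : Tendsto (fun n => -((v n : ℝ) * 1 ^ 2 / 2)) atTop atBot := by
      rw [← Real.tendsto_exp_comp_nhds_zero, ← h1]
      exact h 1
    have h2 : ∀ t, t ≠ 0 → φ t = 0 := by
      intro t ht
      refine tendsto_nhds_unique (h t) ?_
      rw [Real.tendsto_exp_comp_nhds_zero]
      have := hv.atBot_mul_const (r := t ^ 2) (by positivity)
      refine this.congr fun n => ?_
      ring
    have h3 : Tendsto φ (𝓝[≠] 0) (𝓝 0) :=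
      tendsto_const_nhds.congr' (by
        filter_upwards [self_mem_nhdsWithin] with t ht using (h2 t ht).symm)
    have h4 := tendsto_nhds_unique h3 (hφ.tendsto.mono_left nhdsWithin_le_nhds)
    rw [h0] at h4
    exact zero_ne_one h4
  · have hv : Tendsto (fun n => (v n : ℝ)) atTop (𝓝 (-2 * Real.log (φ 1))) := by
      have := ((h 1).log h1).const_mul (-2)
      refine this.congr fun n => ?_
      rw [Real.log_exp]
      ring
    refine ⟨(-2 * Real.log (φ 1)).toNNReal, fun t => ?_⟩
    have hnn : 0 ≤ -2 * Real.log (φ 1) := ge_of_tendsto' hv fun n => (v n).coe_nonneg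
    rw [Real.coe_toNNReal _ hnn]
    refine tendsto_nhds_unique (h t) ?_
    exact (Real.continuous_exp.tendsto _).comp (((hv.mul_const (t ^ 2)).div_const 2).neg)

/-- An almost sure limit of centered Gaussian random variables is a centered Gaussian. -/
theorem exists_hasLaw_gaussianReal_of_ae_tendsto {L : ℕ → Ω → ℝ} {Z : Ω → ℝ}
    (hL : ∀ n, HasGaussianLaw (L n) P) (h0 : ∀ n, ∫ ω, L n ω ∂P = 0)
    (hlim : ∀ᵐ ω ∂P, Tendsto (fun n => L n ω) atTop (𝓝 (Z ω))) :
    ∃ v : ℝ≥0, HasLaw Z (gaussianReal 0 v) P := by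
  have hLm : ∀ n, AEMeasurable (L n) P := fun n => (hL n).aemeasurable
  have hZ : AEMeasurable Z P := aemeasurable_of_tendsto_metrizable_ae atTop hLm hlim
  have hd := (tendstoInDistribution_of_ae_tendsto hLm hZ hlim).tendsto
  replace hd := ProbabilityMeasure.tendsto_iff_tendsto_charFun.1 hd
  simp only [ProbabilityMeasure.coe_mk] at hd
  have hPZ : IsProbabilityMeasure (P.map Z) := Measure.isProbabilityMeasure_map hZ
  have hexp : ∀ (w : ℝ≥0) (t : ℝ), charFun (gaussianReal 0 w) t =
      ((Real.exp (-(w * t ^ 2 / 2)) : ℝ) : ℂ) := by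
    intro w t
    rw [charFun_gaussianReal]
    push_cast
    congr 1
    ring
  have hch : ∀ n t, charFun (P.map (L n)) t =
      ((Real.exp (-(((∫ ω, L n ω ^ 2 ∂P).toNNReal : ℝ) * t ^ 2 / 2)) : ℝ) : ℂ) := by
    intro n t
    rw [((hL n).hasLaw_of_centered (h0 n)).map_eq, hexp]
  simp_rw [hch] at hd
  have hre : ∀ t, Tendsto (fun n => Real.exp (-(((∫ ω, L n ω ^ 2 ∂P).toNNReal : ℝ) * t ^ 2 / 2)))
      atTop (𝓝 (charFun (P.map Z) t).re) := fun t => by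
    have := (Complex.continuous_re.tendsto _).comp (hd t)
    simpa only [Function.comp_def, Complex.ofReal_re] using this
  have him : ∀ t, (charFun (P.map Z) t).im = 0 := fun t => by
    refine tendsto_nhds_unique ((Complex.continuous_im.tendsto _).comp (hd t)) ?_
    simp [Function.comp_def, -Complex.ofReal_exp]
  -- The limit is a characteristic function, so it is continuous at zero; this rules out variances
  -- escaping to infinity.
  obtain ⟨w, hw⟩ := exists_eq_exp_of_tendsto
    (φ := fun t => (charFun (P.map Z) t).re)
    (Complex.continuous_re.comp continuous_charFun).continuousAt (by simp) hre
  refine ⟨w, hZ, Measure.ext_of_charFun (funext fun t => ?_)⟩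
  rw [hexp]
  refine Complex.ext ?_ ?_
  · rw [Complex.ofReal_re]; exact hw t
  · rw [Complex.ofReal_im]; exact him t

/-- The integral of a centered Gaussian process with continuous paths of linear growth against a
finite measure is a centered Gaussian. -/
theorem exists_hasLaw_gaussianReal_integral {W : ℝ → Ω → ℝ} {ν : Measure ℝ} [IsFiniteMeasure ν]
    (hG : IsGaussianProcess W P) (h0 : ∀ u, ∫ ω, W u ω ∂P = 0)
    (hc : ∀ ω, Continuous fun u => W u ω)
    (hb : ∀ ω, ∃ C : ℝ, ∀ u, |W u ω| ≤ C * (1 + |u|))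
    (hν : Integrable (fun u : ℝ => 1 + |u|) ν) :
    ∃ v : ℝ≥0, HasLaw (fun ω => ∫ u, W u ω ∂ν) (gaussianReal 0 v) P := by
  -- Simple functions approximating the identity of the line: evaluating W at φ_n(u) turns the
  -- integral into a finite linear combination of values of W. The base point 0 gives |φ_n(u)| ≤
  -- 2|u|, hence a dominating function.
  set φ : ℕ → SimpleFunc ℝ ℝ := fun n =>
    SimpleFunc.approxOn id measurable_id Set.univ 0 (Set.mem_univ _) n with hφ
  have hφlim : ∀ u, Tendsto (fun n => φ n u) atTop (𝓝 u) := fun u =>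
    SimpleFunc.tendsto_approxOn measurable_id (Set.mem_univ _) (by simp)
  have hφle : ∀ n u, |φ n u| ≤ 2 * |u| := by
    intro n u
    have := SimpleFunc.edist_approxOn_y0_le measurable_id (Set.mem_univ (0 : ℝ)) u n
    rw [← two_mul, edist_dist, edist_dist, ← ENNReal.ofReal_ofNat, ← ENNReal.ofReal_mul (by simp),
      ENNReal.ofReal_le_ofReal_iff (by positivity)] at this
    simpa [Real.dist_eq] using this
  have hsum : ∀ n ω, ∫ u, W (φ n u) ω ∂ν =
      ∑ x ∈ (φ n).range, ν.real (φ n ⁻¹' {x}) • W x ω := by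
    intro n ω
    have h1 : ∀ u, W (φ n u) ω =
        ∑ x ∈ (φ n).range, (φ n ⁻¹' {x}).indicator (fun _ => W x ω) u := by
      intro u
      rw [Finset.sum_eq_single (φ n u)]
      · simp
      · intro x _ hx
        exact Set.indicator_of_notMem (fun h => hx (by simpa using h.symm)) _
      · intro h
        exact absurd (SimpleFunc.mem_range_self _ u) h
    simp_rw [h1]
    rw [integral_finsetSum]
    · refine Finset.sum_congr rfl fun x _ => ?_
      rw [integral_indicator_const _ ((φ n).measurableSet_preimage _)]
    · intro x _
      exact (integrable_const _).indicator ((φ n).measurableSet_preimage _)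
  refine exists_hasLaw_gaussianReal_of_ae_tendsto (L := fun n ω => ∫ u, W (φ n u) ω ∂ν)
    (fun n => ?_) (fun n => ?_) (ae_of_all _ fun ω => ?_)
  · simp_rw [hsum]
    exact (hG.smul fun x => ν.real (φ n ⁻¹' {x})).hasGaussianLaw_fun_sum
  · simp_rw [hsum]
    rw [integral_finsetSum]
    · refine Finset.sum_eq_zero fun x _ => ?_
      rw [integral_smul, h0, smul_zero]
    · intro x _
      exact (hG.hasGaussianLaw_eval x).integrable.const_mul (ν.real (φ n ⁻¹' {x}))
  · obtain ⟨C, hC⟩ := hb ω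
    have hC0 : 0 ≤ C := by
      have := (abs_nonneg _).trans (hC 0)
      simpa using this
    refine tendsto_integral_of_dominated_convergence (fun u => C * 2 * (1 + |u|)) (fun n => ?_)
      (hν.const_mul _) (fun n => ae_of_all _ fun u => ?_) (ae_of_all _ fun u => ?_)
    · exact ((hc ω).measurable.comp (φ n).measurable).aestronglyMeasurable
    · calc ‖W (φ n u) ω‖ ≤ C * (1 + |φ n u|) := hC _
        _ ≤ C * (2 * (1 + |u|)) := by
          gcongr
          have := hφle n u
          linarith
        _ = _ := by ring
    · exact ((hc ω).tendsto u).comp (hφlim u)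

omit [IsProbabilityMeasure P] in
theorem integral_norm_mul_le_of_sq_le {X Y : Ω → ℝ} (hX : MemLp X 2 P) (hY : MemLp Y 2 P)
    {a b : ℝ} (ha : 0 ≤ a) (hb : 0 ≤ b) (hXa : ∫ ω, X ω ^ 2 ∂P ≤ a ^ 2)
    (hYb : ∫ ω, Y ω ^ 2 ∂P ≤ b ^ 2) : ∫ ω, ‖X ω * Y ω‖ ∂P ≤ a * b := by
  have h3 := integral_mul_le_Lp_mul_Lq_of_nonneg (μ := P) Real.HolderConjugate.two_two
    (f := fun ω => ‖X ω‖) (g := fun ω => ‖Y ω‖)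
    (ae_of_all _ fun _ => norm_nonneg _) (ae_of_all _ fun _ => norm_nonneg _)
    (by simpa using hX.norm) (by simpa using hY.norm)
  simp only [Real.rpow_two, Real.norm_eq_abs, sq_abs] at h3
  simp only [norm_mul, Real.norm_eq_abs]
  refine h3.trans (mul_le_mul ?_ ?_ (by positivity) ha)
  · rw [← Real.sqrt_eq_rpow]
    exact Real.sqrt_le_iff.2 ⟨ha, hXa⟩
  · rw [← Real.sqrt_eq_rpow]
    exact Real.sqrt_le_iff.2 ⟨hb, hYb⟩

/-- Fubini's theorem for the product of two integrals of square integrable processes. -/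
theorem integral_integral_mul_integral {U V : ℝ → Ω → ℝ} {ν : Measure ℝ} [IsFiniteMeasure ν]
    (hU : Measurable fun p : ℝ × Ω => U p.1 p.2) (hV : Measurable fun p : ℝ × Ω => V p.1 p.2)
    (hU2 : ∀ u, MemLp (U u) 2 P) (hV2 : ∀ u, MemLp (V u) 2 P)
    {a b : ℝ → ℝ} (ha : Integrable a ν) (hb : Integrable b ν)
    (hUa : ∀ᵐ u ∂ν, 0 ≤ a u ∧ ∫ ω, U u ω ^ 2 ∂P ≤ a u ^ 2)
    (hVb : ∀ᵐ u ∂ν, 0 ≤ b u ∧ ∫ ω, V u ω ^ 2 ∂P ≤ b u ^ 2) :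
    ∫ ω, (∫ u, U u ω ∂ν) * (∫ u, V u ω ∂ν) ∂P =
      ∫ q, ∫ ω, U q.1 ω * V q.2 ω ∂P ∂(ν.prod ν) := by
  have hmeas : Measurable fun p : Ω × (ℝ × ℝ) => U p.2.1 p.1 * V p.2.2 p.1 :=
    (hU.comp (by fun_prop : Measurable fun p : Ω × (ℝ × ℝ) => (p.2.1, p.1))).mul
      (hV.comp (by fun_prop : Measurable fun p : Ω × (ℝ × ℝ) => (p.2.2, p.1)))
  have hint : Integrable (fun p : Ω × (ℝ × ℝ) => U p.2.1 p.1 * V p.2.2 p.1)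
      (P.prod (ν.prod ν)) := by
    rw [integrable_prod_iff' hmeas.aestronglyMeasurable]
    refine ⟨ae_of_all _ fun q => (hU2 q.1).integrable_mul (hV2 q.2), ?_⟩
    -- By Cauchy-Schwarz, E|U_u V_v| ≤ a(u) b(v), which is integrable for the product measure.
    refine (ha.mul_prod hb).mono' ?_ ?_
    · exact (hmeas.norm.stronglyMeasurable.integral_prod_left).aestronglyMeasurable
    · have h1 : ∀ᵐ q ∂ν.prod ν, 0 ≤ a q.1 ∧ ∫ ω, U q.1 ω ^ 2 ∂P ≤ a q.1 ^ 2 :=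
        Measure.quasiMeasurePreserving_fst.ae hUa
      have h2 : ∀ᵐ q ∂ν.prod ν, 0 ≤ b q.2 ∧ ∫ ω, V q.2 ω ^ 2 ∂P ≤ b q.2 ^ 2 :=
        Measure.quasiMeasurePreserving_snd.ae hVb
      filter_upwards [h1, h2] with q hq1 hq2
      rw [Real.norm_of_nonneg (integral_nonneg fun ω => norm_nonneg _)]
      exact integral_norm_mul_le_of_sq_le (hU2 q.1) (hV2 q.2) hq1.1 hq2.1 hq1.2 hq2.2
  refine Eq.trans ?_ (integral_integral_swap (f := fun ω (q : ℝ × ℝ) => U q.1 ω * V q.2 ω) hint)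
  refine integral_congr_ae (ae_of_all _ fun ω => ?_)
  exact (integral_prod_mul (fun u => U u ω) fun u => V u ω).symm

end GaussianLimit

/-! ### First and second differences of powers at infinity. -/

section PowerAsymptotics

/-- Mean value inequality on a half-line where |h'| is small. Staying beyond N + |a| keeps both x
and x - a in it, whatever the sign of a. -/
theorem tendsto_sub_shift_of_deriv_tendsto_zero {h h' : ℝ → ℝ} (a : ℝ)
    (hd : ∀ᶠ x in atTop, HasDerivAt h (h' x) x) (h0 : Tendsto h' atTop (𝓝 0)) :
    Tendsto (fun x => h x - h (x - a)) atTop (𝓝 0) := by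
  rw [Metric.tendsto_nhds]
  intro ε hε
  have hε' : 0 < ε / (|a| + 1) := by positivity
  have h1 := (Metric.tendsto_nhds.1 h0 _ hε').and hd
  obtain ⟨N, hN⟩ := eventually_atTop.1 h1
  filter_upwards [eventually_ge_atTop (N + |a|)] with x hx
  have hx1 : x ∈ Set.Ici N := by
    have := abs_nonneg a
    exact Set.mem_Ici.2 (by linarith)
  have hx2 : x - a ∈ Set.Ici N := by
    have := le_abs_self a
    exact Set.mem_Ici.2 (by linarith)
  have := (convex_Ici N).norm_image_sub_le_of_norm_hasDerivWithin_le
    (fun y hy => (hN y hy).2.hasDerivWithinAt)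
    (fun y hy => by simpa [Real.dist_eq] using (hN y hy).1.le) hx2 hx1
  rw [Real.dist_eq, sub_zero]
  rw [sub_sub_cancel, Real.norm_eq_abs, Real.norm_eq_abs] at this
  calc _ ≤ ε / (|a| + 1) * |a| := this
    _ < ε / (|a| + 1) * (|a| + 1) := by gcongr; linarith
    _ = ε := by field_simp

theorem tendsto_rpow_sub_shift {β : ℝ} (hβ : β < 1) (a : ℝ) :
    Tendsto (fun x : ℝ => x ^ β - (x - a) ^ β) atTop (𝓝 0) := by
  refine tendsto_sub_shift_of_deriv_tendsto_zero (h' := fun x => β * x ^ (β - 1)) a ?_ ?_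
  · filter_upwards [eventually_gt_atTop 0] with x hx
    exact Real.hasDerivAt_rpow_const (Or.inl hx.ne')
  · have := (tendsto_rpow_neg_atTop (y := 1 - β) (by linarith)).const_mul β
    simpa using this

/-- The shift lemma is used twice: the derivative of the first difference of x^γ is γ times a first
difference of x^{γ-1}, and γ - 1 < 1. -/
theorem tendsto_rpow_mixed_difference {γ : ℝ} (hγ : γ < 2) (a b : ℝ) :
    Tendsto (fun x : ℝ => x ^ γ - (x - a) ^ γ - ((x - b) ^ γ - (x - b - a) ^ γ)) atTop (𝓝 0) := by
  refine tendsto_sub_shift_of_deriv_tendsto_zero (h := fun x => x ^ γ - (x - a) ^ γ)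
    (h' := fun x => γ * (x ^ (γ - 1) - (x - a) ^ (γ - 1))) b ?_ ?_
  · filter_upwards [eventually_gt_atTop 0, eventually_gt_atTop a] with x hx hxa
    have h1 := Real.hasDerivAt_rpow_const (x := x) (p := γ) (Or.inl hx.ne')
    have h2 := (Real.hasDerivAt_rpow_const (x := x - a) (p := γ)
      (Or.inl (sub_pos.2 hxa).ne')).comp x ((hasDerivAt_id x).sub_const a)
    refine (h1.sub h2).congr_deriv ?_
    ring
  · simpa using (tendsto_rpow_sub_shift (β := γ - 1) (by linarith) a).const_mul γ

/-- With d = x^H - (x-a)^H → 0, the difference of squares is d(2x^H - d). This treats all H in (0,1)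
at once, although x^{2H} - (x-a)^{2H} itself may diverge. -/
theorem tendsto_rpow_sub_shift_div {H : ℝ} (hH0 : 0 < H) (hH1 : H < 1) (a : ℝ) :
    Tendsto (fun x : ℝ => (x ^ (2 * H) - (x - a) ^ (2 * H)) / x ^ H) atTop (𝓝 0) := by
  have h1 := tendsto_rpow_sub_shift hH1 a
  have h2 : Tendsto (fun x : ℝ => x ^ H) atTop atTop := tendsto_rpow_atTop hH0
  have h3 : Tendsto (fun x : ℝ => (x ^ H - (x - a) ^ H) * (2 - (x ^ H - (x - a) ^ H) * (x ^ H)⁻¹))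
      atTop (𝓝 (0 * (2 - 0 * 0))) :=
    h1.mul (tendsto_const_nhds.sub (h1.mul h2.inv_tendsto_atTop))
  rw [zero_mul] at h3
  refine h3.congr' ?_
  filter_upwards [eventually_gt_atTop 0, eventually_gt_atTop a] with x hx hxa
  have hp : 0 < x ^ H := by positivity
  rw [mul_comm 2 H, Real.rpow_mul hx.le, Real.rpow_mul (sub_pos.2 hxa).le, Real.rpow_two,
    Real.rpow_two]
  field_simp
  ring

end PowerAsymptotics

/-! ### Moments of sums and differences of two independent exponential variables. -/

section ExpIntegrals

variable {θ : ℝ}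

/-- The memoryless property: beyond v, the weight is e^{-θv} times its own translate. -/
theorem integral_expWeight_shift (hθ : 0 < θ) (f : ℝ → ℝ) {v : ℝ} (hv : 0 ≤ v) :
    ∫ u, (Set.Ioi v).indicator (fun u => f (u - v)) u ∂expWeight θ =
      Real.exp (-θ * v) * ∫ u, f u ∂expWeight θ := by
  rw [integral_expWeight hθ, integral_expWeight hθ, ← integral_indicator measurableSet_Ioi,
    ← integral_indicator measurableSet_Ioi, mul_left_comm]
  congr 1
  rw [← integral_const_mul, ← integral_add_right_eq_self (fun s => (Set.Ioi (0 : ℝ)).indicator (fun s =>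
    Real.exp (-θ * s) * (Set.Ioi v).indicator (fun u => f (u - v)) s) s) v]
  refine integral_congr_ae (ae_of_all _ fun u => ?_)
  by_cases hu : 0 < u
  · have h1 : 0 < u + v := by linarith
    simp only [Set.indicator, Set.mem_Ioi, h1, hu, if_true, lt_add_iff_pos_left, add_sub_cancel_right]
    rw [show -θ * (u + v) = -θ * v + -θ * u by ring, Real.exp_add]
    ring
  · simp [Set.indicator, Set.mem_Ioi, hu]

theorem integrable_abs_sub_rpow_expWeight (hθ : 0 < θ) {a : ℝ} (ha : 0 ≤ a) :
    Integrable (fun q : ℝ × ℝ => |q.1 - q.2| ^ a) ((expWeight θ).prod (expWeight θ)) ∧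
    Integrable (fun q : ℝ × ℝ => (q.1 + q.2) ^ a) ((expWeight θ).prod (expWeight θ)) := by
  have := isProbabilityMeasure_expWeight hθ
  have hi := integrable_rpow_expWeight hθ (a := a) (by linarith)
  have hdom : Integrable (fun q : ℝ × ℝ => (2 : ℝ) ^ a * (q.1 ^ a + q.2 ^ a))
      ((expWeight θ).prod (expWeight θ)) :=
    ((hi.comp_fst _).add (hi.comp_snd _)).const_mul _
  have hpos1 : ∀ᵐ q ∂(expWeight θ).prod (expWeight θ), 0 < q.1 :=
    Measure.quasiMeasurePreserving_fst.ae (ae_expWeight_pos θ)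
  have hpos2 : ∀ᵐ q ∂(expWeight θ).prod (expWeight θ), 0 < q.2 :=
    Measure.quasiMeasurePreserving_snd.ae (ae_expWeight_pos θ)
  have key : ∀ x y : ℝ, 0 < x → 0 < y → (x + y) ^ a ≤ 2 ^ a * (x ^ a + y ^ a) := by
    intro x y hx hy
    rcases le_total x y with h | h
    · calc (x + y) ^ a ≤ (2 * y) ^ a := by gcongr; linarith
        _ = 2 ^ a * y ^ a := Real.mul_rpow (by norm_num) hy.le
        _ ≤ _ := by gcongr; linarith [Real.rpow_nonneg hx.le a]
    · calc (x + y) ^ a ≤ (2 * x) ^ a := by gcongr; linarith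
        _ = 2 ^ a * x ^ a := Real.mul_rpow (by norm_num) hx.le
        _ ≤ _ := by gcongr; linarith [Real.rpow_nonneg hy.le a]
  constructor
  · refine hdom.mono' (by fun_prop) ?_
    filter_upwards [hpos1, hpos2] with q h1 h2
    rw [Real.norm_of_nonneg (by positivity)]
    refine le_trans ?_ (key _ _ h1 h2)
    gcongr
    rw [abs_le]
    constructor <;> linarith
  · refine hdom.mono' (by fun_prop) ?_
    filter_upwards [hpos1, hpos2] with q h1 h2
    rw [Real.norm_of_nonneg (by positivity)]
    exact key _ _ h1 h2

theorem integral_exp_neg_expWeight (hθ : 0 < θ) :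
    ∫ v, Real.exp (-θ * v) ∂expWeight θ = 1 / 2 := by
  rw [integral_expWeight hθ]
  have h : ∀ s : ℝ, Real.exp (-θ * s) * Real.exp (-θ * s) = Real.exp (-(2 * θ) * s) := fun s => by
    rw [← Real.exp_add]; ring_nf
  simp_rw [h]
  rw [integral_exp_mul_Ioi (by linarith)]
  simp
  field_simp

/-- The absolute difference of two independent exponential variables is again exponential. On each
side of the diagonal memorylessness gives the a-th moment times ∫ e^{-θv}, which is 1/2; the
diagonal contributes nothing because a > 0. -/
theorem integral_abs_sub_rpow_expWeight (hθ : 0 < θ) {a : ℝ} (ha : 0 < a) :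
    ∫ q, |q.1 - q.2| ^ a ∂((expWeight θ).prod (expWeight θ)) = Real.Gamma (a + 1) / θ ^ a := by
  have := isProbabilityMeasure_expWeight hθ
  have hI := (integrable_abs_sub_rpow_expWeight hθ ha.le).1
  have hs : MeasurableSet {q : ℝ × ℝ | q.2 < q.1} := measurableSet_lt measurable_snd measurable_fst
  have hs' : MeasurableSet {q : ℝ × ℝ | q.1 < q.2} := measurableSet_lt measurable_fst measurable_snd
  have hhalf : ∫ q, {q : ℝ × ℝ | q.2 < q.1}.indicator (fun q => |q.1 - q.2| ^ a) q
      ∂((expWeight θ).prod (expWeight θ)) = (1 / 2) * (Real.Gamma (a + 1) / θ ^ a) := by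
    rw [integral_prod_symm _ (hI.indicator hs)]
    have h1 : ∀ᵐ v ∂expWeight θ, ∫ u, {q : ℝ × ℝ | q.2 < q.1}.indicator
        (fun q => |q.1 - q.2| ^ a) (u, v) ∂expWeight θ =
        Real.exp (-θ * v) * (Real.Gamma (a + 1) / θ ^ a) := by
      filter_upwards [ae_expWeight_pos θ] with v hv
      rw [← integral_rpow_expWeight hθ (by linarith : -1 < a), ← integral_expWeight_shift hθ _ hv.le]
      refine integral_congr_ae (ae_of_all _ fun u => ?_)
      by_cases h : v < u
      · simp [Set.indicator, h, abs_of_pos (sub_pos.2 h)]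
      · simp [Set.indicator, h]
    rw [integral_congr_ae h1, integral_mul_const, integral_exp_neg_expWeight hθ]
  have hhalf' : ∫ q, {q : ℝ × ℝ | q.1 < q.2}.indicator (fun q => |q.1 - q.2| ^ a) q
      ∂((expWeight θ).prod (expWeight θ)) = (1 / 2) * (Real.Gamma (a + 1) / θ ^ a) := by
    rw [← hhalf, ← integral_prod_swap]
    refine integral_congr_ae (ae_of_all _ fun q => ?_)
    simp [Set.indicator, abs_sub_comm]
  have hsum : ∀ q : ℝ × ℝ, |q.1 - q.2| ^ a =
      {q : ℝ × ℝ | q.2 < q.1}.indicator (fun q => |q.1 - q.2| ^ a) q +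
      {q : ℝ × ℝ | q.1 < q.2}.indicator (fun q => |q.1 - q.2| ^ a) q := by
    intro q
    rcases lt_trichotomy q.1 q.2 with h | h | h
    · simp [Set.indicator, h, h.not_gt]
    · simp [Set.indicator, h, Real.zero_rpow ha.ne']
    · simp [Set.indicator, h, h.not_gt]
  rw [integral_congr_ae (ae_of_all _ hsum), integral_add (hI.indicator hs) (hI.indicator hs'),
    hhalf, hhalf']
  ring

/-- Memorylessness turns e^{-θv} ∫ (u+v)^a into the integral of u^a over u > v. Integrating in v
first then gives the length u of (0,u), so that the moment of order a + 1 appears, and with it the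
factor a + 1 from Γ(a+2). -/
theorem integral_add_rpow_expWeight (hθ : 0 < θ) {a : ℝ} (ha : 0 < a) :
    ∫ q, (q.1 + q.2) ^ a ∂((expWeight θ).prod (expWeight θ)) =
      (a + 1) * (Real.Gamma (a + 1) / θ ^ a) := by
  have := isProbabilityMeasure_expWeight hθ
  have hI := (integrable_abs_sub_rpow_expWeight hθ ha.le).2
  set f : ℝ → ℝ → ℝ := fun v u => (Set.Ioi v).indicator (fun u => u ^ a) u with hf
  have hfm : Measurable fun q : ℝ × ℝ => f q.1 q.2 := by
    have : (fun q : ℝ × ℝ => f q.1 q.2) =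
        {q : ℝ × ℝ | q.1 < q.2}.indicator fun q => q.2 ^ a := by
      ext q; simp [hf, Set.indicator]
    rw [this]
    exact (by fun_prop : Measurable fun q : ℝ × ℝ => q.2 ^ a).indicator
      (measurableSet_lt measurable_fst measurable_snd)
  have hin : ∀ u : ℝ, 0 < u → ∫ v in Set.Ioi (0 : ℝ), f v u = u ^ (a + 1) := by
    intro u hu
    have : ∀ v, f v u = (Set.Iio u).indicator (fun _ => u ^ a) v := fun v => by
      simp [hf, Set.indicator]
    simp_rw [this]
    rw [setIntegral_indicator measurableSet_Iio, setIntegral_const, Set.Ioi_inter_Iio,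
      Real.volume_real_Ioo_of_le hu.le, smul_eq_mul, sub_zero, Real.rpow_add_one hu.ne', mul_comm]
  have hint : Integrable (fun q : ℝ × ℝ => f q.1 q.2)
      ((volume.restrict (Set.Ioi (0 : ℝ))).prod (expWeight θ)) := by
    rw [integrable_prod_iff' hfm.aestronglyMeasurable]
    constructor
    · filter_upwards with u
      have : ∀ v, f v u = (Set.Iio u).indicator (fun _ => u ^ a) v := fun v => by
        simp [hf, Set.indicator]
      simp_rw [this]
      rw [integrable_indicator_iff measurableSet_Iio, IntegrableOn,
        Measure.restrict_restrict measurableSet_Iio]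
      exact integrableOn_const (by
        rw [Set.inter_comm, Set.Ioi_inter_Iio]; simp) 
    · refine (integrable_rpow_expWeight hθ (a := a + 1) (by linarith)).congr ?_
      filter_upwards [ae_expWeight_pos θ] with u hu
      rw [← hin u hu]
      refine integral_congr_ae (ae_of_all _ fun v => ?_)
      simp only [hf, Set.indicator]
      split_ifs
      · exact (Real.norm_of_nonneg (by positivity)).symm
      · simp
  have h1 : ∀ v : ℝ, 0 < v → Real.exp (-θ * v) * ∫ u, (u + v) ^ a ∂expWeight θ =
      ∫ u, f v u ∂expWeight θ := by
    intro v hv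
    rw [← integral_expWeight_shift hθ _ hv.le]
    simp [hf]
  rw [integral_prod_symm _ hI, integral_expWeight hθ,
    setIntegral_congr_fun measurableSet_Ioi fun v hv => h1 v hv,
    integral_integral_swap hint]
  have h2 : ∫ u, (∫ v in Set.Ioi (0 : ℝ), f v u) ∂expWeight θ = ∫ u, u ^ (a + 1) ∂expWeight θ :=
    integral_congr_ae (by filter_upwards [ae_expWeight_pos θ] with u hu using hin u hu)
  rw [h2, integral_rpow_expWeight hθ (by linarith), Real.Gamma_add_one (by linarith),
    Real.rpow_add_one hθ.ne']
  field_simp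

end ExpIntegrals

/-! ### Limits of covariances of increments. -/

/-- The covariance of two increments `S_a - S_b` and `S_c - S_d` of subfractional Brownian
motion. -/
noncomputable def subfIncrCov (H a b c d : ℝ) : ℝ :=
  subfCov H a c - subfCov H a d - subfCov H b c + subfCov H b d

section CovarianceAsymptotics

variable {H : ℝ}

theorem subfCov_zero_right (hH : 0 < H) {a : ℝ} (ha : 0 ≤ a) : subfCov H a 0 = 0 := by
  rw [subfCov, Real.zero_rpow (by positivity), zero_add, zero_sub, abs_neg, abs_of_nonneg ha]
  ring_nf

/-- All terms that depend on T form half of a second difference of x^{2H}, which vanishes because 2H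
< 2. So the covariance with a fixed time stays bounded. -/
theorem tendsto_subfCov_atTop (hH1 : H < 1) (v : ℝ) :
    Tendsto (fun T => subfCov H T v) atTop (𝓝 (v ^ (2 * H))) := by
  have h := (tendsto_rpow_mixed_difference (γ := 2 * H) (by linarith) v v).comp
    (tendsto_atTop_add_const_right atTop v tendsto_id)
  have h2 := (h.const_mul (1 / 2)).const_sub (v ^ (2 * H))
  simp only [mul_zero, sub_zero] at h2
  refine h2.congr' ?_
  filter_upwards [eventually_gt_atTop v] with T hT
  simp only [Function.comp, id, subfCov]
  rw [abs_sub_comm, abs_of_pos (sub_pos.2 hT), add_sub_cancel_right, add_comm v T]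
  ring

/-- Far from the origin the increments behave like those of fractional Brownian motion: the
nonstationary part of their covariance is a mixed difference of x^{2H} at x = 2T. -/
theorem tendsto_subfIncrCov_lag_lag (hH0 : 0 < H) (hH1 : H < 1) {u v : ℝ} (hu : 0 ≤ u)
    (hv : 0 ≤ v) :
    Tendsto (fun T => subfIncrCov H T (T - u) T (T - v)) atTop
      (𝓝 (1 / 2 * (u ^ (2 * H) + v ^ (2 * H) - |u - v| ^ (2 * H)))) := by
  have h := (tendsto_rpow_mixed_difference (γ := 2 * H) (by linarith) u v).comp
    ((tendsto_id (α := ℝ) (x := atTop)).const_mul_atTop (zero_lt_two' ℝ))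
  have h2 := (h.const_mul (1 / 2)).const_sub (1 / 2 * (u ^ (2 * H) + v ^ (2 * H) - |u - v| ^ (2 * H)))
  simp only [mul_zero, sub_zero] at h2
  refine h2.congr' ?_
  filter_upwards [eventually_gt_atTop u, eventually_gt_atTop v] with T hTu hTv
  simp only [Function.comp, id, subfIncrCov, subfCov]
  rw [show T - v - T = -v by ring, show T - (T - u) = u by ring,
    show T - v - (T - u) = u - v by ring, sub_self, abs_zero, abs_neg, abs_of_nonneg hu,
    abs_of_nonneg hv, Real.zero_rpow (by positivity), show T + T = 2 * T by ring,
    show T - v + T = 2 * T - v by ring, show T + (T - u) = 2 * T - u by ring,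
    show T - v + (T - u) = 2 * T - v - u by ring]
  ring_nf

/-- Both S_T and S_{T-u} have a covariance with S_v that tends to v^{2H}, so the increment
decorrelates from the fixed past. -/
theorem tendsto_subfIncrCov_lag_fixed (hH0 : 0 < H) (hH1 : H < 1) (u v : ℝ) :
    Tendsto (fun T => subfIncrCov H T (T - u) v 0) atTop (𝓝 0) := by
  have h1 := tendsto_subfCov_atTop hH1 v
  have h2 := h1.comp (tendsto_atTop_add_const_right atTop (-u) tendsto_id)
  have h3 := h1.sub h2
  rw [sub_self] at h3
  refine h3.congr' ?_
  filter_upwards [eventually_ge_atTop 0, eventually_ge_atTop u] with T h0 hT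
  simp only [Function.comp, id, subfIncrCov]
  rw [subfCov_zero_right hH0 h0, subfCov_zero_right hH0 (sub_nonneg.2 hT)]
  ring_nf

theorem tendsto_inv_rpow_atTop (hH0 : 0 < H) :
    Tendsto (fun T : ℝ => (T ^ H)⁻¹) atTop (𝓝 0) :=
  (tendsto_rpow_atTop hH0).inv_tendsto_atTop

theorem tendsto_subfIncrCov_fixed_div (hH0 : 0 < H) (hH1 : H < 1) {v : ℝ} (hv : 0 ≤ v) :
    Tendsto (fun T => (T ^ H)⁻¹ * subfIncrCov H T 0 v 0) atTop (𝓝 0) := by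
  have h3 := (tendsto_inv_rpow_atTop hH0).mul (tendsto_subfCov_atTop hH1 v)
  rw [zero_mul] at h3
  refine h3.congr' ?_
  filter_upwards [eventually_ge_atTop 0] with T h0
  rw [subfIncrCov, subfCov_zero_right hH0 h0, subfCov_zero_right hH0 le_rfl, subfCov_comm H 0 v,
    subfCov_zero_right hH0 hv]
  ring

/-- The covariance consists of first differences of x^{2H} at T and at 2T and of a constant, and
each of them is o(T^H). -/
theorem tendsto_subfIncrCov_lag_div (hH0 : 0 < H) (hH1 : H < 1) {v : ℝ} (hv : 0 ≤ v) :
    Tendsto (fun T => (T ^ H)⁻¹ * subfIncrCov H T 0 T (T - v)) atTop (𝓝 0) := by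
  have h1 := tendsto_rpow_sub_shift_div hH0 hH1 v
  have h2 := h1.comp ((tendsto_id (α := ℝ) (x := atTop)).const_mul_atTop (zero_lt_two' ℝ))
  have h3 := (tendsto_inv_rpow_atTop hH0).mul_const (1 / 2 * v ^ (2 * H))
  -- The difference at 2T is normalised by (2T)^H; the factor 2^H restores T^H.
  have h4 := (h1.sub (h2.const_mul (1 / 2 * 2 ^ H))).add h3
  simp only [mul_zero, zero_mul, sub_zero, add_zero] at h4
  refine h4.congr' ?_
  filter_upwards [eventually_gt_atTop 0, eventually_gt_atTop v] with T h0 hT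
  simp only [Function.comp, id, subfIncrCov]
  rw [subfCov_comm H 0 T, subfCov_comm H 0 (T - v), subfCov_zero_right hH0 h0.le,
    subfCov_zero_right hH0 (sub_pos.2 hT).le, Real.mul_rpow (x := 2) (z := H) (by norm_num) h0.le]
  simp only [subfCov]
  rw [show T - v - T = -v by ring, sub_self, abs_zero, abs_neg, abs_of_nonneg hv,
    Real.zero_rpow (by positivity), show T + T = 2 * T by ring,
    show T - v + T = 2 * T - v by ring]
  have : (2 : ℝ) ^ H ≠ 0 := by positivity
  have : T ^ H ≠ 0 := by positivity
  field_simp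
  ring

theorem measurable_subfIncrCov (H : ℝ) {α : Type*} [MeasurableSpace α] {a b c d : α → ℝ}
    (ha : Measurable a) (hb : Measurable b) (hc : Measurable c) (hd : Measurable d) :
    Measurable fun x => subfIncrCov H (a x) (b x) (c x) (d x) := by
  unfold subfIncrCov subfCov
  fun_prop

end CovarianceAsymptotics

/-! ### The lagged mean and bounds along a path of sublinear growth. -/

/-- The exponentially weighted mean of the increments of `g` before time `T`; it equals
`e^{-θT} ∫_0^T e^{θs} dg_s`. -/
noncomputable def laggedMean (θ : ℝ) (g : ℝ≥0 → ℝ) (T : ℝ≥0) : ℝ :=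
  ∫ u, (g T - g (T - u.toNNReal)) ∂expWeight θ

theorem zetaInf_eq_integral_expWeight {θ : ℝ} (hθ : 0 < θ) (g : ℝ≥0 → ℝ) :
    zetaInf θ g = ∫ u, g u.toNNReal ∂expWeight θ :=
  (integral_expWeight hθ _).symm

section Path

variable {g : ℝ≥0 → ℝ} {θ : ℝ}

theorem exists_abs_le_of_tendsto_div (hc : Continuous g)
    (hg : Tendsto (fun t : ℝ≥0 => g t / t) atTop (𝓝 0)) :
    ∃ C : ℝ, 0 ≤ C ∧ ∀ t : ℝ≥0, |g t| ≤ C * (1 + t) := by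
  obtain ⟨N, hN⟩ := eventually_atTop.1 ((Metric.tendsto_nhds.1 hg 1 one_pos).and
    (eventually_gt_atTop 0))
  obtain ⟨B, hB⟩ := (isCompact_Icc (a := (0 : ℝ≥0)) (b := N)).exists_bound_of_continuousOn
    hc.continuousOn
  have hB0 : 0 ≤ B := (norm_nonneg _).trans (hB 0 ⟨le_rfl, zero_le⟩)
  refine ⟨B + 1, by positivity, fun t => ?_⟩
  have ht := t.coe_nonneg
  rcases le_total t N with h | h
  · have := hB t ⟨zero_le, h⟩
    rw [Real.norm_eq_abs] at this
    nlinarith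
  · obtain ⟨h1, h2⟩ := hN t h
    have h2' : (0 : ℝ) < t := h2
    rw [Real.dist_eq, sub_zero, abs_div, abs_of_pos h2', div_lt_one h2'] at h1
    nlinarith

theorem abs_le_one_add_abs {C : ℝ} (hC : 0 ≤ C) (h : ∀ t : ℝ≥0, |g t| ≤ C * (1 + t)) (u : ℝ) :
    |g u.toNNReal| ≤ C * (1 + |u|) := by
  refine (h _).trans ?_
  gcongr
  rw [Real.coe_toNNReal']
  exact max_le (le_abs_self u) (abs_nonneg u)

theorem integrable_comp_toNNReal_expWeight (hθ : 0 < θ) (hc : Continuous g)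
    (hg : Tendsto (fun t : ℝ≥0 => g t / t) atTop (𝓝 0)) :
    Integrable (fun u : ℝ => g u.toNNReal) (expWeight θ) := by
  obtain ⟨C, hC, h⟩ := exists_abs_le_of_tendsto_div hc hg
  refine ((integrable_one_add_abs_expWeight hθ).const_mul C).mono'
    (hc.comp continuous_real_toNNReal).aestronglyMeasurable (ae_of_all _ fun u => ?_)
  exact abs_le_one_add_abs hC h u

theorem continuous_lag (hc : Continuous g) (T : ℝ≥0) :
    Continuous fun u : ℝ => g T - g (T - u.toNNReal) :=
  continuous_const.sub (hc.comp (continuous_const.sub continuous_real_toNNReal))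

theorem abs_lag_le {C : ℝ} (hC : 0 ≤ C) (h : ∀ t : ℝ≥0, |g t| ≤ C * (1 + t)) (T : ℝ≥0) (u : ℝ) :
    |g T - g (T - u.toNNReal)| ≤ 2 * C * (1 + T) := by
  have h1 := h T
  have h2 := h (T - u.toNNReal)
  have h3 : ((T - u.toNNReal : ℝ≥0) : ℝ) ≤ T := NNReal.coe_le_coe.2 tsub_le_self
  have h4 : C * (1 + ((T - u.toNNReal : ℝ≥0) : ℝ)) ≤ C * (1 + T) := by gcongr
  calc _ ≤ |g T| + |g (T - u.toNNReal)| := abs_sub _ _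
    _ ≤ _ := by linarith

theorem integrable_lag_expWeight (hθ : 0 < θ) (hc : Continuous g)
    (hg : Tendsto (fun t : ℝ≥0 => g t / t) atTop (𝓝 0)) (T : ℝ≥0) :
    Integrable (fun u : ℝ => g T - g (T - u.toNNReal)) (expWeight θ) := by
  have := isProbabilityMeasure_expWeight hθ
  obtain ⟨C, hC, h⟩ := exists_abs_le_of_tendsto_div hc hg
  exact (integrable_const (2 * C * (1 + T))).mono' (continuous_lag hc T).aestronglyMeasurable
    (ae_of_all _ fun u => abs_lag_le hC h T u)

end Path

/-! ### Gaussianity and second moments of S_T, the lagged mean and ζ_∞. -/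

section Moments

variable {Ω : Type*} [MeasurableSpace Ω] {P : Measure Ω} [IsProbabilityMeasure P] {H θ : ℝ}
  {S : ℝ≥0 → Ω → ℝ}

namespace IsRegularSubfractionalBM

/-- The weight is a probability measure, so the whole combination is one integral over u of a
Gaussian process, linear in the values of S at T, T - u and u. All linear combinations are treated
at once because the joint law is needed later. -/
theorem exists_hasLaw_comb (hS : IsRegularSubfractionalBM H S P) (hθ : 0 < θ) (T : ℝ≥0)
    (a b c : ℝ) :
    ∃ v : ℝ≥0, HasLaw (fun ω => a * S T ω + b * laggedMean θ (S · ω) T + c * zetaInf θ (S · ω))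
      (gaussianReal 0 v) P := by
  classical
  have := isProbabilityMeasure_expWeight hθ
  have key := exists_hasLaw_gaussianReal_integral (P := P) (ν := expWeight θ)
    (W := fun u ω => a * S T ω + b * (S T ω - S (T - u.toNNReal) ω) + c * S u.toNNReal ω)
    ?_ ?_ ?_ ?_ (integrable_one_add_abs_expWeight hθ)
  · obtain ⟨v, hv⟩ := key
    refine ⟨v, hv.congr (ae_of_all _ fun ω => ?_)⟩
    have h1 := integrable_lag_expWeight hθ (hS.continuous ω) (hS.tendsto_div ω) T
    have h2 := integrable_comp_toNNReal_expWeight hθ (hS.continuous ω) (hS.tendsto_div ω)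
    simp only
    have h3 : Integrable (fun u : ℝ => a * S T ω + b * (S T ω - S (T - u.toNNReal) ω))
        (expWeight θ) := (integrable_const _).add (h1.const_mul b)
    rw [integral_add h3 (h2.const_mul c), integral_add (integrable_const _) (h1.const_mul b), integral_const, integral_const_mul,
      integral_const_mul, zetaInf_eq_integral_expWeight hθ, laggedMean]
    simp
  · refine hS.gaussian.of_isGaussianProcess fun u =>
      ⟨{T, T - u.toNNReal, u.toNNReal},
        { toFun := fun x => a * x ⟨T, by simp⟩ + b * (x ⟨T, by simp⟩ - x ⟨T - u.toNNReal, by simp⟩)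
            + c * x ⟨u.toNNReal, by simp⟩
          map_add' := fun x y => by simp only [Pi.add_apply]; ring
          map_smul' := fun r x => by simp only [Pi.smul_apply, smul_eq_mul, RingHom.id_apply]; ring },
        fun ω => by simp⟩
  · intro u
    have hi : ∀ t, Integrable (S t) P := fun t => (hS.gaussian.hasGaussianLaw_eval t).integrable
    have h1 := (hi T).const_mul a
    have h2 : Integrable (fun ω => b * (S T ω - S (T - u.toNNReal) ω)) P :=
      ((hi T).sub (hi (T - u.toNNReal))).const_mul b
    have h3 := (hi u.toNNReal).const_mul c
    have h12 : Integrable (fun ω => a * S T ω + b * (S T ω - S (T - u.toNNReal) ω)) P := h1.add h2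
    rw [integral_add h12 h3, integral_add h1 h2, integral_const_mul, integral_const_mul,
      integral_const_mul, hS.integral_sub_eq_zero, hS.centered, hS.centered]
    ring
  · intro ω
    exact (continuous_const.add ((continuous_lag (hS.continuous ω) T).const_mul b)).add
      (((hS.continuous ω).comp continuous_real_toNNReal).const_mul c)
  · intro ω
    obtain ⟨C, hC, h⟩ := exists_abs_le_of_tendsto_div (hS.continuous ω) (hS.tendsto_div ω)
    refine ⟨|a| * |S T ω| + |b| * (2 * C * (1 + T)) + |c| * C, fun u => ?_⟩
    have h1 := abs_lag_le hC h T u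
    have h2 := abs_le_one_add_abs hC h u
    have hu : 1 ≤ 1 + |u| := by linarith [abs_nonneg u]
    have hT := T.coe_nonneg
    calc _ ≤ |a * S T ω| + |b * (S T ω - S (T - u.toNNReal) ω)| + |c * S u.toNNReal ω| :=
          abs_add_three _ _ _
      _ = |a| * |S T ω| + |b| * |S T ω - S (T - u.toNNReal) ω| + |c| * |S u.toNNReal ω| := by
          simp only [abs_mul]
      _ ≤ |a| * |S T ω| * (1 + |u|) + |b| * (2 * C * (1 + T)) * (1 + |u|)
          + |c| * (C * (1 + |u|)) := by
        have h3 : |a| * |S T ω| ≤ |a| * |S T ω| * (1 + |u|) :=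
          le_mul_of_one_le_right (by positivity) hu
        have h4 : |b| * (2 * C * (1 + T)) ≤ |b| * (2 * C * (1 + T)) * (1 + |u|) :=
          le_mul_of_one_le_right (by positivity) hu
        have h5 := mul_le_mul_of_nonneg_left h1 (abs_nonneg b)
        have h6 := mul_le_mul_of_nonneg_left h2 (abs_nonneg c)
        linarith
      _ = _ := by ring

omit [IsProbabilityMeasure P] in
theorem memLp_increment (hS : IsRegularSubfractionalBM H S P) (s t : ℝ≥0) :
    MemLp (fun ω => S t ω - S s ω) 2 P :=
  (hS.memLp_two t).sub (hS.memLp_two s)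

omit [IsProbabilityMeasure P] in
theorem increment_sq_le (hS : IsRegularSubfractionalBM H S P) (hH : 0 < H) {s t : ℝ≥0}
    (hst : s ≤ t) : 0 ≤ 2 * ((t : ℝ) - s) ^ H ∧
      ∫ ω, (S t ω - S s ω) ^ 2 ∂P ≤ (2 * ((t : ℝ) - s) ^ H) ^ 2 := by
  have hd : (0 : ℝ) ≤ t - s := sub_nonneg.2 (NNReal.coe_le_coe.2 hst)
  refine ⟨by positivity, (hS.integral_sub_sq_le hH hst).trans ?_⟩
  rw [mul_pow, ← Real.rpow_two (((t : ℝ) - s) ^ H), ← Real.rpow_mul hd, mul_comm H]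
  have : 0 ≤ ((t : ℝ) - s) ^ (2 * H) := by positivity
  nlinarith

omit [IsProbabilityMeasure P] in
-- Cauchy-Schwarz for the process itself; the bound depends only on the two lengths, hence is
-- uniform in T for lagged increments.
theorem abs_subfIncrCov_le (hS : IsRegularSubfractionalBM H S P) (hH : 0 < H) {a b c d : ℝ≥0}
    (hab : b ≤ a) (hcd : d ≤ c) :
    |subfIncrCov H a b c d| ≤ 2 * ((a : ℝ) - b) ^ H * (2 * ((c : ℝ) - d) ^ H) := by
  have h1 := hS.increment_sq_le hH hab
  have h2 := hS.increment_sq_le hH hcd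
  rw [subfIncrCov, ← hS.integral_sub_mul_sub]
  exact (norm_integral_le_integral_norm _).trans (integral_norm_mul_le_of_sq_le
    (hS.memLp_increment b a) (hS.memLp_increment d c) h1.1 h2.1 h1.2 h2.2)

omit [IsProbabilityMeasure P] in
theorem measurable_uncurry_increment (hS : IsRegularSubfractionalBM H S P) {p q : ℝ → ℝ≥0}
    (hp : Measurable p) (hq : Measurable q) :
    Measurable fun x : ℝ × Ω => S (p x.1) x.2 - S (q x.1) x.2 := by
  have h : Measurable (Function.uncurry S) :=
    measurable_uncurry_of_continuous_of_measurable hS.continuous hS.measurable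
  exact (h.comp ((hp.comp measurable_fst).prodMk measurable_snd)).sub
    (h.comp ((hq.comp measurable_fst).prodMk measurable_snd))

theorem integral_mul_integral_increments (hS : IsRegularSubfractionalBM H S P) (hH : 0 < H)
    (hθ : 0 < θ) {p q p' q' : ℝ → ℝ≥0} (hp : Measurable p) (hq : Measurable q)
    (hp' : Measurable p') (hq' : Measurable q') (hqp : ∀ u, q u ≤ p u) (hqp' : ∀ u, q' u ≤ p' u)
    (hi : Integrable (fun u => ((p u : ℝ) - q u) ^ H) (expWeight θ))
    (hi' : Integrable (fun u => ((p' u : ℝ) - q' u) ^ H) (expWeight θ)) :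
    ∫ ω, (∫ u, (S (p u) ω - S (q u) ω) ∂expWeight θ) *
        (∫ u, (S (p' u) ω - S (q' u) ω) ∂expWeight θ) ∂P =
      ∫ z, subfIncrCov H (p z.1) (q z.1) (p' z.2) (q' z.2)
        ∂((expWeight θ).prod (expWeight θ)) := by
  have := isProbabilityMeasure_expWeight hθ
  rw [integral_integral_mul_integral (hS.measurable_uncurry_increment hp hq)
    (hS.measurable_uncurry_increment hp' hq') (fun u => hS.memLp_increment _ _)
    (fun u => hS.memLp_increment _ _) (hi.const_mul 2) (hi'.const_mul 2)
    (ae_of_all _ fun u => hS.increment_sq_le hH (hqp u))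
    (ae_of_all _ fun u => hS.increment_sq_le hH (hqp' u))]
  simp only [hS.integral_sub_mul_sub, subfIncrCov]

/-- Convergence of cross moments of exponentially weighted means of increments. -/
theorem tendsto_integral_mul_integral_increments (hS : IsRegularSubfractionalBM H S P)
    (hH : 0 < H) (hθ : 0 < θ) {p q p' q' : ℝ≥0 → ℝ → ℝ≥0} (hp : ∀ T, Measurable (p T))
    (hq : ∀ T, Measurable (q T)) (hp' : ∀ T, Measurable (p' T)) (hq' : ∀ T, Measurable (q' T))
    (hqp : ∀ T u, q T u ≤ p T u) (hqp' : ∀ T u, q' T u ≤ p' T u)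
    (hi : ∀ T, Integrable (fun u => ((p T u : ℝ) - q T u) ^ H) (expWeight θ))
    (hi' : ∀ T, Integrable (fun u => ((p' T u : ℝ) - q' T u) ^ H) (expWeight θ))
    {s : ℝ≥0 → ℝ} {a b : ℝ → ℝ} (ha : Integrable a (expWeight θ)) (hb : Integrable b (expWeight θ))
    (hsa : ∀ T u, 0 < u → |s T| * ((p T u : ℝ) - q T u) ^ H ≤ a u)
    (hsb : ∀ T u, 0 < u → ((p' T u : ℝ) - q' T u) ^ H ≤ b u) {ℓ : ℝ × ℝ → ℝ}
    (hlim : ∀ u v, 0 < u → 0 < v → Tendsto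
      (fun T => s T * subfIncrCov H (p T u) (q T u) (p' T v) (q' T v)) atTop (𝓝 (ℓ (u, v)))) :
    Tendsto (fun T => s T * ∫ ω, (∫ u, (S (p T u) ω - S (q T u) ω) ∂expWeight θ) *
        (∫ u, (S (p' T u) ω - S (q' T u) ω) ∂expWeight θ) ∂P) atTop
      (𝓝 (∫ z, ℓ z ∂((expWeight θ).prod (expWeight θ)))) := by
  have := isProbabilityMeasure_expWeight hθ
  have hpos1 : ∀ᵐ z ∂(expWeight θ).prod (expWeight θ), 0 < z.1 :=
    Measure.quasiMeasurePreserving_fst.ae (ae_expWeight_pos θ)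
  have hpos2 : ∀ᵐ z ∂(expWeight θ).prod (expWeight θ), 0 < z.2 :=
    Measure.quasiMeasurePreserving_snd.ae (ae_expWeight_pos θ)
  have heq : ∀ T, s T * ∫ ω, (∫ u, (S (p T u) ω - S (q T u) ω) ∂expWeight θ) *
        (∫ u, (S (p' T u) ω - S (q' T u) ω) ∂expWeight θ) ∂P =
      ∫ z, s T * subfIncrCov H (p T z.1) (q T z.1) (p' T z.2) (q' T z.2)
        ∂((expWeight θ).prod (expWeight θ)) := by
    intro T
    rw [hS.integral_mul_integral_increments hH hθ (hp T) (hq T) (hp' T) (hq' T) (hqp T) (hqp' T)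
      (hi T) (hi' T), integral_const_mul]
  simp_rw [heq]
  -- The constant 4 is the product of the constants 2 in the bounds for the two increments.
  refine tendsto_integral_filter_of_dominated_convergence (fun z => 4 * (a z.1 * b z.2))
    (Eventually.of_forall fun T => ?_) (Eventually.of_forall fun T => ?_)
    ((ha.mul_prod hb).const_mul 4) ?_
  · have hm1 : Measurable fun z : ℝ × ℝ => p T z.1 := (hp T).comp measurable_fst
    have hm2 : Measurable fun z : ℝ × ℝ => q T z.1 := (hq T).comp measurable_fst
    have hm3 : Measurable fun z : ℝ × ℝ => p' T z.2 := (hp' T).comp measurable_snd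
    have hm4 : Measurable fun z : ℝ × ℝ => q' T z.2 := (hq' T).comp measurable_snd
    exact ((measurable_subfIncrCov H hm1.coe_nnreal_real hm2.coe_nnreal_real hm3.coe_nnreal_real
      hm4.coe_nnreal_real).const_mul (s T)).aestronglyMeasurable
  · filter_upwards [hpos1, hpos2] with z h1 h2
    have hd1 : (0 : ℝ) ≤ p T z.1 - q T z.1 := sub_nonneg.2 (NNReal.coe_le_coe.2 (hqp T _))
    have hd2 : (0 : ℝ) ≤ p' T z.2 - q' T z.2 := sub_nonneg.2 (NNReal.coe_le_coe.2 (hqp' T _))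
    have hA := hsa T z.1 h1
    have hB := hsb T z.2 h2
    rw [norm_mul, Real.norm_eq_abs, Real.norm_eq_abs]
    calc _ ≤ |s T| * (2 * ((p T z.1 : ℝ) - q T z.1) ^ H * (2 * ((p' T z.2 : ℝ) - q' T z.2) ^ H)) := by
          gcongr
          exact hS.abs_subfIncrCov_le hH (hqp T _) (hqp' T _)
      _ = 4 * (|s T| * ((p T z.1 : ℝ) - q T z.1) ^ H * ((p' T z.2 : ℝ) - q' T z.2) ^ H) := by ring
      _ ≤ _ := by
        have : 0 ≤ a z.1 := le_trans (by positivity) hA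
        gcongr
  · filter_upwards [hpos1, hpos2] with z h1 h2
    exact hlim _ _ h1 h2

end IsRegularSubfractionalBM

end Moments

section Moments

variable {Ω : Type*} [MeasurableSpace Ω] {P : Measure Ω} [IsProbabilityMeasure P] {H θ : ℝ}
  {S : ℝ≥0 → Ω → ℝ}

theorem tendsto_nnreal_coe_atTop : Tendsto (fun T : ℝ≥0 => (T : ℝ)) atTop atTop :=
  NNReal.tendsto_coe_atTop.2 tendsto_id

theorem coe_sub_toNNReal {T : ℝ≥0} {u : ℝ} (hu : 0 ≤ u) (h : u ≤ T) :
    ((T - u.toNNReal : ℝ≥0) : ℝ) = T - u := by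
  rw [NNReal.coe_sub (Real.toNNReal_le_iff_le_coe.2 h), Real.coe_toNNReal _ hu]

theorem lag_rpow_le (hH : 0 < H) (T : ℝ≥0) {u : ℝ} (hu : 0 < u) :
    ((T : ℝ) - (T - u.toNNReal : ℝ≥0)) ^ H ≤ u ^ H := by
  have h1 : ((T - u.toNNReal : ℝ≥0) : ℝ) ≤ T := NNReal.coe_le_coe.2 tsub_le_self
  have h2 : (T : ℝ) ≤ (T - u.toNNReal : ℝ≥0) + u := by
    have : T ≤ T - u.toNNReal + u.toNNReal := le_tsub_add
    have := NNReal.coe_le_coe.2 this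
    rwa [NNReal.coe_add, Real.coe_toNNReal _ hu.le] at this
  have h3 : (0 : ℝ) ≤ T - (T - u.toNNReal : ℝ≥0) := sub_nonneg.2 h1
  gcongr
  linarith

theorem integrable_lag_rpow (hH : 0 < H) (hθ : 0 < θ) (T : ℝ≥0) :
    Integrable (fun u : ℝ => ((T : ℝ) - (T - u.toNNReal : ℝ≥0)) ^ H) (expWeight θ) := by
  refine (integrable_rpow_expWeight hθ (a := H) (by linarith)).mono'
    (Measurable.aestronglyMeasurable (by fun_prop)) ?_
  filter_upwards [ae_expWeight_pos θ] with u hu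
  rw [Real.norm_of_nonneg]
  · exact lag_rpow_le hH T hu
  · exact Real.rpow_nonneg (sub_nonneg.2 (NNReal.coe_le_coe.2 tsub_le_self)) _

theorem integrable_toNNReal_rpow (hH : 0 < H) (hθ : 0 < θ) :
    Integrable (fun u : ℝ => ((u.toNNReal : ℝ) - (0 : ℝ≥0)) ^ H) (expWeight θ) := by
  refine (integrable_rpow_expWeight hθ (a := H) (by linarith)).congr ?_
  filter_upwards [ae_expWeight_pos θ] with u hu
  simp [Real.coe_toNNReal u hu.le]

theorem inv_rpow_mul_rpow_le_one (H : ℝ) (T : ℝ≥0) :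
    |((T : ℝ) ^ H)⁻¹| * ((T : ℝ) - (0 : ℝ≥0)) ^ H ≤ 1 := by
  rw [NNReal.coe_zero, sub_zero, abs_of_nonneg (by positivity)]
  exact inv_mul_le_one

/-- With G = Γ(2H+1)/θ^{2H}, the pure powers contribute G each, the sum (2H+1)G and the difference
G; and 2 - (2H+2)/2 = 1 - H. -/
theorem integral_subfCov_expWeight (hH0 : 0 < H) (hθ : 0 < θ) :
    ∫ z, subfCov H z.1 z.2 ∂((expWeight θ).prod (expWeight θ)) = subfZetaVar θ H := by
  have := isProbabilityMeasure_expWeight hθ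
  have hi := integrable_rpow_expWeight hθ (a := 2 * H) (by linarith)
  obtain ⟨h1, h2⟩ := integrable_abs_sub_rpow_expWeight hθ (a := 2 * H) (by linarith)
  have hf := hi.comp_fst (expWeight θ)
  have hs := hi.comp_snd (expWeight θ)
  have h : ∀ z : ℝ × ℝ, subfCov H z.1 z.2 = (z.1 ^ (2 * H) + z.2 ^ (2 * H)) -
      1 / 2 * ((z.1 + z.2) ^ (2 * H) + |z.1 - z.2| ^ (2 * H)) := fun z => by
    rw [subfCov_comm, subfCov]
  have hfs : Integrable (fun z : ℝ × ℝ => z.1 ^ (2 * H) + z.2 ^ (2 * H)) _ := hf.add hs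
  have h21 : Integrable (fun z : ℝ × ℝ => (z.1 + z.2) ^ (2 * H) + |z.1 - z.2| ^ (2 * H)) _ :=
    h2.add h1
  simp_rw [h]
  rw [integral_sub hfs (h21.const_mul _), integral_add hf hs, integral_const_mul,
    integral_add h2 h1, integral_abs_sub_rpow_expWeight hθ (by linarith),
    integral_add_rpow_expWeight hθ (by linarith), integral_fun_fst (fun u : ℝ => u ^ (2 * H)),
    integral_fun_snd (fun u : ℝ => u ^ (2 * H)), integral_rpow_expWeight hθ (by linarith),
    subfZetaVar]
  simp
  ring

/-- The three powers contribute Γ(2H+1)/θ^{2H} each, with signs that leave one half of it, and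
Γ(2H+1) = 2H Γ(2H). -/
theorem integral_lag_limit_expWeight (hH0 : 0 < H) (hθ : 0 < θ) :
    ∫ z, 1 / 2 * (z.1 ^ (2 * H) + z.2 ^ (2 * H) - |z.1 - z.2| ^ (2 * H))
      ∂((expWeight θ).prod (expWeight θ)) = subfSigma θ H ^ 2 := by
  have := isProbabilityMeasure_expWeight hθ
  have hi := integrable_rpow_expWeight hθ (a := 2 * H) (by linarith)
  have h1 := (integrable_abs_sub_rpow_expWeight hθ (a := 2 * H) (by linarith)).1
  have hf := hi.comp_fst (expWeight θ)
  have hs := hi.comp_snd (expWeight θ)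
  have hG : 0 < Real.Gamma (2 * H) := Real.Gamma_pos_of_pos (by linarith)
  have hfs : Integrable (fun z : ℝ × ℝ => z.1 ^ (2 * H) + z.2 ^ (2 * H)) _ := hf.add hs
  rw [integral_const_mul, integral_sub hfs h1, integral_add hf hs,
    integral_abs_sub_rpow_expWeight hθ (by linarith), integral_fun_fst (fun u : ℝ => u ^ (2 * H)),
    integral_fun_snd (fun u : ℝ => u ^ (2 * H)), integral_rpow_expWeight hθ (by linarith),
    subfSigma, Real.sq_sqrt (by positivity), Real.Gamma_add_one (by linarith)]
  simp
  ring

namespace IsRegularSubfractionalBM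

omit [IsProbabilityMeasure P] in
theorem zetaInf_eq (hS : IsRegularSubfractionalBM H S P) (hθ : 0 < θ) (ω : Ω) :
    zetaInf θ (S · ω) = ∫ u : ℝ, (S u.toNNReal ω - S 0 ω) ∂expWeight θ := by
  simp only [hS.zero, sub_zero]
  exact zetaInf_eq_integral_expWeight hθ _

omit [IsProbabilityMeasure P] in
-- Writing S_T as a weighted mean of a constant increment brings its cross moments under the general
-- formula.
theorem integral_const_increment (hS : IsRegularSubfractionalBM H S P) (hθ : 0 < θ) (T : ℝ≥0)
    (ω : Ω) : ∫ _u : ℝ, (S T ω - S 0 ω) ∂expWeight θ = S T ω := by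
  have := isProbabilityMeasure_expWeight hθ
  simp [hS.zero]

theorem integral_zetaInf_sq (hS : IsRegularSubfractionalBM H S P) (hH0 : 0 < H) (hθ : 0 < θ) :
    ∫ ω, zetaInf θ (S · ω) * zetaInf θ (S · ω) ∂P = subfZetaVar θ H := by
  simp_rw [hS.zetaInf_eq hθ]
  rw [hS.integral_mul_integral_increments hH0 hθ (p := fun u => u.toNNReal) (q := fun _ => 0)
    (p' := fun u => u.toNNReal) (q' := fun _ => 0) (by fun_prop) (by fun_prop) (by fun_prop)
    (by fun_prop) (fun _ => zero_le) (fun _ => zero_le) (integrable_toNNReal_rpow hH0 hθ)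
    (integrable_toNNReal_rpow hH0 hθ), ← integral_subfCov_expWeight hH0 hθ]
  have := isProbabilityMeasure_expWeight hθ
  refine integral_congr_ae ?_
  have h1 : ∀ᵐ z ∂(expWeight θ).prod (expWeight θ), 0 < z.1 :=
    Measure.quasiMeasurePreserving_fst.ae (ae_expWeight_pos θ)
  have h2 : ∀ᵐ z ∂(expWeight θ).prod (expWeight θ), 0 < z.2 :=
    Measure.quasiMeasurePreserving_snd.ae (ae_expWeight_pos θ)
  filter_upwards [h1, h2] with z hz1 hz2
  rw [subfIncrCov, NNReal.coe_zero, Real.coe_toNNReal _ hz1.le, Real.coe_toNNReal _ hz2.le,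
    subfCov_zero_right hH0 hz1.le, subfCov_comm H 0, subfCov_zero_right hH0 hz2.le,
    subfCov_zero_right hH0 le_rfl]
  ring

theorem tendsto_integral_lag_sq (hS : IsRegularSubfractionalBM H S P) (hH0 : 0 < H) (hH1 : H < 1)
    (hθ : 0 < θ) :
    Tendsto (fun T => ∫ ω, laggedMean θ (S · ω) T * laggedMean θ (S · ω) T ∂P) atTop
      (𝓝 (subfSigma θ H ^ 2)) := by
  have h := hS.tendsto_integral_mul_integral_increments hH0 hθ (p := fun T _ => T)
    (q := fun T u => T - u.toNNReal) (p' := fun T _ => T) (q' := fun T u => T - u.toNNReal)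
    (s := fun _ => 1) (a := fun u => u ^ H) (b := fun u => u ^ H)
    (fun T => by fun_prop) (fun T => by fun_prop) (fun T => by fun_prop) (fun T => by fun_prop)
    (fun T u => tsub_le_self) (fun T u => tsub_le_self) (integrable_lag_rpow hH0 hθ)
    (integrable_lag_rpow hH0 hθ) (integrable_rpow_expWeight hθ (by linarith))
    (integrable_rpow_expWeight hθ (by linarith))
    (fun T u hu => by simpa using lag_rpow_le hH0 T hu) (fun T u hu => lag_rpow_le hH0 T hu)
    (ℓ := fun z => 1 / 2 * (z.1 ^ (2 * H) + z.2 ^ (2 * H) - |z.1 - z.2| ^ (2 * H)))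
    fun u v hu hv => ?_
  · rw [integral_lag_limit_expWeight hH0 hθ] at h
    simpa only [laggedMean, one_mul] using h
  · refine ((tendsto_subfIncrCov_lag_lag hH0 hH1 hu.le hv.le).comp
      tendsto_nnreal_coe_atTop).congr' ?_
    filter_upwards [tendsto_nnreal_coe_atTop.eventually_ge_atTop u,
      tendsto_nnreal_coe_atTop.eventually_ge_atTop v] with T hTu hTv
    rw [one_mul, coe_sub_toNNReal hu.le hTu, coe_sub_toNNReal hv.le hTv]
    rfl

theorem tendsto_integral_lag_mul_zetaInf (hS : IsRegularSubfractionalBM H S P) (hH0 : 0 < H)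
    (hH1 : H < 1) (hθ : 0 < θ) :
    Tendsto (fun T => ∫ ω, laggedMean θ (S · ω) T * zetaInf θ (S · ω) ∂P) atTop (𝓝 0) := by
  have h := hS.tendsto_integral_mul_integral_increments hH0 hθ (p := fun T _ => T)
    (q := fun T u => T - u.toNNReal) (p' := fun _ u => u.toNNReal) (q' := fun _ _ => 0)
    (s := fun _ => 1) (a := fun u => u ^ H) (b := fun u => u ^ H)
    (fun T => by fun_prop) (fun T => by fun_prop) (fun T => by fun_prop) (fun T => by fun_prop)
    (fun T u => tsub_le_self) (fun T u => zero_le) (integrable_lag_rpow hH0 hθ)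
    (fun _ => integrable_toNNReal_rpow hH0 hθ) (integrable_rpow_expWeight hθ (by linarith))
    (integrable_rpow_expWeight hθ (by linarith))
    (fun T u hu => by simpa using lag_rpow_le hH0 T hu)
    (fun T u hu => by simp [Real.coe_toNNReal u hu.le])
    (ℓ := fun _ => 0) fun u v hu hv => ?_
  · simp_rw [hS.zetaInf_eq hθ]
    simpa only [laggedMean, one_mul, integral_zero] using h
  · refine ((tendsto_subfIncrCov_lag_fixed hH0 hH1 u v).comp tendsto_nnreal_coe_atTop).congr' ?_
    filter_upwards [tendsto_nnreal_coe_atTop.eventually_ge_atTop u] with T hTu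
    rw [one_mul, coe_sub_toNNReal hu.le hTu, Real.coe_toNNReal v hv.le, NNReal.coe_zero]
    rfl

theorem tendsto_integral_mul_zetaInf (hS : IsRegularSubfractionalBM H S P) (hH0 : 0 < H)
    (hH1 : H < 1) (hθ : 0 < θ) :
    Tendsto (fun T : ℝ≥0 => ((T : ℝ) ^ H)⁻¹ * ∫ ω, S T ω * zetaInf θ (S · ω) ∂P) atTop
      (𝓝 0) := by
  have := isProbabilityMeasure_expWeight hθ
  have h := hS.tendsto_integral_mul_integral_increments hH0 hθ (p := fun T _ => T)
    (q := fun _ _ => 0) (p' := fun _ u => u.toNNReal) (q' := fun _ _ => 0)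
    (s := fun T => ((T : ℝ) ^ H)⁻¹) (a := fun _ => 1) (b := fun u => u ^ H)
    (fun T => by fun_prop) (fun T => by fun_prop) (fun T => by fun_prop) (fun T => by fun_prop)
    (fun T u => zero_le) (fun T u => zero_le) (fun _ => integrable_const _)
    (fun _ => integrable_toNNReal_rpow hH0 hθ) (integrable_const _)
    (integrable_rpow_expWeight hθ (by linarith))
    (fun T u _ => inv_rpow_mul_rpow_le_one H T)
    (fun T u hu => by simp [Real.coe_toNNReal u hu.le])
    (ℓ := fun _ => 0) fun u v hu hv => ?_
  · simp_rw [hS.zetaInf_eq hθ]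
    simpa only [hS.integral_const_increment hθ, integral_zero] using h
  · refine ((tendsto_subfIncrCov_fixed_div hH0 hH1 hv.le).comp
      tendsto_nnreal_coe_atTop).congr' ?_
    filter_upwards with T
    rw [Real.coe_toNNReal v hv.le, NNReal.coe_zero]
    rfl

theorem tendsto_integral_mul_lag (hS : IsRegularSubfractionalBM H S P) (hH0 : 0 < H)
    (hH1 : H < 1) (hθ : 0 < θ) :
    Tendsto (fun T : ℝ≥0 => ((T : ℝ) ^ H)⁻¹ * ∫ ω, S T ω * laggedMean θ (S · ω) T ∂P) atTop
      (𝓝 0) := by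
  have := isProbabilityMeasure_expWeight hθ
  have h := hS.tendsto_integral_mul_integral_increments hH0 hθ (p := fun T _ => T)
    (q := fun _ _ => 0) (p' := fun T _ => T) (q' := fun T u => T - u.toNNReal)
    (s := fun T => ((T : ℝ) ^ H)⁻¹) (a := fun _ => 1) (b := fun u => u ^ H)
    (fun T => by fun_prop) (fun T => by fun_prop) (fun T => by fun_prop) (fun T => by fun_prop)
    (fun T u => zero_le) (fun T u => tsub_le_self) (fun _ => integrable_const _)
    (integrable_lag_rpow hH0 hθ) (integrable_const _)
    (integrable_rpow_expWeight hθ (by linarith))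
    (fun T u _ => inv_rpow_mul_rpow_le_one H T) (fun T u hu => lag_rpow_le hH0 T hu)
    (ℓ := fun _ => 0) fun u v hu hv => ?_
  · simpa only [laggedMean, hS.integral_const_increment hθ, integral_zero] using h
  · refine ((tendsto_subfIncrCov_lag_div hH0 hH1 hv.le).comp
      tendsto_nnreal_coe_atTop).congr' ?_
    filter_upwards [tendsto_nnreal_coe_atTop.eventually_ge_atTop v] with T hTv
    rw [coe_sub_toNNReal hv.le hTv, NNReal.coe_zero]
    rfl

/-- The variance of a linear combination of `S_T / T^H`, the lagged mean at `T` and `ζ_∞`. -/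
theorem tendsto_integral_comb_sq (hS : IsRegularSubfractionalBM H S P) (hH0 : 0 < H)
    (hH1 : H < 1) (hθ : 0 < θ) (a : ℝ) {b : ℝ≥0 → ℝ} {b₀ : ℝ}
    (hb : Tendsto b atTop (𝓝 b₀)) (c : ℝ) :
    Tendsto (fun T : ℝ≥0 => ∫ ω, (a * ((T : ℝ) ^ H)⁻¹ * S T ω + b T * laggedMean θ (S · ω) T
        + c * zetaInf θ (S · ω)) ^ 2 ∂P) atTop
      (𝓝 (a ^ 2 * subfLambda H ^ 2 + b₀ ^ 2 * subfSigma θ H ^ 2 + c ^ 2 * subfZetaVar θ H)) := by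
  have hlag : ∀ T, MemLp (fun ω => laggedMean θ (S · ω) T) 2 P := fun T => by
    obtain ⟨v, hv⟩ := hS.exists_hasLaw_comb hθ T 0 1 0
    simpa using hv.hasGaussianLaw.memLp_two
  have hz : MemLp (fun ω => zetaInf θ (S · ω)) 2 P := by
    obtain ⟨v, hv⟩ := hS.exists_hasLaw_comb hθ 0 0 0 1
    simpa using hv.hasGaussianLaw.memLp_two
  have hexp : ∀ T : ℝ≥0, ∫ ω, (a * ((T : ℝ) ^ H)⁻¹ * S T ω + b T * laggedMean θ (S · ω) T
        + c * zetaInf θ (S · ω)) ^ 2 ∂P =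
      a ^ 2 * ((((T : ℝ) ^ H)⁻¹) ^ 2 * ∫ ω, S T ω * S T ω ∂P) +
      b T ^ 2 * ∫ ω, laggedMean θ (S · ω) T * laggedMean θ (S · ω) T ∂P +
      c ^ 2 * ∫ ω, zetaInf θ (S · ω) * zetaInf θ (S · ω) ∂P +
      2 * a * b T * (((T : ℝ) ^ H)⁻¹ * ∫ ω, S T ω * laggedMean θ (S · ω) T ∂P) +
      2 * a * c * (((T : ℝ) ^ H)⁻¹ * ∫ ω, S T ω * zetaInf θ (S · ω) ∂P) +
      2 * b T * c * ∫ ω, laggedMean θ (S · ω) T * zetaInf θ (S · ω) ∂P := by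
    intro T
    have i1 := ((hS.memLp_two T).integrable_mul (hS.memLp_two T)).const_mul
      (a ^ 2 * (((T : ℝ) ^ H)⁻¹) ^ 2)
    have i2 := ((hlag T).integrable_mul (hlag T)).const_mul (b T ^ 2)
    have i3 := (hz.integrable_mul hz).const_mul (c ^ 2)
    have i4 := ((hS.memLp_two T).integrable_mul (hlag T)).const_mul (2 * a * b T * ((T : ℝ) ^ H)⁻¹)
    have i5 := ((hS.memLp_two T).integrable_mul hz).const_mul (2 * a * c * ((T : ℝ) ^ H)⁻¹)
    have i6 := ((hlag T).integrable_mul hz).const_mul (2 * b T * c)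
    simp only [Pi.mul_apply] at i1 i2 i3 i4 i5 i6
    have e1 := integral_add' (((((i1.add i2).add i3).add i4).add i5)) i6
    rw [integral_add' ((((i1.add i2).add i3).add i4)) i5, integral_add' (((i1.add i2).add i3)) i4,
      integral_add' ((i1.add i2)) i3, integral_add' i1 i2] at e1
    simp only [integral_const_mul] at e1
    simp only [← mul_assoc]
    rw [← e1]
    refine integral_congr_ae (ae_of_all _ fun ω => ?_)
    simp only [Pi.add_apply]
    ring
  simp_rw [hexp]
  -- No limit is involved here: the variance of S_T is exactly λ² T^{2H}.
  have hself : Tendsto (fun T : ℝ≥0 => (((T : ℝ) ^ H)⁻¹) ^ 2 * ∫ ω, S T ω * S T ω ∂P) atTop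
      (𝓝 (subfLambda H ^ 2)) := by
    refine tendsto_const_nhds.congr' ?_
    filter_upwards [eventually_gt_atTop 0] with T hT
    have hT' : (0 : ℝ) < T := hT
    have h2 : (2 : ℝ) ^ (2 * H - 1) ≤ 2 := by
      calc (2 : ℝ) ^ (2 * H - 1) ≤ 2 ^ (1 : ℝ) := by gcongr <;> linarith
        _ = 2 := Real.rpow_one 2
    rw [hS.integral_mul, subfCov_self hH0 T.coe_nonneg, subfLambda, Real.sq_sqrt (by linarith),
      mul_comm 2 H, Real.rpow_mul T.coe_nonneg, Real.rpow_two]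
    have : (T : ℝ) ^ H ≠ 0 := by positivity
    field_simp
  have := (((((hself.const_mul (a ^ 2)).add ((hb.pow 2).mul
    (hS.tendsto_integral_lag_sq hH0 hH1 hθ))).add (tendsto_const_nhds
    (x := c ^ 2 * ∫ ω, zetaInf θ (S · ω) * zetaInf θ (S · ω) ∂P))).add
    ((hb.const_mul (2 * a)).mul (hS.tendsto_integral_mul_lag hH0 hH1 hθ))).add
    ((hS.tendsto_integral_mul_zetaInf hH0 hH1 hθ).const_mul (2 * a * c))).add
    (((hb.const_mul 2).mul_const c).mul (hS.tendsto_integral_lag_mul_zetaInf hH0 hH1 hθ))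
  rw [hS.integral_zetaInf_sq hH0 hθ] at this
  simpa only [mul_zero, add_zero, hS.integral_zetaInf_sq hH0 hθ] using this

/-- `ζ_∞` is a centered Gaussian with variance `subfZetaVar`. -/
theorem hasLaw_zetaInf (hS : IsRegularSubfractionalBM H S P) (hH0 : 0 < H) (hθ : 0 < θ) :
    HasLaw (fun ω => zetaInf θ (S · ω)) (gaussianReal 0 (subfZetaVar θ H).toNNReal) P := by
  obtain ⟨v, hv⟩ := hS.exists_hasLaw_comb hθ 0 0 0 1
  simp only [zero_mul, one_mul, zero_add] at hv
  have h0 : ∫ ω, zetaInf θ (S · ω) ∂P = 0 := by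
    rw [hv.integral_eq, integral_id_gaussianReal]
  have := hv.hasGaussianLaw.hasLaw_of_centered h0
  simp only [sq] at this
  rwa [hS.integral_zetaInf_sq hH0 hθ] at this

end IsRegularSubfractionalBM

end Moments

/-! ### The solution along a fixed path of the noise. -/

/-- The explicit solution of `x_0 = 0`, `dx_t = θ (μ + x_t) dt + dg_t`. -/
noncomputable def vasicekSol (θ μ : ℝ) (g : ℝ≥0 → ℝ) (T : ℝ≥0) : ℝ :=
  g T + Real.exp (θ * T) *
    ∫ s in (0 : ℝ)..T, θ * Real.exp (-θ * s) * (μ + g s.toNNReal)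

theorem continuous_vasicekSol (θ μ : ℝ) {g : ℝ≥0 → ℝ} (hg : Continuous g) :
    Continuous (vasicekSol θ μ g) := by
  have h : Continuous fun s : ℝ => θ * Real.exp (-θ * s) * (μ + g s.toNNReal) := by fun_prop
  have h2 : Continuous fun T : ℝ => ∫ s in (0 : ℝ)..T, θ * Real.exp (-θ * s) * (μ + g s.toNNReal) :=
    intervalIntegral.continuous_primitive (fun a b => h.intervalIntegrable a b) 0
  exact hg.add ((by fun_prop : Continuous fun T : ℝ≥0 => Real.exp (θ * T)).mul
    (h2.comp NNReal.continuous_coe))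

/-- `x` is a continuous solution of `x_t = ∫_0^t θ (μ + x_s) ds + g_t`, where `g` is a continuous
path of sublinear growth with `g_0 = 0`. -/
structure IsVasicekPath (θ μ : ℝ) (g x : ℝ≥0 → ℝ) : Prop where
  pos : 0 < θ
  continuous_noise : Continuous g
  noise_zero : g 0 = 0
  tendsto_div : Tendsto (fun t : ℝ≥0 => g t / t) atTop (𝓝 0)
  continuous_path : Continuous x
  equation : ∀ t : ℝ≥0, x t = (∫ s in (0 : ℝ)..t, θ * (μ + x s.toNNReal)) + g t

theorem integral_Ioi_eq_integral_comp_add (f : ℝ → ℝ) (a : ℝ) :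
    ∫ s in Set.Ioi a, f s = ∫ u in Set.Ioi (0 : ℝ), f (a + u) := by
  rw [← integral_indicator measurableSet_Ioi, ← integral_indicator measurableSet_Ioi,
    ← integral_add_left_eq_self _ a]
  congr 1
  ext u
  simp [Set.indicator]

namespace IsVasicekPath

variable {θ μ : ℝ} {g x : ℝ≥0 → ℝ}

/-- The noise is only continuous, but the drift x - g is continuously differentiable. Ordinary
calculus is applied to it alone, and no stochastic integral is needed. -/
theorem hasDerivAt_drift (h : IsVasicekPath θ μ g x) (t : ℝ) :
    HasDerivAt (fun t : ℝ => ∫ s in (0 : ℝ)..t, θ * (μ + x s.toNNReal))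
      (θ * (μ + x t.toNNReal)) t := by
  have := h.continuous_path
  have hc : Continuous fun s : ℝ => θ * (μ + x s.toNNReal) := by fun_prop
  exact intervalIntegral.integral_hasDerivAt_right (hc.intervalIntegrable _ _)
    (hc.stronglyMeasurableAtFilter _ _) hc.continuousAt

theorem drift_eq (h : IsVasicekPath θ μ g x) {s : ℝ} (hs : 0 ≤ s) :
    ∫ r in (0 : ℝ)..s, θ * (μ + x r.toNNReal) = x s.toNNReal - g s.toNNReal := by
  have := h.equation s.toNNReal
  rw [Real.coe_toNNReal s hs] at this
  linarith

/-- Integrating factor: y = x - g satisfies y' = θy + θ(μ + g), so the derivative of e^{-θt}y is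
θe^{-θt}(μ + g). The formula also makes x a measurable function of the noise. -/
theorem eq_vasicekSol (h : IsVasicekPath θ μ g x) (T : ℝ≥0) : x T = vasicekSol θ μ g T := by
  have hxc := h.continuous_path
  have hgc := h.continuous_noise
  have hd : ∀ t : ℝ, HasDerivAt (fun t : ℝ => Real.exp (-θ * t) *
      ∫ s in (0 : ℝ)..t, θ * (μ + x s.toNNReal))
      (Real.exp (-θ * t) * (-θ * 1) * (∫ s in (0 : ℝ)..t, θ * (μ + x s.toNNReal)) +
        Real.exp (-θ * t) * (θ * (μ + x t.toNNReal))) t := fun t =>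
    (((hasDerivAt_id t).const_mul (-θ)).exp).mul (h.hasDerivAt_drift t)
  have hp : Continuous fun t : ℝ => ∫ s in (0 : ℝ)..t, θ * (μ + x s.toNNReal) :=
    continuous_iff_continuousAt.2 fun t => (h.hasDerivAt_drift t).continuousAt
  have hc : Continuous fun t : ℝ => Real.exp (-θ * t) * (-θ * 1) *
      (∫ s in (0 : ℝ)..t, θ * (μ + x s.toNNReal)) +
        Real.exp (-θ * t) * (θ * (μ + x t.toNNReal)) := by fun_prop
  have hftc := intervalIntegral.integral_eq_sub_of_hasDerivAt (a := 0) (b := (T : ℝ))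
    (fun t _ => hd t) (hc.intervalIntegrable _ _)
  rw [intervalIntegral.integral_same, mul_zero, sub_zero, h.drift_eq T.coe_nonneg,
    Real.toNNReal_coe] at hftc
  have hint : ∫ s in (0 : ℝ)..T, θ * Real.exp (-θ * s) * (μ + g s.toNNReal) =
      Real.exp (-θ * T) * (x T - g T) := by
    rw [← hftc]
    refine intervalIntegral.integral_congr fun s hs => ?_
    rw [Set.uIcc_of_le T.coe_nonneg] at hs
    rw [h.drift_eq hs.1]
    ring
  rw [vasicekSol, hint, ← mul_assoc, ← Real.exp_add]
  simp

theorem pathInt_eq (h : IsVasicekPath θ μ g x) (T : ℝ≥0) :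
    θ * pathInt x T = x T - g T - θ * μ * T := by
  have hxc := h.continuous_path
  have hc : Continuous fun s : ℝ => x s.toNNReal := by fun_prop
  have := h.equation T
  rw [intervalIntegral.integral_const_mul, intervalIntegral.integral_add
    (by simp) (hc.intervalIntegrable _ _)] at this
  rw [intervalIntegral.integral_const, smul_eq_mul] at this
  rw [pathInt]
  linear_combination -this

/-- Integrate the derivative 2(x - g)θ(μ + x) of (x - g)² and expand the product. -/
theorem pathSqInt_eq (h : IsVasicekPath θ μ g x) (T : ℝ≥0) :
    2 * θ * pathSqInt x T = (x T - g T) ^ 2 - 2 * θ * μ * pathInt x T +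
      2 * θ * ∫ s in (0 : ℝ)..T, g s.toNNReal * (μ + x s.toNNReal) := by
  have hxc := h.continuous_path
  have hgc := h.continuous_noise
  have hp : Continuous fun t : ℝ => ∫ s in (0 : ℝ)..t, θ * (μ + x s.toNNReal) :=
    continuous_iff_continuousAt.2 fun t => (h.hasDerivAt_drift t).continuousAt
  have hftc := intervalIntegral.integral_eq_sub_of_hasDerivAt (a := 0) (b := (T : ℝ))
    (fun t _ => (h.hasDerivAt_drift t).pow 2)
    (Continuous.intervalIntegrable (by fun_prop) _ _)
  simp only [Pi.pow_apply, intervalIntegral.integral_same, h.drift_eq T.coe_nonneg,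
    Real.toNNReal_coe] at hftc
  have hc1 : Continuous fun s : ℝ => x s.toNNReal ^ 2 := by fun_prop
  have hc2 : Continuous fun s : ℝ => μ * x s.toNNReal := by fun_prop
  have hc3 : Continuous fun s : ℝ => g s.toNNReal * (μ + x s.toNNReal) := by fun_prop
  have hint : 2 * θ * ∫ s in (0 : ℝ)..T, (x s.toNNReal ^ 2 + μ * x s.toNNReal -
      g s.toNNReal * (μ + x s.toNNReal)) = (x T - g T) ^ 2 := by
    rw [zero_pow two_ne_zero, sub_zero] at hftc
    rw [← hftc, ← intervalIntegral.integral_const_mul]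
    refine intervalIntegral.integral_congr fun s hs => ?_
    rw [Set.uIcc_of_le T.coe_nonneg] at hs
    rw [h.drift_eq hs.1]
    push_cast
    ring
  have hc12 : Continuous fun s : ℝ => x s.toNNReal ^ 2 + μ * x s.toNNReal := hc1.add hc2
  rw [intervalIntegral.integral_sub (hc12.intervalIntegrable _ _)
    (hc3.intervalIntegrable _ _), intervalIntegral.integral_add (hc1.intervalIntegrable _ _) (hc2.intervalIntegrable _ _),
    intervalIntegral.integral_const_mul] at hint
  rw [pathInt, pathSqInt]
  linear_combination hint

/-- Replacing ∫_0^T by ∫_0^∞ in the explicit solution costs the tail, which after a shift by T is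
the weighted mean of μ + g(T+u). This grows at most linearly. -/
theorem abs_sub_exp_le (h : IsVasicekPath θ μ g x) :
    ∃ C : ℝ, 0 ≤ C ∧ ∀ T : ℝ≥0, |x T - (μ + zetaInf θ g) * Real.exp (θ * T)| ≤ C * (1 + T) := by
  have := isProbabilityMeasure_expWeight h.pos
  have hgc := h.continuous_noise
  obtain ⟨C, hC, hb⟩ := exists_abs_le_of_tendsto_div h.continuous_noise h.tendsto_div
  have hi := integrable_comp_toNNReal_expWeight h.pos h.continuous_noise h.tendsto_div
  have hi' : IntegrableOn (fun s : ℝ => Real.exp (-θ * s) * (μ + g s.toNNReal)) (Set.Ioi 0) :=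
    (integrable_expWeight_iff h.pos _).1 ((integrable_const μ).add hi)
  have hz : μ + zetaInf θ g =
      θ * ∫ s in Set.Ioi (0 : ℝ), Real.exp (-θ * s) * (μ + g s.toNNReal) := by
    rw [← integral_expWeight h.pos (fun s => μ + g s.toNNReal),
      integral_add (integrable_const μ) hi, zetaInf_eq_integral_expWeight h.pos]
    simp
  set M := ∫ u : ℝ, (1 + |u|) ∂expWeight θ
  have hM : 0 ≤ M := integral_nonneg fun u => by positivity
  have hμ := abs_nonneg μ
  refine ⟨C + (|μ| + C * M), by positivity, fun T => ?_⟩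
  have hT := T.coe_nonneg
  have hsplit := intervalIntegral.integral_interval_add_Ioi (a := (0 : ℝ)) (b := (T : ℝ)) hi'
    (hi'.mono_set (Set.Ioi_subset_Ioi hT))
  have hshift : ∫ s in Set.Ioi (T : ℝ), Real.exp (-θ * s) * (μ + g s.toNNReal) =
      Real.exp (-θ * T) * ∫ u in Set.Ioi (0 : ℝ), Real.exp (-θ * u) * (μ + g (T + u).toNNReal) := by
    rw [← integral_const_mul, integral_Ioi_eq_integral_comp_add]
    refine setIntegral_congr_fun measurableSet_Ioi fun u _ => ?_
    rw [← mul_assoc, ← Real.exp_add]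
    ring_nf
  have heq : x T - (μ + zetaInf θ g) * Real.exp (θ * T) =
      g T - ∫ u : ℝ, (μ + g (T + u).toNNReal) ∂expWeight θ := by
    rw [integral_expWeight h.pos, hz, ← hsplit, hshift, h.eq_vasicekSol, vasicekSol]
    simp only [mul_assoc θ, intervalIntegral.integral_const_mul]
    have : Real.exp (θ * T) * Real.exp (-θ * T) = 1 := by
      rw [← Real.exp_add]
      simp
    linear_combination (-θ * ∫ u in Set.Ioi (0 : ℝ), Real.exp (-θ * u) *
      (μ + g (T + u).toNNReal)) * this
  rw [heq]
  have h2 : |∫ u : ℝ, (μ + g (T + u).toNNReal) ∂expWeight θ| ≤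
      ∫ u : ℝ, (|μ| + C * (1 + T) * (1 + |u|)) ∂expWeight θ := by
    have hdom : Integrable (fun u : ℝ => |μ| + C * (1 + T) * (1 + |u|)) (expWeight θ) :=
      (integrable_const _).add ((integrable_one_add_abs_expWeight h.pos).const_mul _)
    rw [← Real.norm_eq_abs]
    refine norm_integral_le_of_norm_le hdom (ae_of_all _ fun u => ?_)
    refine (abs_add_le _ _).trans (add_le_add le_rfl ((abs_le_one_add_abs hC hb _).trans ?_))
    rw [mul_assoc]
    refine mul_le_mul_of_nonneg_left ?_ hC
    have := abs_add_le (T : ℝ) u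
    rw [abs_of_nonneg hT] at this
    nlinarith [mul_nonneg hT (abs_nonneg u)]
  rw [integral_add (integrable_const _) ((integrable_one_add_abs_expWeight h.pos).const_mul _),
    integral_const_mul] at h2
  simp only [integral_const, probReal_univ, one_smul] at h2
  calc _ ≤ |g T| + |∫ u : ℝ, (μ + g (T + u).toNNReal) ∂expWeight θ| := abs_sub _ _
    _ ≤ C * (1 + T) + (|μ| + C * (1 + T) * M) := add_le_add (hb T) h2
    _ ≤ _ := by nlinarith [mul_nonneg hμ hT]

end IsVasicekPath

/-! ### The lagged mean as a convolution with the exponential, and its growth. -/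

section Lag

variable {θ : ℝ} {g : ℝ≥0 → ℝ}

/-- Reflection u ↦ T - u. Lags u > T contribute nothing: truncated subtraction gives T - u = 0
there, and g 0 = 0. -/
theorem mul_integral_exp_mul_eq (hθ : 0 < θ) (hc : Continuous g) (h0 : g 0 = 0)
    (hg : Tendsto (fun t : ℝ≥0 => g t / t) atTop (𝓝 0)) (T : ℝ≥0) :
    θ * ∫ s in (0 : ℝ)..T, Real.exp (θ * s) * g s.toNNReal =
      Real.exp (θ * T) * (g T - laggedMean θ g T) := by
  have := isProbabilityMeasure_expWeight hθ
  have hT := T.coe_nonneg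
  have hi : Integrable (fun u : ℝ => g (T - u.toNNReal)) (expWeight θ) := by
    refine ((integrable_const (g T)).sub (integrable_lag_expWeight hθ hc hg T)).congr
      (ae_of_all _ fun u => ?_)
    simp
  have h1 : laggedMean θ g T = g T - ∫ u : ℝ, g (T - u.toNNReal) ∂expWeight θ := by
    rw [laggedMean, integral_sub (integrable_const _) hi]
    simp
  have h2 : ∫ u in Set.Ioi (0 : ℝ), Real.exp (-θ * u) * g (T - u.toNNReal) =
      ∫ u in (0 : ℝ)..T, Real.exp (-θ * u) * g (T - u.toNNReal) := by
    rw [intervalIntegral.integral_of_le hT]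
    refine (setIntegral_eq_of_subset_of_forall_sdiff_eq_zero measurableSet_Ioi
      Set.Ioc_subset_Ioi_self fun u hu => ?_)
    have : (T : ℝ) < u := by
      by_contra hcon
      exact hu.2 ⟨hu.1, not_lt.1 hcon⟩
    rw [tsub_eq_zero_of_le (NNReal.le_toNNReal_of_coe_le this.le), h0, mul_zero]
  have h3 : ∫ u in (0 : ℝ)..T, Real.exp (-θ * u) * g (T - u.toNNReal) =
      ∫ u in (0 : ℝ)..T, Real.exp (-θ * (T - u)) * g u.toNNReal := by
    have := intervalIntegral.integral_comp_sub_left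
      (fun u : ℝ => Real.exp (-θ * (T - u)) * g u.toNNReal) (a := 0) (b := (T : ℝ)) (T : ℝ)
    rw [sub_self, sub_zero] at this
    rw [← this]
    refine intervalIntegral.integral_congr fun u hu => ?_
    rw [Set.uIcc_of_le hT] at hu
    simp only [sub_sub_cancel]
    congr 2
    ext
    rw [coe_sub_toNNReal hu.1 hu.2, Real.coe_toNNReal _ (sub_nonneg.2 hu.2)]
  rw [h1, sub_sub_cancel, integral_expWeight hθ, h2, h3, mul_left_comm]
  congr 1
  rw [← intervalIntegral.integral_const_mul]
  refine intervalIntegral.integral_congr fun s _ => ?_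
  rw [← mul_assoc, ← Real.exp_add]
  ring_nf

theorem tendsto_laggedMean_div (hθ : 0 < θ) (hc : Continuous g)
    (hg : Tendsto (fun t : ℝ≥0 => g t / t) atTop (𝓝 0)) :
    Tendsto (fun T : ℝ≥0 => laggedMean θ g T / T) atTop (𝓝 0) := by
  have := isProbabilityMeasure_expWeight hθ
  obtain ⟨C, hC, hb⟩ := exists_abs_le_of_tendsto_div hc hg
  have key : Tendsto (fun T : ℝ≥0 => ∫ u : ℝ, (g T - g (T - u.toNNReal)) / T ∂expWeight θ) atTop
      (𝓝 (∫ _ : ℝ, 0 ∂expWeight θ)) := by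
    -- For T ≥ 1 the bound 2C(1+T)/T on the scaled increment is at most 4C.
    refine tendsto_integral_filter_of_dominated_convergence (fun _ => 4 * C)
      (Eventually.of_forall fun T => ((continuous_lag hc T).div_const _).aestronglyMeasurable) ?_
      (integrable_const _) ?_
    · filter_upwards [eventually_ge_atTop 1] with T hT
      have hT' : (1 : ℝ) ≤ T := hT
      refine ae_of_all _ fun u => ?_
      rw [norm_div, Real.norm_eq_abs, Real.norm_of_nonneg T.coe_nonneg,
        div_le_iff₀ (by linarith)]
      refine (abs_lag_le hC hb T u).trans ?_
      nlinarith
    · refine ae_of_all _ fun u => ?_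
      have h1 : Tendsto (fun T : ℝ≥0 => T - u.toNNReal) atTop atTop :=
        tendsto_atTop_atTop.2 fun b =>
          ⟨b + u.toNNReal, fun T hT => le_tsub_of_add_le_right hT⟩
      have h2 := hg.comp h1
      have h3 : Tendsto (fun T : ℝ≥0 => ((T - u.toNNReal : ℝ≥0) : ℝ) / T) atTop (𝓝 1) := by
        have h4 : Tendsto (fun T : ℝ≥0 => 1 - (u.toNNReal : ℝ) / T) atTop (𝓝 (1 - 0)) :=
          tendsto_const_nhds.sub (tendsto_const_nhds.div_atTop tendsto_nnreal_coe_atTop)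
        rw [sub_zero] at h4
        refine h4.congr' ?_
        filter_upwards [eventually_ge_atTop u.toNNReal, eventually_gt_atTop 0] with T hT hT0
        have : (T : ℝ) ≠ 0 := by exact_mod_cast hT0.ne'
        rw [NNReal.coe_sub hT]
        field_simp
      have h5 := hg.sub (h2.mul h3)
      rw [zero_mul, sub_zero] at h5
      refine h5.congr' ?_
      filter_upwards [eventually_gt_atTop u.toNNReal, eventually_gt_atTop 0] with T hT hT0
      have : (T : ℝ) ≠ 0 := by exact_mod_cast hT0.ne'
      have h6 : ((T - u.toNNReal : ℝ≥0) : ℝ) ≠ 0 := by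
        exact_mod_cast (tsub_pos_of_lt hT).ne'
      simp only [Function.comp]
      field_simp
  simpa only [integral_div, integral_zero, laggedMean] using key

end Lag

/-! ### Exact identities for the errors of the estimators. -/

section Algebra

variable {θ μ T e x I D ξ η : ℝ}

/-- Here e stands for e^{-θT}, I for ∫x, D for T∫x² - I², and η for the lagged mean, so (D + I²)/T
is ∫x² and x - θI - θμT is the noise. The right-hand side is arranged so that every factor is a
normalised quantity with a known limit. -/
theorem theta_error_eq (hθ : θ ≠ 0) (hT : T ≠ 0) (he : e ≠ 0) (hD : D ≠ 0) (hξ : ξ ≠ 0) :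
    e⁻¹ * ((1 / 2 * T * x ^ 2 - x * I) / D - θ) - 2 * θ / ξ * η =
      (-(I * e) * ((x - θ * I - θ * μ * T) / T)
        - θ * (((D + I ^ 2) / T - x ^ 2 / (2 * θ)) * e + ξ * η / θ + μ * (I * e))
        - 2 * θ / ξ * (η / T) * (T * (D * e ^ 2 / T - ξ ^ 2 / (2 * θ)))) / (D * e ^ 2 / T) := by
  field_simp
  ring

theorem alpha_error_eq (hθ : θ ≠ 0) (hT : T ≠ 0) (he : e ≠ 0) (hD : D ≠ 0) :
    T * ((x * ((D + I ^ 2) / T) - 1 / 2 * x ^ 2 * I) / D - μ * θ)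
        - (x - θ * I - θ * μ * T - 2 * η) =
      (((x - θ * I - θ * μ * T) / T) *
          ((I * e) ^ 2 - T * ((((D + I ^ 2) / T - x ^ 2 / (2 * θ)) * e) * e))
        + η / T * (2 * (T * (D * e ^ 2 / T - ξ ^ 2 / (2 * θ))) - T * (x * e - ξ) * ξ / θ)
        + x * e * (((D + I ^ 2) / T - x ^ 2 / (2 * θ)) * e + ξ * η / θ + μ * (I * e))
        - μ * (I * e) * (x * e - θ * (I * e))
        - μ * θ * (T * ((((D + I ^ 2) / T - x ^ 2 / (2 * θ)) * e) * e))) / (D * e ^ 2 / T) := by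
  field_simp
  ring

theorem mu_error_eq (hθ : θ ≠ 0) (hT : T ≠ 0) (he : e ≠ 0)
    (hm : 1 / 2 * (x * e) - I * e / T ≠ 0) {J : ℝ} :
    T * ((J - 1 / 2 * x * I) / (1 / 2 * T * x - I) - μ) - (x - θ * I - θ * μ * T - 2 * η) / θ =
      ((x - θ * I - θ * μ * T) / T * (I * e) / θ
        + η / T * (T * (x * e - ξ)) / θ - 2 * (η / T) * (I * e) / θ
        + ((J - x ^ 2 / (2 * θ)) * e + ξ * η / θ + μ * (I * e))) /
          (1 / 2 * (x * e) - I * e / T) := by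
  have h1 : 1 / 2 * (x * e) - I * e / T = (1 / 2 * T * x - I) * (e / T) := by
    field_simp
  rw [h1] at hm ⊢
  have h2 := (mul_ne_zero_iff.1 hm).1
  generalize hM : 1 / 2 * T * x - I = M at *
  obtain rfl : I = 1 / 2 * T * x - M := by linarith
  field_simp
  ring

end Algebra

/-! ### Expansion of the path functionals and of the estimators. -/

theorem tendsto_one_add_pow_mul_exp_neg {θ : ℝ} (hθ : 0 < θ) (k : ℕ) :
    Tendsto (fun T : ℝ≥0 => (1 + (T : ℝ)) ^ k * Real.exp (-θ * T)) atTop (𝓝 0) := by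
  have h := ((isLittleO_pow_exp_pos_mul_atTop k hθ).tendsto_div_nhds_zero).comp
    (tendsto_atTop_add_const_left atTop 1 tendsto_nnreal_coe_atTop)
  have h2 := h.mul_const (Real.exp θ)
  rw [zero_mul] at h2
  refine h2.congr fun T => ?_
  simp only [Function.comp]
  rw [div_mul_eq_mul_div, mul_div_assoc, ← Real.exp_sub]
  ring_nf

namespace IsVasicekPath

variable {θ μ : ℝ} {g x : ℝ≥0 → ℝ}

/-- In ∫ g(μ + x), the part ξe^{θs} of x gives ξe^{θT}(g_T - η_T)/θ by the convolution formula. Its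
g_T cancels the leading part of the cross term -2x_T g_T in (x_T - g_T)², so at order e^{θT} only
η_T survives besides μ∫x. -/
theorem exists_abs_sqInt_remainder_le (h : IsVasicekPath θ μ g x) :
    ∃ M : ℝ, ∀ T : ℝ≥0, |(pathSqInt x T - x T ^ 2 / (2 * θ)) * Real.exp (-θ * T)
      + (μ + zetaInf θ g) * laggedMean θ g T / θ + μ * (pathInt x T * Real.exp (-θ * T))| ≤
        M * ((1 + (T : ℝ)) ^ 3 * Real.exp (-θ * T)) := by
  have hθ := h.pos
  have hgc := h.continuous_noise
  have hxc := h.continuous_path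
  obtain ⟨C, hC, hb⟩ := exists_abs_le_of_tendsto_div h.continuous_noise h.tendsto_div
  obtain ⟨B, hB, hr⟩ := h.abs_sub_exp_le
  set ξ := μ + zetaInf θ g
  have hμ := abs_nonneg μ
  refine ⟨1 / (2 * θ) * (2 * B * C + C ^ 2 + 2 * θ * (C * (|μ| + B))), fun T => ?_⟩
  have hT := T.coe_nonneg
  set e := Real.exp (-θ * T) with he
  have hEe : Real.exp (θ * T) * e = 1 := by
    rw [he, ← Real.exp_add]
    simp
  have hlag := mul_integral_exp_mul_eq hθ hgc h.noise_zero h.tendsto_div T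
  have hR : Continuous fun s : ℝ => g s.toNNReal * (μ + (x s.toNNReal - ξ * Real.exp (θ * s))) := by
    fun_prop
  have hE : Continuous fun s : ℝ => ξ * (Real.exp (θ * s) * g s.toNNReal) := by fun_prop
  set R := ∫ s in (0 : ℝ)..T, g s.toNNReal * (μ + (x s.toNNReal - ξ * Real.exp (θ * s))) with hRdef
  have hsplit : ∫ s in (0 : ℝ)..T, g s.toNNReal * (μ + x s.toNNReal) =
      R + ξ * ∫ s in (0 : ℝ)..T, Real.exp (θ * s) * g s.toNNReal := by
    rw [hRdef, ← intervalIntegral.integral_const_mul, ← intervalIntegral.integral_add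
      (hR.intervalIntegrable _ _) (hE.intervalIntegrable _ _)]
    refine intervalIntegral.integral_congr fun s _ => ?_
    ring
  -- Each of the two factors of the integrand is at most linear and the interval has length T, hence
  -- the third power.
  have hRle : |R| ≤ C * (|μ| + B) * (1 + T) ^ 3 := by
    have h1 := intervalIntegral.norm_integral_le_of_norm_le_const (a := (0 : ℝ)) (b := (T : ℝ))
      (f := fun s : ℝ => g s.toNNReal * (μ + (x s.toNNReal - ξ * Real.exp (θ * s))))
      (C := C * (1 + T) * (|μ| * (1 + T) + B * (1 + T))) fun s hs => by
        rw [Set.uIoc_of_le hT] at hs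
        rw [norm_mul, Real.norm_eq_abs, Real.norm_eq_abs]
        have h2 := hb s.toNNReal
        have h3 := hr s.toNNReal
        rw [Real.coe_toNNReal s hs.1.le] at h2 h3
        have h4 : C * (1 + s) ≤ C * (1 + T) := by
          have := hs.2
          gcongr
        have h5 : B * (1 + s) ≤ B * (1 + T) := by
          have := hs.2
          gcongr
        refine mul_le_mul (h2.trans h4) ((abs_add_le _ _).trans ?_) (abs_nonneg _) (by positivity)
        have : |μ| ≤ |μ| * (1 + T) := le_mul_of_one_le_right hμ (by linarith)
        linarith
    rw [sub_zero, abs_of_nonneg hT, Real.norm_eq_abs] at h1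
    refine h1.trans ?_
    have : C * (1 + T) * (|μ| * (1 + T) + B * (1 + T)) * T =
      C * (|μ| + B) * ((1 + T) ^ 2 * T) := by ring
    rw [this]
    refine mul_le_mul_of_nonneg_left ?_ (by positivity)
    nlinarith [sq_nonneg (1 + (T : ℝ))]
  have hJ := h.pathSqInt_eq T
  rw [hsplit] at hJ
  have heq : (pathSqInt x T - x T ^ 2 / (2 * θ)) * e + ξ * laggedMean θ g T / θ
      + μ * (pathInt x T * e) = 1 / (2 * θ) * (-(2 * (x T - ξ * Real.exp (θ * T)) * g T)
        + g T ^ 2 + 2 * θ * R) * e := by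
    have h1 : pathSqInt x T = ((x T - g T) ^ 2 - 2 * θ * μ * pathInt x T +
      2 * θ * R + 2 * ξ * (Real.exp (θ * T) * (g T - laggedMean θ g T))) / (2 * θ) := by
      rw [eq_div_iff (by positivity), ← hlag]
      linear_combination hJ
    -- The field identity does not know that e is the inverse of e^{θT}; the discrepancy is
    -- collected in the factor 1 - e^{θT}e.
    have h2 : (pathSqInt x T - x T ^ 2 / (2 * θ)) * e + ξ * laggedMean θ g T / θ
        + μ * (pathInt x T * e) - 1 / (2 * θ) * (-(2 * (x T - ξ * Real.exp (θ * T)) * g T)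
        + g T ^ 2 + 2 * θ * R) * e =
        ξ * laggedMean θ g T / θ * (1 - Real.exp (θ * T) * e) := by
      rw [h1]
      field_simp
      ring
    rwa [hEe, sub_self, mul_zero, sub_eq_zero] at h2
  have he0 : 0 < e := Real.exp_pos _
  rw [heq, abs_mul, abs_mul, abs_of_pos he0, abs_of_pos (by positivity : 0 < 1 / (2 * θ))]
  have h1 : |2 * (x T - ξ * Real.exp (θ * T)) * g T| ≤ 2 * B * C * (1 + T) ^ 3 := by
    rw [abs_mul, abs_mul, abs_two]
    calc _ ≤ 2 * (B * (1 + T)) * (C * (1 + T)) := by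
          gcongr
          · exact hr T
          · exact hb T
      _ = 2 * B * C * (1 + T) ^ 2 := by ring
      _ ≤ 2 * B * C * (1 + T) ^ 3 := by
        gcongr
        · linarith
        · norm_num
  have h2 : |g T ^ 2| ≤ C ^ 2 * (1 + T) ^ 3 := by
    rw [abs_pow]
    calc _ ≤ (C * (1 + T)) ^ 2 := by
          gcongr
          exact hb T
      _ = C ^ 2 * (1 + T) ^ 2 := by ring
      _ ≤ _ := by
        gcongr
        · linarith
        · norm_num
  have h3 : |-(2 * (x T - ξ * Real.exp (θ * T)) * g T) + g T ^ 2 + 2 * θ * R| ≤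
      2 * B * C * (1 + T) ^ 3 + C ^ 2 * (1 + T) ^ 3 + 2 * θ * (C * (|μ| + B) * (1 + T) ^ 3) := by
    refine (abs_add_three _ _ _).trans ?_
    rw [abs_neg, abs_mul (2 * θ), abs_of_pos (by positivity : 0 < 2 * θ)]
    gcongr
  calc _ ≤ 1 / (2 * θ) * (2 * B * C * (1 + T) ^ 3 + C ^ 2 * (1 + T) ^ 3 +
        2 * θ * (C * (|μ| + B) * (1 + T) ^ 3)) * e := by gcongr
    _ = _ := by ring

/-- The limits, as `T → ∞`, of the normalised functionals of the path of which the estimators are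
made up. -/
structure NormalisedLimits (θ μ : ℝ) (g x : ℝ≥0 → ℝ) (ξ : ℝ) : Prop where
  noise : Tendsto (fun T : ℝ≥0 => g T / T) atTop (𝓝 0)
  lag : Tendsto (fun T : ℝ≥0 => laggedMean θ g T / T) atTop (𝓝 0)
  path : Tendsto (fun T : ℝ≥0 => x T * Real.exp (-θ * T)) atTop (𝓝 ξ)
  mul_path : Tendsto (fun T : ℝ≥0 => T * (x T * Real.exp (-θ * T) - ξ)) atTop (𝓝 0)
  int : Tendsto (fun T : ℝ≥0 => pathInt x T * Real.exp (-θ * T)) atTop (𝓝 (ξ / θ))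
  remainder : Tendsto (fun T : ℝ≥0 => (pathSqInt x T - x T ^ 2 / (2 * θ)) * Real.exp (-θ * T)
    + ξ * laggedMean θ g T / θ + μ * (pathInt x T * Real.exp (-θ * T))) atTop (𝓝 0)
  mul_sqInt : Tendsto (fun T : ℝ≥0 => T * ((pathSqInt x T - x T ^ 2 / (2 * θ)) *
    Real.exp (-θ * T) * Real.exp (-θ * T))) atTop (𝓝 0)
  det : Tendsto (fun T : ℝ≥0 => (T * pathSqInt x T - pathInt x T ^ 2) *
    Real.exp (-θ * T) ^ 2 / T) atTop (𝓝 (ξ ^ 2 / (2 * θ)))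
  mul_det : Tendsto (fun T : ℝ≥0 => T * ((T * pathSqInt x T - pathInt x T ^ 2) *
    Real.exp (-θ * T) ^ 2 / T - ξ ^ 2 / (2 * θ))) atTop (𝓝 (-(ξ / θ) ^ 2))

/-- Everything follows from the linear error of x_T - ξe^{θT}, the exponentially small remainder of
∫x², and the fact that g_T and η_T are o(T). -/
theorem normalisedLimits (h : IsVasicekPath θ μ g x) :
    NormalisedLimits θ μ g x (μ + zetaInf θ g) := by
  have hθ := h.pos
  obtain ⟨M, hM⟩ := h.exists_abs_sqInt_remainder_le
  obtain ⟨B, hB, hr⟩ := h.abs_sub_exp_le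
  have hlag := tendsto_laggedMean_div hθ h.continuous_noise h.tendsto_div
  set ξ := μ + zetaInf θ g
  have hEe : ∀ T : ℝ≥0, Real.exp (θ * T) * Real.exp (-θ * T) = 1 := fun T => by
    rw [← Real.exp_add]
    simp
  have hpow : ∀ k : ℕ, Tendsto (fun T : ℝ≥0 => (T : ℝ) ^ k * Real.exp (-θ * T)) atTop (𝓝 0) :=
    fun k => squeeze_zero (fun T => by positivity) (fun T => by gcongr; linarith)
      (tendsto_one_add_pow_mul_exp_neg hθ k)
  have hTe : Tendsto (fun T : ℝ≥0 => (T : ℝ) * Real.exp (-θ * T)) atTop (𝓝 0) := by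
    simpa using hpow 1
  have hmul : Tendsto (fun T : ℝ≥0 => T * (x T * Real.exp (-θ * T) - ξ)) atTop (𝓝 0) := by
    have h1 := (tendsto_one_add_pow_mul_exp_neg hθ 2).const_mul B
    rw [mul_zero] at h1
    refine squeeze_zero_norm (fun T => ?_) h1
    have hT := T.coe_nonneg
    have h2 : x T * Real.exp (-θ * T) - ξ = (x T - ξ * Real.exp (θ * T)) * Real.exp (-θ * T) := by
      linear_combination ξ * hEe T
    rw [h2, norm_mul, norm_mul, Real.norm_of_nonneg hT, Real.norm_of_nonneg (Real.exp_pos _).le,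
      Real.norm_eq_abs]
    calc _ ≤ (1 + (T : ℝ)) * (B * (1 + T) * Real.exp (-θ * T)) := by
          gcongr
          · linarith
          · exact hr T
      _ = _ := by ring
  have hpath : Tendsto (fun T : ℝ≥0 => x T * Real.exp (-θ * T)) atTop (𝓝 ξ) := by
    have h1 := (hmul.div_atTop tendsto_nnreal_coe_atTop).add_const ξ
    rw [zero_add] at h1
    refine h1.congr' ?_
    filter_upwards [eventually_gt_atTop 0] with T hT
    have : (T : ℝ) ≠ 0 := by exact_mod_cast hT.ne'
    field_simp
    ring
  have hint : Tendsto (fun T : ℝ≥0 => pathInt x T * Real.exp (-θ * T)) atTop (𝓝 (ξ / θ)) := by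
    have h1 := ((hpath.sub (h.tendsto_div.mul hTe)).sub (hTe.const_mul (θ * μ))).div_const θ
    simp only [mul_zero, sub_zero] at h1
    refine h1.congr' ?_
    filter_upwards [eventually_gt_atTop 0] with T hT
    have hT' : (T : ℝ) ≠ 0 := by exact_mod_cast hT.ne'
    rw [div_eq_iff hθ.ne']
    field_simp
    linear_combination -h.pathInt_eq T
  have hrem : Tendsto (fun T : ℝ≥0 => (pathSqInt x T - x T ^ 2 / (2 * θ)) * Real.exp (-θ * T)
      + ξ * laggedMean θ g T / θ + μ * (pathInt x T * Real.exp (-θ * T))) atTop (𝓝 0) := by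
    have h1 := (tendsto_one_add_pow_mul_exp_neg hθ 3).const_mul M
    rw [mul_zero] at h1
    exact squeeze_zero_norm hM h1
  have hsq : Tendsto (fun T : ℝ≥0 => T * ((pathSqInt x T - x T ^ 2 / (2 * θ)) *
      Real.exp (-θ * T) * Real.exp (-θ * T))) atTop (𝓝 0) := by
    have h1 := ((hrem.mul hTe).sub ((hlag.mul (hpow 2)).const_mul (ξ / θ))).sub
      ((hint.mul hTe).const_mul μ)
    simp only [mul_zero, sub_zero] at h1
    refine h1.congr' ?_
    filter_upwards [eventually_gt_atTop 0] with T hT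
    have hT' : (T : ℝ) ≠ 0 := by exact_mod_cast hT.ne'
    field_simp
    ring
  -- Multiplied by T, the error of the determinant is T(x²e² - ξ²)/(2θ) + T(∫x² - x²/(2θ))e² -
  -- (Ie)², with I = ∫x and e = e^{-θT}. The first two terms vanish, so the relative error is of
  -- order 1/T, which is enough against η_T = o(T).
  have hmdet : Tendsto (fun T : ℝ≥0 => T * ((T * pathSqInt x T - pathInt x T ^ 2) *
      Real.exp (-θ * T) ^ 2 / T - ξ ^ 2 / (2 * θ))) atTop (𝓝 (-(ξ / θ) ^ 2)) := by
    have h1 := (((hmul.mul (hpath.add_const ξ)).div_const (2 * θ)).add hsq).sub (hint.pow 2)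
    simp only [zero_mul, zero_div, zero_add, zero_sub] at h1
    refine h1.congr' ?_
    filter_upwards [eventually_gt_atTop 0] with T hT
    have hT' : (T : ℝ) ≠ 0 := by exact_mod_cast hT.ne'
    field_simp
    ring
  refine ⟨h.tendsto_div, hlag, hpath, hmul, hint, hrem, hsq, ?_, hmdet⟩
  have h1 := (hmdet.div_atTop tendsto_nnreal_coe_atTop).add_const (ξ ^ 2 / (2 * θ))
  rw [zero_add] at h1
  refine h1.congr' ?_
  filter_upwards [eventually_gt_atTop 0] with T hT
  have hT' : (T : ℝ) ≠ 0 := by exact_mod_cast hT.ne'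
  field_simp
  ring

theorem eventually_det_ne_zero (h : IsVasicekPath θ μ g x) (hξ : μ + zetaInf θ g ≠ 0) :
    ∀ᶠ T : ℝ≥0 in atTop, (T : ℝ) * pathSqInt x T - pathInt x T ^ 2 ≠ 0 := by
  have hθ := h.pos
  filter_upwards [h.normalisedLimits.det.eventually_ne
    (by positivity : (μ + zetaInf θ g) ^ 2 / (2 * θ) ≠ 0)] with T hT hD
  simp [hD] at hT

theorem noise_eq (h : IsVasicekPath θ μ g x) (T : ℝ≥0) :
    g T = x T - θ * pathInt x T - θ * μ * T := by
  linarith [h.pathInt_eq T]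

/-- In the algebraic identity every product in the numerator contains a factor that tends to zero,
while the denominator tends to ξ²/(2θ) ≠ 0. The lagged mean enters only divided by T. -/
theorem tendsto_theta_error (h : IsVasicekPath θ μ g x) (hξ : μ + zetaInf θ g ≠ 0) :
    Tendsto (fun T : ℝ≥0 => Real.exp (θ * T) * (thetaTilde x T - θ)
      - 2 * θ / (μ + zetaInf θ g) * laggedMean θ g T) atTop (𝓝 0) := by
  have hθ := h.pos
  have L := h.normalisedLimits
  have hdet := h.eventually_det_ne_zero hξ
  set ξ := μ + zetaInf θ g
  have h1 := (((L.int.neg.mul L.noise).sub (L.remainder.const_mul θ)).sub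
    ((L.lag.const_mul (2 * θ / ξ)).mul L.mul_det)).div L.det (by positivity)
  simp only [mul_zero, zero_mul, sub_zero, zero_div] at h1
  refine h1.congr' ?_
  filter_upwards [eventually_gt_atTop 0, hdet] with T hT hD
  have hT' : (T : ℝ) ≠ 0 := by exact_mod_cast hT.ne'
  have key := theta_error_eq (μ := μ) (x := x T) (I := pathInt x T) (η := laggedMean θ g T)
    hθ.ne' hT' (Real.exp_pos (-θ * T)).ne' hD hξ
  rw [← h.noise_eq T, sub_add_cancel, mul_div_cancel_left₀ _ hT', ← Real.exp_neg] at key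
  rw [thetaTilde, show θ * (T : ℝ) = -(-θ * T) by ring, key]
  rfl

theorem tendsto_alpha_error (h : IsVasicekPath θ μ g x) (hξ : μ + zetaInf θ g ≠ 0) :
    Tendsto (fun T : ℝ≥0 => T * (alphaTilde x T - μ * θ) - (g T - 2 * laggedMean θ g T)) atTop
      (𝓝 0) := by
  have hθ := h.pos
  have L := h.normalisedLimits
  have hdet := h.eventually_det_ne_zero hξ
  set ξ := μ + zetaInf θ g
  have h1 := (((((L.noise.mul ((L.int.pow 2).sub L.mul_sqInt)).add (L.lag.mul
    ((L.mul_det.const_mul 2).sub ((L.mul_path.mul_const ξ).div_const θ)))).add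
    (L.path.mul L.remainder)).sub ((L.int.const_mul μ).mul (L.path.sub (L.int.const_mul θ)))).sub
    (L.mul_sqInt.const_mul (μ * θ))).div L.det (by positivity)
  -- The only term that needs a cancellation is the one with x_T e^{-θT} - θ e^{-θT}∫x, where both
  -- parts tend to ξ.
  simp only [mul_zero, zero_mul, sub_zero, zero_div, add_zero, mul_div_cancel₀ _ hθ.ne',
    sub_self] at h1
  refine h1.congr' ?_
  filter_upwards [eventually_gt_atTop 0, hdet] with T hT hD
  have hT' : (T : ℝ) ≠ 0 := by exact_mod_cast hT.ne'
  have key := alpha_error_eq (μ := μ) (x := x T) (I := pathInt x T) (η := laggedMean θ g T) (ξ := ξ)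
    hθ.ne' hT' (Real.exp_pos (-θ * T)).ne' hD
  rw [← h.noise_eq T, sub_add_cancel, mul_div_cancel_left₀ _ hT'] at key
  rw [alphaTilde, key]
  rfl

/-- The estimator is expanded directly rather than as a quotient of the other two: its denominator,
times e^{-θT}/T, tends to ξ/2. -/
theorem tendsto_mu_error (h : IsVasicekPath θ μ g x) (hξ : μ + zetaInf θ g ≠ 0) :
    Tendsto (fun T : ℝ≥0 => T * (muTilde x T - μ) - (g T - 2 * laggedMean θ g T) / θ) atTop
      (𝓝 0) := by
  have hθ := h.pos
  have L := h.normalisedLimits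
  set ξ := μ + zetaInf θ g
  have hden : Tendsto (fun T : ℝ≥0 => 1 / 2 * (x T * Real.exp (-θ * T)) -
      pathInt x T * Real.exp (-θ * T) / T) atTop (𝓝 (1 / 2 * ξ)) := by
    have h1 := (L.path.const_mul (1 / 2)).sub (L.int.div_atTop tendsto_nnreal_coe_atTop)
    rwa [sub_zero] at h1
  have hne : 1 / 2 * ξ ≠ 0 := by positivity
  have h1 := (((((L.noise.mul L.int).div_const θ).add ((L.lag.mul L.mul_path).div_const θ)).sub
    (((L.lag.const_mul 2).mul L.int).div_const θ)).add L.remainder).div hden hne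
  simp only [mul_zero, zero_mul, sub_zero, zero_div, add_zero] at h1
  refine h1.congr' ?_
  filter_upwards [eventually_gt_atTop 0, hden.eventually_ne hne] with T hT hD
  have hT' : (T : ℝ) ≠ 0 := by exact_mod_cast hT.ne'
  have key := mu_error_eq (μ := μ) (η := laggedMean θ g T) (ξ := ξ) (J := pathSqInt x T)
    hθ.ne' hT' (Real.exp_pos (-θ * T)).ne' hD
  rw [← h.noise_eq T] at key
  rw [muTilde, key]
  rfl

theorem tendsto_thetaTilde (h : IsVasicekPath θ μ g x) (hξ : μ + zetaInf θ g ≠ 0) :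
    Tendsto (thetaTilde x) atTop (𝓝 θ) := by
  have L := h.normalisedLimits
  have hTe : Tendsto (fun T : ℝ≥0 => (1 + (T : ℝ)) * Real.exp (-θ * T)) atTop (𝓝 0) := by
    simpa using tendsto_one_add_pow_mul_exp_neg h.pos 1
  have he : Tendsto (fun T : ℝ≥0 => Real.exp (-θ * T)) atTop (𝓝 0) := by
    simpa using tendsto_one_add_pow_mul_exp_neg h.pos 0
  have h1 := (((h.tendsto_theta_error hξ).mul he).add
    ((L.lag.mul (hTe.sub he)).const_mul (2 * θ / (μ + zetaInf θ g)))).add_const θ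
  simp only [mul_zero, sub_zero, add_zero, zero_add] at h1
  refine h1.congr' ?_
  filter_upwards [eventually_gt_atTop 0] with T hT
  have hT' : (T : ℝ) ≠ 0 := by exact_mod_cast hT.ne'
  have hEe : Real.exp (θ * T) * Real.exp (-θ * T) = 1 := by
    rw [← Real.exp_add]
    simp
  have h2 : laggedMean θ g T / T * ((1 + (T : ℝ)) * Real.exp (-θ * T) - Real.exp (-θ * T)) =
      laggedMean θ g T * Real.exp (-θ * T) := by
    field_simp
    ring
  rw [h2]
  linear_combination (thetaTilde x T - θ) * hEe

theorem tendsto_noise_sub_lag_div (h : IsVasicekPath θ μ g x) :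
    Tendsto (fun T : ℝ≥0 => (g T - 2 * laggedMean θ g T) / T) atTop (𝓝 0) := by
  have L := h.normalisedLimits
  have h1 := L.noise.sub (L.lag.const_mul 2)
  simp only [mul_zero, sub_zero] at h1
  refine h1.congr fun T => ?_
  ring

theorem tendsto_alphaTilde (h : IsVasicekPath θ μ g x) (hξ : μ + zetaInf θ g ≠ 0) :
    Tendsto (alphaTilde x) atTop (𝓝 (μ * θ)) := by
  have h1 := (((h.tendsto_alpha_error hξ).div_atTop tendsto_nnreal_coe_atTop).add
    h.tendsto_noise_sub_lag_div).add_const (μ * θ)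
  simp only [zero_add] at h1
  refine h1.congr' ?_
  filter_upwards [eventually_gt_atTop 0] with T hT
  have hT' : (T : ℝ) ≠ 0 := by exact_mod_cast hT.ne'
  field_simp
  ring

theorem tendsto_muTilde (h : IsVasicekPath θ μ g x) (hξ : μ + zetaInf θ g ≠ 0) :
    Tendsto (muTilde x) atTop (𝓝 μ) := by
  have hθ := h.pos.ne'
  have h1 := (((h.tendsto_mu_error hξ).div_atTop tendsto_nnreal_coe_atTop).add
    (h.tendsto_noise_sub_lag_div.div_const θ)).add_const μ
  simp only [zero_add, zero_div] at h1
  refine h1.congr' ?_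
  filter_upwards [eventually_gt_atTop 0] with T hT
  have hT' : (T : ℝ) ≠ 0 := by exact_mod_cast hT.ne'
  field_simp
  ring

end IsVasicekPath

/-! ### Convergence in distribution of Gaussian triples, and continuous mapping. -/

section Distribution

variable {Ω Ω' : Type*} [MeasurableSpace Ω] [MeasurableSpace Ω'] {P : Measure Ω} {P' : Measure Ω'}
  [IsProbabilityMeasure P] [IsProbabilityMeasure P']

/-- It suffices to test along sequences tending to infinity, where almost sure convergence implies
convergence in measure. -/
theorem tendstoInMeasure_atTop_nnreal_of_tendsto_ae {E : Type*} [PseudoEMetricSpace E]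
    {f : ℝ≥0 → Ω → E} {g : Ω → E} (hf : ∀ T, AEStronglyMeasurable (f T) P)
    (hfg : ∀ᵐ ω ∂P, Tendsto (fun T => f T ω) atTop (𝓝 (g ω))) : TendstoInMeasure P f atTop g := by
  intro ε hε
  refine tendsto_of_seq_tendsto fun u hu => ?_
  exact tendstoInMeasure_of_tendsto_ae (fun n => hf (u n)) (hfg.mono fun ω hω => hω.comp hu) ε hε

/-- **Continuous mapping theorem** for a map that is continuous on an open set to which the limit
belongs almost surely. -/
theorem MeasureTheory.TendstoInDistribution.comp_continuousOn {ι E F : Type*} [TopologicalSpace E]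
    [HasOuterApproxClosed E] [MeasurableSpace E] [BorelSpace E] [TopologicalSpace F]
    [HasOuterApproxClosed F] [MeasurableSpace F] [BorelSpace F] {X : ι → Ω → E} {Z : Ω' → E}
    {l : Filter ι} [l.IsCountablyGenerated]
    (h : TendstoInDistribution X l Z (fun _ => P) P') {f : E → F} {U : Set E} (hU : IsOpen U)
    (hf : Measurable f) (hfU : ContinuousOn f U) (hZ : ∀ᵐ ω ∂P', Z ω ∈ U) :
    TendstoInDistribution (fun i => f ∘ X i) l (f ∘ Z) (fun _ => P) P' where
  forall_aemeasurable i := hf.comp_aemeasurable (h.forall_aemeasurable i)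
  aemeasurable_limit := hf.comp_aemeasurable h.aemeasurable_limit
  tendsto := by
    refine tendsto_of_forall_isOpen_le_liminf' fun G hG => ?_
    -- Portmanteau: the preimage of G need not be open, but its part in U is, and that part carries
    -- all the mass of the preimage under the limit law.
    have hV : IsOpen (U ∩ f ⁻¹' G) := hfU.isOpen_inter_preimage hU hG
    have key := ProbabilityMeasure.le_liminf_measure_open_of_tendsto h.tendsto hV
    simp only [ProbabilityMeasure.coe_mk] at key ⊢
    rw [Measure.map_apply_of_aemeasurable (hf.comp_aemeasurable h.aemeasurable_limit)
      hG.measurableSet]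
    rw [Measure.map_apply_of_aemeasurable h.aemeasurable_limit hV.measurableSet] at key
    have h1 : P' (f ∘ Z ⁻¹' G) = P' (Z ⁻¹' (U ∩ f ⁻¹' G)) := by
      refine measure_congr ?_
      filter_upwards [hZ] with ω hω
      exact propext ⟨fun h => ⟨hω, h⟩, fun h => h.2⟩
    rw [h1]
    refine key.trans (liminf_le_liminf (Eventually.of_forall fun i => ?_))
    rw [Measure.map_apply_of_aemeasurable (h.forall_aemeasurable i) hV.measurableSet,
      Measure.map_apply_of_aemeasurable (hf.comp_aemeasurable (h.forall_aemeasurable i))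
        hG.measurableSet]
    exact measure_mono fun ω hω => hω.2

omit [IsProbabilityMeasure P] in
-- Cramér-Wold: the characteristic function of the vector at t is that of the linear combination
-- with coefficients t, taken at 1.
theorem charFun_map_of_hasLaw_gaussianReal {A B C : Ω → ℝ} (hA : AEMeasurable A P)
    (hB : AEMeasurable B P) (hC : AEMeasurable C P) (t : EuclideanSpace ℝ (Fin 3)) {v : ℝ≥0}
    (h : HasLaw (fun ω => t 0 * A ω + t 1 * B ω + t 2 * C ω) (gaussianReal 0 v) P) :
    charFun (P.map fun ω => (!₂[A ω, B ω, C ω] : EuclideanSpace ℝ (Fin 3))) t =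
      Complex.exp (-(v : ℂ) / 2) := by
  have hm : AEMeasurable (fun ω => (!₂[A ω, B ω, C ω] : EuclideanSpace ℝ (Fin 3))) P :=
    (WithLp.measurable_toLp 2 _).comp_aemeasurable (aemeasurable_pi_iff.2 fun i => by
      fin_cases i <;> simpa)
  have h1 : charFun (P.map fun ω => t 0 * A ω + t 1 * B ω + t 2 * C ω) 1 =
      Complex.exp (-(v : ℂ) / 2) := by
    rw [h.map_eq, charFun_gaussianReal]
    simp [neg_div]
  rw [← h1, charFun_apply, charFun_apply_real, integral_map hm (by fun_prop),
    integral_map h.aemeasurable (by fun_prop)]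
  refine integral_congr_ae (ae_of_all _ fun ω => ?_)
  simp [PiLp.inner_apply, Fin.sum_univ_three]

omit [IsProbabilityMeasure P] in
theorem hasLaw_gaussianReal_comb {N₁ N₂ Z : Ω → ℝ} {v : ℝ≥0} (h1 : HasLaw N₁ (gaussianReal 0 1) P)
    (h2 : HasLaw N₂ (gaussianReal 0 1) P) (hZ : HasLaw Z (gaussianReal 0 v) P)
    (h12 : IndepFun N₁ N₂ P) (hNZ : IndepFun (fun ω => (N₁ ω, N₂ ω)) Z P) (a b c : ℝ) :
    HasLaw (fun ω => a * N₁ ω + b * N₂ ω + c * Z ω)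
      (gaussianReal 0 (a ^ 2 + b ^ 2 + c ^ 2 * v).toNNReal) P := by
  have e1 := gaussianReal_const_mul h1 a
  have e2 := gaussianReal_const_mul h2 b
  have e3 := gaussianReal_const_mul hZ c
  have i12 := h12.comp (φ := fun x => a * x) (ψ := fun x => b * x) (by fun_prop) (by fun_prop)
  have l12 := gaussianReal_add_gaussianReal_of_indepFun i12 e1.map_eq e2.map_eq
  have i3 := hNZ.comp (φ := fun x => a * x.1 + b * x.2) (ψ := fun x => c * x) (by fun_prop)
    (by fun_prop)
  have l3 := gaussianReal_add_gaussianReal_of_indepFun i3 l12 e3.map_eq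
  refine ⟨(e1.aemeasurable.add e2.aemeasurable).add e3.aemeasurable, ?_⟩
  have hv : (a ^ 2 + b ^ 2 + c ^ 2 * (v : ℝ)).toNNReal =
      NNReal.mk (a ^ 2) (sq_nonneg a) * 1 + NNReal.mk (b ^ 2) (sq_nonneg b) * 1 +
        NNReal.mk (c ^ 2) (sq_nonneg c) * v := by
    apply NNReal.coe_injective
    rw [Real.coe_toNNReal _ (by positivity)]
    simp
  rw [hv]
  simp only [mul_zero, add_zero] at l3
  exact l3

/-- For centered Gaussian combinations the characteristic function depends on the variance alone, so
convergence of variances suffices by Lévy's continuity theorem. -/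
theorem tendstoInDistribution_of_hasLaw_gaussianReal {A B C : ℝ≥0 → Ω → ℝ} {A' B' C' : Ω' → ℝ}
    (hA : ∀ T, AEMeasurable (A T) P) (hB : ∀ T, AEMeasurable (B T) P)
    (hC : ∀ T, AEMeasurable (C T) P) (hA' : AEMeasurable A' P') (hB' : AEMeasurable B' P')
    (hC' : AEMeasurable C' P')
    (h : ∀ a b c : ℝ, ∃ (v : ℝ≥0 → ℝ≥0) (v' : ℝ≥0), Tendsto v atTop (𝓝 v') ∧
      (∀ T, HasLaw (fun ω => a * A T ω + b * B T ω + c * C T ω) (gaussianReal 0 (v T)) P) ∧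
      HasLaw (fun ω => a * A' ω + b * B' ω + c * C' ω) (gaussianReal 0 v') P') :
    TendstoInDistribution
      (fun T ω => (!₂[A T ω, B T ω, C T ω] : EuclideanSpace ℝ (Fin 3))) atTop
      (fun ω => !₂[A' ω, B' ω, C' ω]) (fun _ => P) P' where
  forall_aemeasurable T := (WithLp.measurable_toLp 2 _).comp_aemeasurable
    (aemeasurable_pi_iff.2 fun i => by fin_cases i <;> simp [hA, hB, hC])
  aemeasurable_limit := (WithLp.measurable_toLp 2 _).comp_aemeasurable
    (aemeasurable_pi_iff.2 fun i => by fin_cases i <;> simpa)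
  tendsto := by
    refine tendsto_of_seq_tendsto fun u hu => ?_
    refine ProbabilityMeasure.tendsto_of_tendsto_charFun fun t => ?_
    obtain ⟨v, v', hv, h1, h2⟩ := h (t 0) (t 1) (t 2)
    simp only [Function.comp, ProbabilityMeasure.coe_mk]
    rw [charFun_map_of_hasLaw_gaussianReal hA' hB' hC' t h2]
    simp_rw [charFun_map_of_hasLaw_gaussianReal (hA _) (hB _) (hC _) t (h1 _)]
    have hc : Continuous fun w : ℝ≥0 => Complex.exp (-(w : ℂ) / 2) := by fun_prop
    exact (hc.tendsto v').comp (hv.comp hu)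

end Distribution

/-! ### Measurability of path functionals. -/

section Measurability

variable {Ω : Type*} [MeasurableSpace Ω] {Y : ℝ≥0 → Ω → ℝ}

theorem measurable_uncurry_comp_toNNReal (hc : ∀ ω, Continuous fun t => Y t ω)
    (hm : ∀ t, Measurable (Y t)) : Measurable fun x : Ω × ℝ => Y x.2.toNNReal x.1 :=
  (measurable_uncurry_of_continuous_of_measurable hc hm).comp
    ((measurable_real_toNNReal.comp measurable_snd).prodMk measurable_fst)

theorem measurable_intervalIntegral_of_uncurry {f : Ω → ℝ → ℝ}
    (hf : Measurable (Function.uncurry f)) (a b : ℝ) :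
    Measurable fun ω => ∫ s in a..b, f ω s := by
  simp only [intervalIntegral]
  exact (hf.stronglyMeasurable.integral_prod_right.measurable).sub
    hf.stronglyMeasurable.integral_prod_right.measurable

theorem measurable_zetaInf (θ : ℝ) (hc : ∀ ω, Continuous fun t => Y t ω)
    (hm : ∀ t, Measurable (Y t)) : Measurable fun ω => zetaInf θ (Y · ω) := by
  have h : Measurable (Function.uncurry fun (ω : Ω) (s : ℝ) =>
      Real.exp (-θ * s) * Y s.toNNReal ω) := by
    have := measurable_uncurry_comp_toNNReal hc hm
    exact (by fun_prop : Measurable fun x : Ω × ℝ => Real.exp (-θ * x.2)).mul this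
  exact (h.stronglyMeasurable.integral_prod_right.measurable).const_mul θ

theorem measurable_pathInt (hc : ∀ ω, Continuous fun t => Y t ω) (hm : ∀ t, Measurable (Y t))
    (T : ℝ≥0) : Measurable fun ω => pathInt (Y · ω) T :=
  measurable_intervalIntegral_of_uncurry (measurable_uncurry_comp_toNNReal hc hm) _ _

theorem measurable_pathSqInt (hc : ∀ ω, Continuous fun t => Y t ω) (hm : ∀ t, Measurable (Y t))
    (T : ℝ≥0) : Measurable fun ω => pathSqInt (Y · ω) T :=
  measurable_intervalIntegral_of_uncurry ((measurable_uncurry_comp_toNNReal hc hm).pow_const 2) _ _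

theorem measurable_vasicekSol (θ μ : ℝ) (hc : ∀ ω, Continuous fun t => Y t ω)
    (hm : ∀ t, Measurable (Y t)) (T : ℝ≥0) : Measurable fun ω => vasicekSol θ μ (Y · ω) T := by
  have h : Measurable (Function.uncurry fun (ω : Ω) (s : ℝ) =>
      θ * Real.exp (-θ * s) * (μ + Y s.toNNReal ω)) := by
    have := measurable_uncurry_comp_toNNReal hc hm
    exact (by fun_prop : Measurable fun x : Ω × ℝ => θ * Real.exp (-θ * x.2)).mul
      (this.const_add μ)
  exact (hm T).add ((measurable_intervalIntegral_of_uncurry h _ _).const_mul _)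

theorem measurable_thetaTilde (hc : ∀ ω, Continuous fun t => Y t ω) (hm : ∀ t, Measurable (Y t))
    (T : ℝ≥0) : Measurable fun ω => thetaTilde (Y · ω) T := by
  have h1 := measurable_pathInt hc hm T
  have h2 := measurable_pathSqInt hc hm T
  have h3 := hm T
  unfold thetaTilde
  fun_prop

theorem measurable_alphaTilde (hc : ∀ ω, Continuous fun t => Y t ω) (hm : ∀ t, Measurable (Y t))
    (T : ℝ≥0) : Measurable fun ω => alphaTilde (Y · ω) T := by
  have h1 := measurable_pathInt hc hm T
  have h2 := measurable_pathSqInt hc hm T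
  have h3 := hm T
  unfold alphaTilde
  fun_prop

theorem measurable_muTilde (hc : ∀ ω, Continuous fun t => Y t ω) (hm : ∀ t, Measurable (Y t))
    (T : ℝ≥0) : Measurable fun ω => muTilde (Y · ω) T := by
  have h1 := measurable_pathInt hc hm T
  have h2 := measurable_pathSqInt hc hm T
  have h3 := hm T
  unfold muTilde
  fun_prop

/-- A random variable independent of a process with continuous paths is independent of `ζ_∞` of
that process. -/
theorem ProbabilityTheory.IndepFun.zetaInf_right {P : Measure Ω} {β : Type*} [MeasurableSpace β] {N : Ω → β}
    (θ : ℝ) (hc : ∀ ω, Continuous fun t => Y t ω)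
    (h : IndepFun N (fun ω t => Y t ω) P) : IndepFun N (fun ω => zetaInf θ (Y · ω)) P := by
  rw [IndepFun_iff_Indep] at h ⊢
  refine indep_of_indep_of_le_right h ?_
  -- The measurability of ζ_∞ is used with the σ-algebra generated by the process in place of the
  -- ambient one.
  have hm : ∀ t, Measurable[MeasurableSpace.comap (fun ω t => Y t ω) MeasurableSpace.pi] (Y t) :=
    fun t => (measurable_pi_apply t).comp (comap_measurable fun ω t => Y t ω)
  exact (@measurable_zetaInf Ω (MeasurableSpace.comap (fun ω t => Y t ω) MeasurableSpace.pi) Y θ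
    hc hm).comap_le

end Measurability

/-! ### Joint limit laws and the main theorem. -/

section Limit

variable {Ω : Type*} [MeasurableSpace Ω] {P : Measure Ω} [IsProbabilityMeasure P] {H θ μ : ℝ}
  {S : ℝ≥0 → Ω → ℝ}

theorem subfZetaVar_pos (hH0 : 0 < H) (hH1 : H < 1) (hθ : 0 < θ) : 0 < subfZetaVar θ H := by
  have h1 : 0 < Real.Gamma (2 * H + 1) := Real.Gamma_pos_of_pos (by linarith)
  have h2 : 0 < 1 - H := by linarith
  rw [subfZetaVar]
  positivity

theorem rpow_neg_mul_tendsto_zero (hH0 : 0 < H) :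
    Tendsto (fun T : ℝ≥0 => ((T : ℝ) ^ H)⁻¹) atTop (𝓝 0) :=
  (tendsto_inv_rpow_atTop hH0).comp tendsto_nnreal_coe_atTop

namespace IsRegularSubfractionalBM

omit [IsProbabilityMeasure P] in
theorem ae_isVasicekPath (hS : IsRegularSubfractionalBM H S P) (hθ : 0 < θ) {X : ℝ≥0 → Ω → ℝ}
    (hX : IsVasicekProcess θ μ S X P) : ∀ᵐ ω ∂P, IsVasicekPath θ μ (S · ω) (X · ω) := by
  filter_upwards [hX.continuous_paths, hX.equation] with ω h1 h2
  exact ⟨hθ, hS.continuous ω, hS.zero ω, hS.tendsto_div ω, h1, h2⟩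

/-- For H < 1 the Gaussian law of ζ_∞ is nondegenerate, so it has no atom at -μ. -/
theorem ae_add_zetaInf_ne_zero (hS : IsRegularSubfractionalBM H S P) (hH0 : 0 < H) (hH1 : H < 1)
    (hθ : 0 < θ) (μ : ℝ) : ∀ᵐ ω ∂P, μ + zetaInf θ (S · ω) ≠ 0 := by
  have hv : (subfZetaVar θ H).toNNReal ≠ 0 :=
    (Real.toNNReal_pos.2 (subfZetaVar_pos hH0 hH1 hθ)).ne'
  have := nullSingletonClass_gaussianReal (μ := 0) hv
  have h1 : ∀ᵐ z ∂gaussianReal 0 (subfZetaVar θ H).toNNReal, z ≠ -μ := by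
    rw [ae_iff]
    simp
  have h2 := ((hS.hasLaw_zetaInf hH0 hθ).ae_iff
    (measurableSet_setOfPred.1 (measurableSet_singleton (-μ)).compl)).2 h1
  filter_upwards [h2] with ω hω h0
  exact hω (eq_neg_of_add_eq_zero_right h0)

/-- Joint convergence of the normalised noise, the lagged mean and `ζ_∞`. -/
theorem tendstoInDistribution_triple (hS : IsRegularSubfractionalBM H S P) (hH0 : 0 < H)
    (hH1 : H < 1) (hθ : 0 < θ) {Ω' : Type*} [MeasurableSpace Ω'] {P' : Measure Ω'}
    [IsProbabilityMeasure P'] {N₁ N₂ Z : Ω' → ℝ} (h1 : HasLaw N₁ (gaussianReal 0 1) P')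
    (h2 : HasLaw N₂ (gaussianReal 0 1) P')
    (hZ : HasLaw Z (gaussianReal 0 (subfZetaVar θ H).toNNReal) P') (h12 : IndepFun N₁ N₂ P')
    (hNZ : IndepFun (fun ω' => (N₁ ω', N₂ ω')) Z P') :
    TendstoInDistribution
      (fun (T : ℝ≥0) ω => (!₂[((T : ℝ) ^ H)⁻¹ * (S T ω - 2 * laggedMean θ (S · ω) T),
        laggedMean θ (S · ω) T, zetaInf θ (S · ω)] : EuclideanSpace ℝ (Fin 3))) atTop
      (fun ω' => !₂[subfLambda H * N₁ ω', subfSigma θ H * N₂ ω', Z ω']) (fun _ => P) P' := by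
  have hlaw := hS.exists_hasLaw_comb hθ
  have hη : ∀ T, AEMeasurable (fun ω => laggedMean θ (S · ω) T) P := fun T => by
    obtain ⟨v, hv⟩ := hlaw T 0 1 0
    simpa using hv.aemeasurable
  have hζ := (hS.hasLaw_zetaInf hH0 hθ).aemeasurable
  have hN1 := h1.aemeasurable
  have hN2 := h2.aemeasurable
  refine tendstoInDistribution_of_hasLaw_gaussianReal
    (fun T => ((hS.measurable T).aemeasurable.sub ((hη T).const_mul 2)).const_mul _) hη
    (fun _ => hζ) (hN1.const_mul _) (hN2.const_mul _) hZ.aemeasurable fun a b c => ?_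
  -- The term -2T^{-H}η_T of the first coordinate is absorbed into the coefficient of η_T, which is
  -- why that coefficient varies with T.
  have hb : Tendsto (fun T : ℝ≥0 => b - 2 * a * ((T : ℝ) ^ H)⁻¹) atTop (𝓝 b) := by
    have := (rpow_neg_mul_tendsto_zero hH0).const_mul (2 * a)
    rw [mul_zero] at this
    simpa using this.const_sub b
  have hlim := hS.tendsto_integral_comb_sq hH0 hH1 hθ a hb c
  have hcomb : ∀ T : ℝ≥0, HasLaw (fun ω => a * (((T : ℝ) ^ H)⁻¹ *
      (S T ω - 2 * laggedMean θ (S · ω) T)) + b * laggedMean θ (S · ω) T + c * zetaInf θ (S · ω))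
      (gaussianReal 0 (∫ ω, (a * ((T : ℝ) ^ H)⁻¹ * S T ω + (b - 2 * a * ((T : ℝ) ^ H)⁻¹) *
        laggedMean θ (S · ω) T + c * zetaInf θ (S · ω)) ^ 2 ∂P).toNNReal) P := fun T => by
    obtain ⟨v, hv⟩ := hlaw T (a * ((T : ℝ) ^ H)⁻¹) (b - 2 * a * ((T : ℝ) ^ H)⁻¹) c
    have h0 := hv.integral_eq
    rw [integral_id_gaussianReal] at h0
    refine (hv.hasGaussianLaw.hasLaw_of_centered h0).congr (ae_of_all _ fun ω => ?_)
    ring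
  refine ⟨_, _, (continuous_real_toNNReal.tendsto _).comp hlim, hcomb, ?_⟩
  have hG := hasLaw_gaussianReal_comb h1 h2 hZ h12 hNZ (a * subfLambda H) (b * subfSigma θ H) c
  rw [Real.coe_toNNReal _ (subfZetaVar_pos hH0 hH1 hθ).le] at hG
  simpa only [mul_pow, mul_assoc] using hG

/-- Convergence in law of the normalised errors of a pair of estimators, of which the first has
error `2 θ η_T e^{-θT} / (μ + ζ_∞)` and the second has error `κ (S_T - 2 η_T) / T` up to terms of
smaller order, where `η` is the lagged mean. -/
theorem tendstoInDistribution_errors (hS : IsRegularSubfractionalBM H S P) (hH0 : 0 < H)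
    (hH1 : H < 1) (hθ : 0 < θ) {Ω' : Type*} [MeasurableSpace Ω'] {P' : Measure Ω'}
    [IsProbabilityMeasure P'] {N₁ N₂ Z : Ω' → ℝ} (h1 : HasLaw N₁ (gaussianReal 0 1) P')
    (h2 : HasLaw N₂ (gaussianReal 0 1) P')
    (hZ : HasLaw Z (gaussianReal 0 (subfZetaVar θ H).toNNReal) P') (h12 : IndepFun N₁ N₂ P')
    (hNZ : IndepFun (fun ω' => (N₁ ω', N₂ ω')) Z P') {U V : ℝ≥0 → Ω → ℝ} {κ v : ℝ}
    (hUm : ∀ T, AEMeasurable (U T) P) (hVm : ∀ T, AEMeasurable (V T) P)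
    (hU : ∀ᵐ ω ∂P, Tendsto (fun T : ℝ≥0 => U T ω
      - 2 * θ / (μ + zetaInf θ (S · ω)) * laggedMean θ (S · ω) T) atTop (𝓝 0))
    (hV : ∀ᵐ ω ∂P, Tendsto (fun T : ℝ≥0 => T * (V T ω - v)
      - κ * (S T ω - 2 * laggedMean θ (S · ω) T)) atTop (𝓝 0)) :
    TendstoInDistribution (fun (T : ℝ≥0) ω => (U T ω, (T : ℝ) ^ (1 - H) * (V T ω - v))) atTop
      (fun ω' => (2 * θ * subfSigma θ H * N₂ ω' / (μ + Z ω'), κ * subfLambda H * N₁ ω'))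
      (fun _ => P) P' := by
  have htriple := hS.tendstoInDistribution_triple hH0 hH1 hθ h1 h2 hZ h12 hNZ
  have hZne : ∀ᵐ ω' ∂P', μ + Z ω' ≠ 0 := by
    have h3 := hS.ae_add_zetaInf_ne_zero hH0 hH1 hθ μ
    have hms : Measurable fun z : ℝ => μ + z ≠ 0 := measurableSet_setOfPred.1
      ((by fun_prop : Measurable fun z : ℝ => μ + z) (measurableSet_singleton 0).compl)
    exact (hZ.ae_iff hms).2 (((hS.hasLaw_zetaInf hH0 hθ).ae_iff hms).1 h3)
  have hcoord : ∀ i, Continuous fun y : EuclideanSpace ℝ (Fin 3) => y i := fun i => by fun_prop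
  have hmap := htriple.comp_continuousOn
    (f := fun y : EuclideanSpace ℝ (Fin 3) => (2 * θ * y 1 / (μ + y 2), κ * y 0))
    (U := {y | μ + y 2 ≠ 0})
    (isOpen_ne_fun (continuous_const.add (hcoord 2)) continuous_const) (by fun_prop)
    ((((hcoord 1).const_mul _).continuousOn.div ((hcoord 2).const_add μ).continuousOn
      fun y hy => hy).prodMk ((hcoord 0).const_mul κ).continuousOn)
    (by simpa using hZne)
  have hYm : ∀ T : ℝ≥0, AEMeasurable (fun ω => (U T ω, (T : ℝ) ^ (1 - H) * (V T ω - v))) P :=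
    fun T => (hUm T).prodMk (((hVm T).sub_const v).const_mul _)
  -- Slutsky: the errors differ from the image of the Gaussian triple by a quantity that tends to
  -- zero almost surely, hence in measure.
  have hdiff := tendstoInDistribution_of_tendstoInMeasure_sub
    (fun (T : ℝ≥0) ω => (U T ω, (T : ℝ) ^ (1 - H) * (V T ω - v))) _ hmap ?_ hYm
  · refine hdiff.congr (fun T => .rfl) (ae_of_all _ fun ω' => ?_)
    simp [mul_assoc]
  · refine tendstoInMeasure_atTop_nnreal_of_tendsto_ae
      (fun T => ((hYm T).sub (hmap.forall_aemeasurable T)).aestronglyMeasurable) ?_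
    filter_upwards [hU, hV] with ω hUω hVω
    have hV' := (rpow_neg_mul_tendsto_zero hH0).mul hVω
    rw [zero_mul] at hV'
    refine (hUω.prodMk_nhds hV').congr' ?_
    filter_upwards [eventually_gt_atTop 0] with T hT
    have hT' : (0 : ℝ) < T := hT
    have hpow : (T : ℝ) ^ (1 - H) = ((T : ℝ) ^ H)⁻¹ * T := by
      rw [sub_eq_neg_add, Real.rpow_add hT', Real.rpow_one, Real.rpow_neg hT'.le]
    simp only [Pi.sub_apply, Function.comp, hpow, Prod.mk_sub_mk, Prod.mk.injEq]
    constructor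
    · simp
      ring
    · simp
      ring

end IsRegularSubfractionalBM

end Limit


theorem mainTheorem4 {Ω : Type*} [MeasurableSpace Ω] (P : Measure Ω) [IsProbabilityMeasure P]
    (H θ μ : ℝ) (hH0 : 0 < H) (hH1 : H < 1) (hθ : 0 < θ)
    (S X : ℝ≥0 → Ω → ℝ) (hS : IsSubfractionalBM H S P) (hX : IsVasicekProcess θ μ S X P) :
    -- strong consistency of both pairs of estimators
    (∀ᵐ ω ∂P, Tendsto (fun T : ℝ≥0 => (thetaTilde (X · ω) T, muTilde (X · ω) T))
      atTop (𝓝 (θ, μ))) ∧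
    (∀ᵐ ω ∂P, Tendsto (fun T : ℝ≥0 => (thetaTilde (X · ω) T, alphaTilde (X · ω) T))
      atTop (𝓝 (θ, μ * θ))) ∧
    -- the integral defining `ζ_∞` converges, and `ζ_∞` is centered Gaussian with known variance
    (∀ᵐ ω ∂P, IntegrableOn (fun s : ℝ => Real.exp (-θ * s) * S s.toNNReal ω) (Set.Ioi 0)) ∧
    HasLaw (fun ω => zetaInf θ (S · ω)) (gaussianReal 0 (subfZetaVar θ H).toNNReal) P ∧
    -- joint limits in law: `N₁`, `N₂` are standard normal, and `N₁`, `N₂`, `S` are independent,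
    -- on `Ω` itself (`π = id`) or on any extension `π : Ω' → Ω` of the probability space
    (∀ (Ω' : Type*) [MeasurableSpace Ω'] (P' : Measure Ω') [IsProbabilityMeasure P']
      (π : Ω' → Ω) (N₁ N₂ : Ω' → ℝ), MeasurePreserving π P' P →
      HasLaw N₁ (gaussianReal 0 1) P' → HasLaw N₂ (gaussianReal 0 1) P' →
      IndepFun N₁ N₂ P' →
      IndepFun (fun ω' => (N₁ ω', N₂ ω')) (fun ω' (t : ℝ≥0) => S t (π ω')) P' →
      IndepFun (fun ω' => (N₁ ω', N₂ ω')) (fun ω' => zetaInf θ (S · (π ω'))) P' ∧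
      TendstoInDistribution
        (fun (T : ℝ≥0) ω => (Real.exp (θ * T) * (thetaTilde (X · ω) T - θ),
          (T : ℝ) ^ (1 - H) * (muTilde (X · ω) T - μ)))
        atTop
        (fun ω' => (2 * θ * subfSigma θ H * N₂ ω' / (μ + zetaInf θ (S · (π ω'))),
          subfLambda H / θ * N₁ ω'))
        (fun _ => P) P' ∧
      TendstoInDistribution
        (fun (T : ℝ≥0) ω => (Real.exp (θ * T) * (thetaTilde (X · ω) T - θ),
          (T : ℝ) ^ (1 - H) * (alphaTilde (X · ω) T - μ * θ)))
        atTop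
        (fun ω' => (2 * θ * subfSigma θ H * N₂ ω' / (μ + zetaInf θ (S · (π ω'))),
          subfLambda H * N₁ ω'))
        (fun _ => P) P') := by
  obtain ⟨S', hS', hSS'⟩ := hS.exists_regular hH0 hH1
  have hX' : IsVasicekProcess θ μ S' X P := by
    refine ⟨hX.initial, hX.continuous_paths, ?_⟩
    filter_upwards [hX.equation, hSS'] with ω h1 h2 t
    rw [← h2]
    exact h1 t
  have hpath := hS'.ae_isVasicekPath hθ hX'
  have hne := hS'.ae_add_zetaInf_ne_zero hH0 hH1 hθ μ
  have hfun : ∀ᵐ ω ∂P, (S · ω) = (S' · ω) := hSS'.mono fun ω h => funext h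
  have hζ : (fun ω => zetaInf θ (S · ω)) =ᵐ[P] fun ω => zetaInf θ (S' · ω) :=
    hfun.mono fun ω h => congrArg (zetaInf θ) h
  have hζlaw : HasLaw (fun ω => zetaInf θ (S · ω))
      (gaussianReal 0 (subfZetaVar θ H).toNNReal) P := (hS'.hasLaw_zetaInf hH0 hθ).congr hζ
  -- No measurability of X is assumed: almost surely it equals the explicit solution driven by the
  -- regular version, and this makes the estimators almost everywhere measurable.
  have hsol : ∀ᵐ ω ∂P, (X · ω) = vasicekSol θ μ (S' · ω) :=
    hpath.mono fun ω h => funext h.eq_vasicekSol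
  have hcont : ∀ ω, Continuous fun t => vasicekSol θ μ (S' · ω) t := fun ω =>
    continuous_vasicekSol θ μ (hS'.continuous ω)
  have hmeas := measurable_vasicekSol θ μ hS'.continuous hS'.measurable
  have hmθ : ∀ T, AEMeasurable (fun ω => thetaTilde (X · ω) T) P := fun T =>
    ⟨_, measurable_thetaTilde hcont hmeas T, hsol.mono fun ω h => congrArg (thetaTilde · T) h⟩
  have hmα : ∀ T, AEMeasurable (fun ω => alphaTilde (X · ω) T) P := fun T =>
    ⟨_, measurable_alphaTilde hcont hmeas T, hsol.mono fun ω h => congrArg (alphaTilde · T) h⟩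
  have hmμ : ∀ T, AEMeasurable (fun ω => muTilde (X · ω) T) P := fun T =>
    ⟨_, measurable_muTilde hcont hmeas T, hsol.mono fun ω h => congrArg (muTilde · T) h⟩
  refine ⟨?_, ?_, ?_, hζlaw, ?_⟩
  · filter_upwards [hpath, hne] with ω h1 h2
    exact (h1.tendsto_thetaTilde h2).prodMk_nhds (h1.tendsto_muTilde h2)
  · filter_upwards [hpath, hne] with ω h1 h2
    exact (h1.tendsto_thetaTilde h2).prodMk_nhds (h1.tendsto_alphaTilde h2)
  · filter_upwards [hSS'] with ω h
    simp only [h]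
    exact (integrable_expWeight_iff hθ _).1
      (integrable_comp_toNNReal_expWeight hθ (hS'.continuous ω) (hS'.tendsto_div ω))
  · intro Ω' _ P' _ π N₁ N₂ hπ hN₁ hN₂ h12 hind
    -- The two versions agree as whole paths off a null set, so independence of the process passes
    -- to the regular version; being measure preserving, π pulls null sets back to null sets.
    have hfun' : (fun ω' (t : ℝ≥0) => S t (π ω')) =ᵐ[P'] fun ω' t => S' t (π ω') :=
      hπ.quasiMeasurePreserving.ae hfun
    have hζ' : (fun ω' => zetaInf θ (S · (π ω'))) =ᵐ[P'] fun ω' => zetaInf θ (S' · (π ω')) :=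
      hπ.quasiMeasurePreserving.ae hζ
    have hindζ : IndepFun (fun ω' => (N₁ ω', N₂ ω')) (fun ω' => zetaInf θ (S · (π ω'))) P' :=
      ((hind.congr .rfl hfun').zetaInf_right θ fun ω' => hS'.continuous (π ω')).congr .rfl hζ'.symm
    have hZ : HasLaw (fun ω' => zetaInf θ (S · (π ω')))
        (gaussianReal 0 (subfZetaVar θ H).toNNReal) P' := hζlaw.comp hπ.hasLaw
    have hU : ∀ᵐ ω ∂P, Tendsto (fun T : ℝ≥0 => Real.exp (θ * T) * (thetaTilde (X · ω) T - θ)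
        - 2 * θ / (μ + zetaInf θ (S' · ω)) * laggedMean θ (S' · ω) T) atTop (𝓝 0) := by
      filter_upwards [hpath, hne] with ω h1 h2
      exact h1.tendsto_theta_error h2
    have hUm : ∀ T : ℝ≥0, AEMeasurable
        (fun ω => Real.exp (θ * T) * (thetaTilde (X · ω) T - θ)) P := fun T =>
      ((hmθ T).sub_const θ).const_mul _
    refine ⟨hindζ, ?_, ?_⟩
    · have hlim := hS'.tendstoInDistribution_errors (κ := 1 / θ) hH0 hH1 hθ hN₁ hN₂ hZ h12 hindζ
        hUm hmμ hU (v := μ) (by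
          filter_upwards [hpath, hne] with ω h1 h2
          simpa only [one_div_mul_eq_div] using h1.tendsto_mu_error h2)
      simpa only [one_div_mul_eq_div] using hlim
    · have hlim := hS'.tendstoInDistribution_errors (κ := 1) hH0 hH1 hθ hN₁ hN₂ hZ h12 hindζ
        hUm hmα hU (v := μ * θ) (by
          filter_upwards [hpath, hne] with ω h1 h2
          simpa only [one_mul] using h1.tendsto_alpha_error h2)
      simpa only [one_mul] using hlim
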